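/- Let $n\ge 1$ and $t\ge 2$ be integers and let $q\in\mathbb C$ be non-zero and not a root of unity. Let $U_q=U_q(osp(1|2n))$ be the Jimbo quantum superalgebra over $\mathbb C$ with generators $e_i,f_i,K_i^{\pm1}$ ($1\le i\le n$; $e_n,f_n$ odd, all other generators even), with coproduct $\Delta(e_i)=e_i\otimes K_i+1\otimes e_i$, $\Delta(f_i)=f_i\otimes 1+K_i^{-1}\otimes f_i$, $\Delta(K_i^{\pm1})=K_i^{\pm1}\otimes K_i^{\pm1}$. Let $V$ be its fundamental $(2n+1)$-dimensional irreducible module with highest weight $\epsilon_1$ and weight basis $v_k$, $-n\le k\le n$ (weight $\epsilon_k$, with $\epsilon_{-k}=-\epsilon_k$, $\epsilon_0=0$; $v_0$ even, all other $v_k$ odd). Let $P(v\otimes w)=(-1)^{[v][w]}w\otimes v$ be the graded permutation, and let $\check{\mathcal R}=P\circ\mathcal E\circ\widetilde R$ on $V\otimes V$, where $\mathcal E(v_k\otimes v_m)=q^{(\epsilon_k,\epsilon_m)}v_k\otimes v_m$ and $\widetilde R=\prod_{\gamma}\widetilde R_\gamma$ is the (Khoroshkin–Tolstoy) product over the reduced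 positive roots $\gamma\in\{\epsilon_i\pm\epsilon_j,\epsilon_k: i<j\}$, taken in any normal ordering $\prec$ (if $\alpha\prec\beta$ and $\alpha+\beta$ is a reduced root then $\alpha\prec\alpha+\beta\prec\beta$), of $$\widetilde R_\gamma=\sum_{k\ge0}\frac{\big((-1)^{[\gamma]}(q-q^{-1})\big)^k\,(E_\gamma\otimes a_\gamma^{-1}F_\gamma)^k}{[k]_{q_\gamma}!},\qquad q_\gamma=(-1)^{[\gamma]}q^{-(\gamma,\gamma)},\quad [k]_x=\frac{1-x^k}{1-x}.$$ Here $[\gamma]$ is $1$ for $\gamma=\epsilon_k$ and $0$ otherwise. The root vectors are constructed recursively by $E_{\alpha_i}=e_i$, $F_{\alpha_i}=f_i$ for the simple roots, and $E_\gamma=[E_\alpha,E_\beta]_q$, $F_\gamma=[F_\beta,F_\alpha]_{q^{-1}}$ for $\gamma=\alpha+\beta$ with $\alpha\prec\beta$ a minimal pair of reduced roots (no other such decomposition of $\gamma$ lies strictly between $\alpha$ and $\beta$), with $[X_\alpha,X_\beta]_q=X_\alpha X_\beta-(-1)^{[\alpha][\beta]}q^{(\alpha,\beta)}X_\beta X_\alpha$.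 The scalar $a_\gamma$ is given by $E_\gamma F_\gamma-(-1)^{[\gamma]}F_\gamma E_\gamma=a_\gamma\,(K_\gamma-K_\gamma^{-1})/(q-q^{-1})$. For $1\le i\le t-1$ let $\check R_i=\mathrm{id}^{\otimes(i-1)}\otimes\check{\mathcal R}\otimes\mathrm{id}^{\otimes(t-i-1)}$ on $V^{\otimes t}$. For non-zero $r\in\mathbb C$ let $BW_t(r,q)$ be the Birman–Wenzl–Murakami algebra: the unital $\mathbb C$-algebra generated by invertible elements $g_1,\dots,g_{t-1}$ with relations $g_ig_j=g_jg_i$ ($|i-j|>1$), $g_ig_{i+1}g_i=g_{i+1}g_ig_{i+1}$ ($1\le i\le t-2$), $e_ig_i=r^{-1}e_i$ ($1\le i\le t-1$), $e_ig_{i-1}^{\pm1}e_i=r^{\pm1}e_i$ ($2\le i\le t-1$), where $(q-q^{-1})(1-e_i)=g_i-g_i^{-1}$. Then each $\check R_i$ is invertible and belongs to the algebra $\mathrm{End}_{U_q}(V^{\otimes t})$ of even $U_q$-linear endomorphisms; the algebra $\mathcal C_t$ generated by $\check R_1^{\pm1},\dots,\check R_{t-1}^{\pm1}$ is contained in $\mathrm{End}_{U_q}(V^{\otimes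 t})$; and there is a unique algebra homomorphism $$\Upsilon: BW_t(-q^{2n},q)\to\mathcal C_t\subseteq \mathrm{End}_{U_q}(V^{\otimes t}),\qquad \Upsilon(g_i)=-\check R_i\quad(1\le i\le t-1).$$ -/

import Mathlib

open scoped TensorProduct

namespace OspBMW

noncomputable section

set_option linter.unusedTactic false
set_option linter.unreachableTactic false
set_option linter.unusedSimpArgs false
set_option linter.unnecessarySeqFocus false

/-! ## Roots and weights of `osp(1|2n)` -/

/-- The weight lattice `⊕ ℤ ε_a`, in coordinates with respect to `ε_1, …, ε_n` (the vector `ε_{a+1}`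
is `Pi.single a 1`).  The bilinear form with `(ε_a, ε_b) = δ_{ab}` is the dot product `x ⬝ᵥ y`. -/
abbrev Weight (n : ℕ) : Type := Fin n → ℤ

/-- The simple roots `α_i = ε_i - ε_{i+1}` for `i < n` and `α_n = ε_n` (the index `i : Fin n` stands
for the mathematical index `i + 1`). -/
def simpleRoot {n : ℕ} (i : Fin n) : Weight n :=
  Pi.single i 1 - (if h : (i : ℕ) + 1 < n then Pi.single ⟨(i : ℕ) + 1, h⟩ 1 else 0)

/-- The Cartan integers `a_{ij} = 2 (α_i, α_j) / (α_i, α_i)` (the division is exact). -/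
def cartan {n : ℕ} (i j : Fin n) : ℤ :=
  2 * (simpleRoot i ⬝ᵥ simpleRoot j) / (simpleRoot i ⬝ᵥ simpleRoot i)

/-- The parity of the generators `e_i`, `f_i`: odd for `i = n`, even otherwise. -/
def genParity {n : ℕ} (i : Fin n) : ℕ := if (i : ℕ) + 1 = n then 1 else 0

/-- The odd positive roots `ε_k`. -/
def oddRoots (n : ℕ) : Set (Weight n) := {γ | ∃ k : Fin n, γ = Pi.single k 1}

/-- The reduced root system `φ = {ε_i ± ε_j, ε_k | i < j}`. -/
def reducedRoots (n : ℕ) : Set (Weight n) :=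
  oddRoots n ∪ {γ | ∃ i j : Fin n, i < j ∧
    (γ = Pi.single i 1 - Pi.single j 1 ∨ γ = Pi.single i 1 + Pi.single j 1)}

open Classical in
/-- The parity of the root vectors `E_γ`, `F_γ`. -/
def rootParity {n : ℕ} (γ : Weight n) : ℕ := if γ ∈ oddRoots n then 1 else 0

/-! ## The quantum superalgebra `U_q(osp(1|2n))` -/

/-- The iterated adjoint action `(ad_q x)^m y`, where
`(ad_q x) X = x X - (-1)^{[x][X]} k X k⁻¹ x`, for homogeneous `x`, `y` of parities `px`, `py`
(so that `(ad_q x)^m y` has parity `py + m px`); `k'` is the inverse of `k`. -/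
def adPow {A : Type*} [Ring A] (px py : ℕ) (x k k' y : A) : ℕ → A
  | 0 => y
  | m + 1 => x * adPow px py x k k' y m
      - (-1) ^ (px * (py + m * px)) * (k * adPow px py x k k' y m * k' * x)

/-- The generators `e_i`, `f_i`, `K_i`, `K_i⁻¹`. -/
inductive UGen (n : ℕ) : Type
  | e (i : Fin n) : UGen n
  | f (i : Fin n) : UGen n
  | K (i : Fin n) : UGen n
  | Kinv (i : Fin n) : UGen n

/-- The defining relations of `U_q(osp(1|2n))`, for elements `e_i, f_i, K_i, K_i⁻¹` of an arbitrary
algebra. -/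
structure IsURep {n : ℕ} {A : Type*} [Ring A] [Algebra ℂ A] (q : ℂ) (e f K K' : Fin n → A) :
    Prop where
  ef : ∀ i j, e i * f j - (-1) ^ (genParity i * genParity j) * (f j * e i) =
    if i = j then (q - q⁻¹)⁻¹ • (K i - K' i) else 0
  Ke : ∀ i j, K i * e j * K' i = q ^ (simpleRoot i ⬝ᵥ simpleRoot j) • e j
  Kf : ∀ i j, K i * f j * K' i = q ^ (-(simpleRoot i ⬝ᵥ simpleRoot j)) • f j
  KK : ∀ i j, K i * K j = K j * K i
  KK' : ∀ i j, K i * K' j = K' j * K i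
  K'K' : ∀ i j, K' i * K' j = K' j * K' i
  K_mul_K' : ∀ i, K i * K' i = 1
  K'_mul_K : ∀ i, K' i * K i = 1
  serre_e : ∀ i j, i ≠ j →
    adPow (genParity i) (genParity j) (e i) (K i) (K' i) (e j) (1 - cartan i j).toNat = 0
  serre_f : ∀ i j, i ≠ j →
    adPow (genParity i) (genParity j) (f i) (K' i) (K i) (f j) (1 - cartan i j).toNat = 0

namespace FreeU

variable {n : ℕ}

/-- The free generators. -/
def e (i : Fin n) : FreeAlgebra ℂ (UGen n) := FreeAlgebra.ι ℂ (UGen.e i)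
/-- The free generators. -/
def f (i : Fin n) : FreeAlgebra ℂ (UGen n) := FreeAlgebra.ι ℂ (UGen.f i)
/-- The free generators. -/
def K (i : Fin n) : FreeAlgebra ℂ (UGen n) := FreeAlgebra.ι ℂ (UGen.K i)
/-- The free generators. -/
def K' (i : Fin n) : FreeAlgebra ℂ (UGen n) := FreeAlgebra.ι ℂ (UGen.Kinv i)

end FreeU

open FreeU in
/-- The defining relations of `U_q(osp(1|2n))`, as a relation on the free algebra. -/
inductive URel (n : ℕ) (q : ℂ) : FreeAlgebra ℂ (UGen n) → FreeAlgebra ℂ (UGen n) → Prop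
  | ef (i j : Fin n) : URel n q (e i * f j - (-1) ^ (genParity i * genParity j) * (f j * e i))
      (if i = j then (q - q⁻¹)⁻¹ • (K i - K' i) else 0)
  | Ke (i j : Fin n) : URel n q (K i * e j * K' i) (q ^ (simpleRoot i ⬝ᵥ simpleRoot j) • e j)
  | Kf (i j : Fin n) : URel n q (K i * f j * K' i) (q ^ (-(simpleRoot i ⬝ᵥ simpleRoot j)) • f j)
  | KK (i j : Fin n) : URel n q (K i * K j) (K j * K i)
  | KK' (i j : Fin n) : URel n q (K i * K' j) (K' j * K i)
  | K'K' (i j : Fin n) : URel n q (K' i * K' j) (K' j * K' i)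
  | K_mul_K' (i : Fin n) : URel n q (K i * K' i) 1
  | K'_mul_K (i : Fin n) : URel n q (K' i * K i) 1
  | serre_e (i j : Fin n) (hij : i ≠ j) : URel n q
      (adPow (genParity i) (genParity j) (e i) (K i) (K' i) (e j) (1 - cartan i j).toNat) 0
  | serre_f (i j : Fin n) (hij : i ≠ j) : URel n q
      (adPow (genParity i) (genParity j) (f i) (K' i) (K i) (f j) (1 - cartan i j).toNat) 0

/-- The quantum superalgebra `U_q(osp(1|2n))`: the associative unital `ℂ`-algebra with generators
`e_i, f_i, K_i, K_i⁻¹` and the defining relations above. -/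
abbrev Uq (n : ℕ) (q : ℂ) : Type := RingQuot (URel n q)

namespace Uq

variable {n : ℕ} (q : ℂ)

/-- The quotient map from the free algebra. -/
def mk : FreeAlgebra ℂ (UGen n) →ₐ[ℂ] Uq n q := RingQuot.mkAlgHom ℂ (URel n q)

/-- The generator `e_i` of `U_q(osp(1|2n))`. -/
def e (i : Fin n) : Uq n q := mk q (FreeU.e i)

/-- The generator `f_i` of `U_q(osp(1|2n))`. -/
def f (i : Fin n) : Uq n q := mk q (FreeU.f i)

/-- The generator `K_i` of `U_q(osp(1|2n))`, as an invertible element. -/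
def K (i : Fin n) : (Uq n q)ˣ where
  val := mk q (FreeU.K i)
  inv := mk q (FreeU.K' i)
  val_inv := by
    rw [← map_mul, ← map_one (mk (n := n) q)]
    exact RingQuot.mkAlgHom_rel ℂ (URel.K_mul_K' i)
  inv_val := by
    rw [← map_mul, ← map_one (mk (n := n) q)]
    exact RingQuot.mkAlgHom_rel ℂ (URel.K'_mul_K i)

/-- `K_β = ∏ K_i^{m_i}` for `β = ∑ m_i α_i`; in the coordinates `β = ∑ β_a ε_a` one has
`m_i = ∑_{a ≤ i} β_a`. -/
def Kweight (β : Weight n) : (Uq n q)ˣ :=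
  (List.ofFn fun i : Fin n => K q i ^ (∑ a ∈ Finset.Iic i, β a)).prod

end Uq

theorem map_adPow {A B : Type*} [Ring A] [Ring B] [Algebra ℂ A] [Algebra ℂ B] (φ : A →ₐ[ℂ] B)
    (px py : ℕ) (x k k' y : A) (m : ℕ) :
    φ (adPow px py x k k' y m) = adPow px py (φ x) (φ k) (φ k') (φ y) m := by
  induction m with
  | zero => rfl
  | succ m ih => simp only [adPow, map_sub, map_mul, map_pow, map_neg, map_one, ih]

/-- Elements of `A` indexed by the generators. -/
def genMap {n : ℕ} {A : Type*} (e f K K' : Fin n → A) : UGen n → A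
  | UGen.e i => e i
  | UGen.f i => f i
  | UGen.K i => K i
  | UGen.Kinv i => K' i

/-- The algebra homomorphism `U_q(osp(1|2n)) → A` determined by elements of `A` that satisfy the
defining relations. -/
def Uq.lift {n : ℕ} {q : ℂ} {A : Type*} [Ring A] [Algebra ℂ A] {e f K K' : Fin n → A}
    (h : IsURep q e f K K') : Uq n q →ₐ[ℂ] A :=
  RingQuot.liftAlgHom ℂ ⟨FreeAlgebra.lift ℂ (genMap e f K K'), by
    have he : ∀ i, FreeAlgebra.lift ℂ (genMap e f K K') (FreeU.e i) = e i := fun i => by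
      simp [FreeU.e, genMap]
    have hf : ∀ i, FreeAlgebra.lift ℂ (genMap e f K K') (FreeU.f i) = f i := fun i => by
      simp [FreeU.f, genMap]
    have hK : ∀ i, FreeAlgebra.lift ℂ (genMap e f K K') (FreeU.K i) = K i := fun i => by
      simp [FreeU.K, genMap]
    have hK' : ∀ i, FreeAlgebra.lift ℂ (genMap e f K K') (FreeU.K' i) = K' i := fun i => by
      simp [FreeU.K', genMap]
    intro x y hxy
    induction hxy with
    | ef i j =>
      have := h.ef i j
      split_ifs at this ⊢ <;>
        simpa only [map_sub, map_mul, map_pow, map_neg, map_one, map_smul, map_zero, he, hf, hK,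
          hK'] using this
    | Ke i j => simpa only [map_mul, map_smul, he, hf, hK, hK'] using h.Ke i j
    | Kf i j => simpa only [map_mul, map_smul, he, hf, hK, hK'] using h.Kf i j
    | KK i j => simpa only [map_mul, hK, hK'] using h.KK i j
    | KK' i j => simpa only [map_mul, hK, hK'] using h.KK' i j
    | K'K' i j => simpa only [map_mul, hK, hK'] using h.K'K' i j
    | K_mul_K' i => simpa only [map_mul, map_one, hK, hK'] using h.K_mul_K' i
    | K'_mul_K i => simpa only [map_mul, map_one, hK, hK'] using h.K'_mul_K i
    | serre_e i j hij =>
      simpa only [map_adPow, map_zero, he, hf, hK, hK'] using h.serre_e i j hij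
    | serre_f i j hij =>
      simpa only [map_adPow, map_zero, he, hf, hK, hK'] using h.serre_f i j hij⟩

/-! ## The fundamental module `V` -/

/-- The index set `{-n, …, n}` of the basis of `V`. -/
abbrev Idx (n : ℕ) : Type := Set.Icc (-(n : ℤ)) n

/-- The `(2n+1)`-dimensional space `V`, with its standard basis `v_k`, `-n ≤ k ≤ n`. -/
def V (n : ℕ) : Type := Idx n → ℂ

instance (n : ℕ) : AddCommGroup (V n) := inferInstanceAs (AddCommGroup (Idx n → ℂ))

instance (n : ℕ) : Module ℂ (V n) := inferInstanceAs (Module ℂ (Idx n → ℂ))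

/-- The basis `(v_k)` of `V`. -/
def vBasis (n : ℕ) : Module.Basis (Idx n) ℂ (V n) := Pi.basisFun ℂ (Idx n)

instance (n : ℕ) : Module.Free ℂ (V n) := Module.Free.of_basis (vBasis n)

instance (n : ℕ) : Module.Finite ℂ (V n) := Module.Finite.of_basis (vBasis n)

/-- The basis vector `v_k` for `-n ≤ k ≤ n` (and `0` for other `k`). -/
def vec {n : ℕ} (k : ℤ) : V n :=
  if h : k ∈ Set.Icc (-(n : ℤ)) n then vBasis n ⟨k, h⟩ else 0

/-- The parity of `v_k`: even for `k = 0` and odd otherwise (`v_1`, of weight `ε_1`, is odd). -/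
def vParity (k : ℤ) : ℕ := if k = 0 then 0 else 1

/-- The weight `ε_k` of `v_k`, with `ε_0 = 0` and `ε_{-k} = -ε_k`. -/
def eps {n : ℕ} (k : ℤ) : Weight n := fun a =>
  if k = (a : ℤ) + 1 then 1 else if k = -((a : ℤ) + 1) then -1 else 0

/-- The vector `e_i v_k`. -/
def eAct {n : ℕ} (i : Fin n) (k : ℤ) : V n :=
  if (i : ℕ) + 1 = n then
    if k = 0 then vec n else if k = -(n : ℤ) then -vec 0 else 0
  else
    if k = (i : ℤ) + 2 then vec ((i : ℤ) + 1)
    else if k = -((i : ℤ) + 1) then vec (-((i : ℤ) + 2)) else 0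

/-- The vector `f_i v_k`. -/
def fAct {n : ℕ} (i : Fin n) (k : ℤ) : V n :=
  if (i : ℕ) + 1 = n then
    if k = n then vec 0 else if k = 0 then vec (-(n : ℤ)) else 0
  else
    if k = (i : ℤ) + 1 then vec ((i : ℤ) + 2)
    else if k = -((i : ℤ) + 2) then vec (-((i : ℤ) + 1)) else 0

/-- The operator `e_i` on `V`. -/
def eV {n : ℕ} (i : Fin n) : Module.End ℂ (V n) := (vBasis n).constr ℂ fun k => eAct i k

/-- The operator `f_i` on `V`. -/
def fV {n : ℕ} (i : Fin n) : Module.End ℂ (V n) := (vBasis n).constr ℂ fun k => fAct i k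

/-- The operator `v_k ↦ q^{(β, ε_k)} v_k` on `V`; for `β = ± α_i` this is `K_i^{±1}`. -/
def KV {n : ℕ} (q : ℂ) (β : Weight n) : Module.End ℂ (V n) :=
  (vBasis n).constr ℂ fun k => q ^ (β ⬝ᵥ eps (k : ℤ)) • vec (k : ℤ)

/-- The parity operator `v ↦ (-1)^{[v]} v` on `V`. -/
def parityV (n : ℕ) : Module.End ℂ (V n) :=
  (vBasis n).constr ℂ fun k => (-1 : ℂ) ^ vParity (k : ℤ) • vec (k : ℤ)

theorem vBasis_eq_vec {n : ℕ} (k : Idx n) : vBasis n k = vec (k : ℤ) := by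
  simp only [vec, dif_pos k.2]

theorem vec_eq_zero {n : ℕ} {k : ℤ} (h : ¬ (-(n : ℤ) ≤ k ∧ k ≤ n)) : (vec k : V n) = 0 := by
  simp only [vec, Set.mem_Icc, dif_neg h]

theorem end_ext {n : ℕ} {M : Type*} [AddCommGroup M] [Module ℂ M] {f g : V n →ₗ[ℂ] M}
    (h : ∀ k : ℤ, f (vec k) = g (vec k)) : f = g :=
  (vBasis n).ext fun k => by rw [vBasis_eq_vec]; exact h k

theorem constr_vec {n : ℕ} {M : Type*} [AddCommGroup M] [Module ℂ M] (F : ℤ → M)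
    (hF : ∀ k : ℤ, ¬ (-(n : ℤ) ≤ k ∧ k ≤ n) → F k = 0) (k : ℤ) :
    (vBasis n).constr ℂ (fun k : Idx n => F k) (vec k) = F k := by
  by_cases h : -(n : ℤ) ≤ k ∧ k ≤ n
  · have h' : k ∈ Set.Icc (-(n : ℤ)) n := h
    have : vec k = vBasis n ⟨k, h'⟩ := by simp only [vec, dif_pos h']
    rw [this, Module.Basis.constr_basis]
  · rw [vec_eq_zero h, map_zero, hF k h]

theorem eV_vec {n : ℕ} (i : Fin n) (k : ℤ) : eV i (vec k) = eAct i k := by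
  refine constr_vec (fun k => eAct i k) (fun k hk => ?_) k
  have := i.2
  unfold eAct
  split_ifs <;> first | (exfalso; omega) | rfl

theorem fV_vec {n : ℕ} (i : Fin n) (k : ℤ) : fV i (vec k) = fAct i k := by
  refine constr_vec (fun k => fAct i k) (fun k hk => ?_) k
  have := i.2
  unfold fAct
  split_ifs <;> first | (exfalso; omega) | rfl

theorem KV_vec {n : ℕ} (q : ℂ) (β : Weight n) (k : ℤ) :
    KV q β (vec k) = q ^ (β ⬝ᵥ eps k) • vec k := by
  refine constr_vec (fun k => q ^ (β ⬝ᵥ eps k) • vec k) (fun k hk => ?_) k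
  simp only [vec_eq_zero hk, smul_zero]

theorem parityV_vec {n : ℕ} (k : ℤ) :
    parityV n (vec k) = (-1 : ℂ) ^ vParity k • vec k := by
  refine constr_vec (fun k => (-1 : ℂ) ^ vParity k • (vec k : V n)) (fun k hk => ?_) k
  simp only [vec_eq_zero hk, smul_zero]

theorem simpleRoot_apply {n : ℕ} (i a : Fin n) :
    simpleRoot i a = (if a = i then 1 else 0) - (if (a : ℕ) = i + 1 then 1 else 0) := by
  unfold simpleRoot
  by_cases h : (i : ℕ) + 1 < n
  · simp [h, Pi.single_apply, Fin.ext_iff]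
  · have := a.2
    have h2 : ¬ ((a : ℕ) = i + 1) := by omega
    simp [h, Pi.single_apply, h2]

theorem simpleRoot_dot {n : ℕ} (i : Fin n) (β : Weight n) :
    simpleRoot i ⬝ᵥ β = β i - (if h : (i : ℕ) + 1 < n then β ⟨(i : ℕ) + 1, h⟩ else 0) := by
  unfold simpleRoot
  rw [sub_dotProduct]
  split_ifs <;> simp

theorem simpleRoot_dot_simpleRoot {n : ℕ} (i j : Fin n) :
    simpleRoot i ⬝ᵥ simpleRoot j =
      if i = j then (if (i : ℕ) + 1 = n then 1 else 2)
      else if (i : ℕ) + 1 = j ∨ (j : ℕ) + 1 = i then -1 else 0 := by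
  have := i.2
  have := j.2
  rw [simpleRoot_dot]
  simp only [simpleRoot_apply, Fin.ext_iff]
  split_ifs <;> omega

theorem simpleRoot_dot_eps {n : ℕ} (i : Fin n) (k : ℤ) :
    simpleRoot i ⬝ᵥ eps k =
      if (i : ℕ) + 1 = n then (if k = n then 1 else if k = -(n : ℤ) then -1 else 0)
      else if k = (i : ℤ) + 1 ∨ k = -((i : ℤ) + 2) then 1
      else if k = (i : ℤ) + 2 ∨ k = -((i : ℤ) + 1) then -1 else 0 := by
  have := i.2
  rw [simpleRoot_dot]
  simp only [eps]
  split_ifs <;> omega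

theorem KV_eAct {n : ℕ} {q : ℂ} (h0 : q ≠ 0) (β : Weight n) (j : Fin n) (k : ℤ) :
    KV q β (eAct j k) = (q ^ (β ⬝ᵥ eps k) * q ^ (β ⬝ᵥ simpleRoot j)) • eAct j k := by
  have hj := j.2
  have key : ∀ k' : ℤ, (eps k' : Weight n) = eps k + simpleRoot j →
      KV q β (vec k') = (q ^ (β ⬝ᵥ eps k) * q ^ (β ⬝ᵥ simpleRoot j)) • vec k' := by
    intro k' h
    rw [KV_vec, h, dotProduct_add, zpow_add₀ h0]
  unfold eAct
  split_ifs with h1 h2 h3 h2 h3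
  · refine key _ (funext fun a => ?_)
    have := a.2
    simp only [eps, Pi.add_apply, simpleRoot_apply, Fin.ext_iff]
    split_ifs <;> omega
  · rw [map_neg, smul_neg, key _ (funext fun a => ?_)]
    have := a.2
    simp only [eps, Pi.add_apply, simpleRoot_apply, Fin.ext_iff]
    split_ifs <;> omega
  · simp
  · refine key _ (funext fun a => ?_)
    have := a.2
    simp only [eps, Pi.add_apply, simpleRoot_apply, Fin.ext_iff]
    split_ifs <;> omega
  · refine key _ (funext fun a => ?_)
    have := a.2
    simp only [eps, Pi.add_apply, simpleRoot_apply, Fin.ext_iff]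
    split_ifs <;> omega
  · simp

theorem KV_fAct {n : ℕ} {q : ℂ} (h0 : q ≠ 0) (β : Weight n) (j : Fin n) (k : ℤ) :
    KV q β (fAct j k) = (q ^ (β ⬝ᵥ eps k) * q ^ (-(β ⬝ᵥ simpleRoot j))) • fAct j k := by
  have hj := j.2
  have key : ∀ k' : ℤ, (eps k' : Weight n) = eps k - simpleRoot j →
      KV q β (vec k') = (q ^ (β ⬝ᵥ eps k) * q ^ (-(β ⬝ᵥ simpleRoot j))) • vec k' := by
    intro k' h
    rw [KV_vec, h, dotProduct_sub, sub_eq_add_neg, zpow_add₀ h0]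
  unfold fAct
  split_ifs with h1 h2 h3 h2 h3
  · refine key _ (funext fun a => ?_)
    have := a.2
    simp only [eps, Pi.sub_apply, simpleRoot_apply, Fin.ext_iff]
    split_ifs <;> omega
  · refine key _ (funext fun a => ?_)
    have := a.2
    simp only [eps, Pi.sub_apply, simpleRoot_apply, Fin.ext_iff]
    split_ifs <;> omega
  · simp
  · refine key _ (funext fun a => ?_)
    have := a.2
    simp only [eps, Pi.sub_apply, simpleRoot_apply, Fin.ext_iff]
    split_ifs <;> omega
  · refine key _ (funext fun a => ?_)
    have := a.2
    simp only [eps, Pi.sub_apply, simpleRoot_apply, Fin.ext_iff]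
    split_ifs <;> omega
  · simp

theorem KV_mul_KV {n : ℕ} {q : ℂ} (h0 : q ≠ 0) (β γ : Weight n) :
    KV q β * KV q γ = KV q (β + γ) := by
  refine end_ext fun k => ?_
  simp only [Module.End.mul_apply, KV_vec, map_smul, smul_smul, add_dotProduct, zpow_add₀ h0]
  rw [mul_comm]

theorem KV_zero {n : ℕ} (q : ℂ) : KV q (0 : Weight n) = 1 := by
  refine end_ext fun k => ?_
  simp [KV_vec]

theorem KV_mul_KV_neg {n : ℕ} {q : ℂ} (h0 : q ≠ 0) (β : Weight n) :
    KV q β * KV q (-β) = 1 := by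
  rw [KV_mul_KV h0, add_neg_cancel, KV_zero]

theorem KV_neg_mul_KV {n : ℕ} {q : ℂ} (h0 : q ≠ 0) (β : Weight n) :
    KV q (-β) * KV q β = 1 := by
  rw [KV_mul_KV h0, neg_add_cancel, KV_zero]

theorem KV_eV {n : ℕ} {q : ℂ} (h0 : q ≠ 0) (β : Weight n) (j : Fin n) :
    KV q β * eV j = q ^ (β ⬝ᵥ simpleRoot j) • (eV j * KV q β) := by
  refine end_ext fun k => ?_
  simp only [Module.End.mul_apply, LinearMap.smul_apply, KV_vec, map_smul, eV_vec, KV_eAct h0,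
    smul_smul]
  rw [mul_comm]

theorem KV_fV {n : ℕ} {q : ℂ} (h0 : q ≠ 0) (β : Weight n) (j : Fin n) :
    KV q β * fV j = q ^ (-(β ⬝ᵥ simpleRoot j)) • (fV j * KV q β) := by
  refine end_ext fun k => ?_
  simp only [Module.End.mul_apply, LinearMap.smul_apply, KV_vec, map_smul, fV_vec, KV_fAct h0,
    smul_smul]
  rw [mul_comm]

theorem eV_mul_eV {n : ℕ} {i j : Fin n} (h1 : (i : ℕ) + 1 ≠ j) (h2 : (j : ℕ) + 1 ≠ i)
    (h3 : (i : ℕ) ≠ j) : (eV i * eV j : Module.End ℂ (V n)) = 0 := by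
  have := i.2
  have := j.2
  refine end_ext fun k => ?_
  simp only [Module.End.mul_apply, eV_vec, LinearMap.zero_apply]
  unfold eAct
  split_ifs <;> simp only [eV_vec, map_neg, map_zero] <;> unfold eAct <;> split_ifs <;>
    first | (exfalso; omega) | rfl | simp

theorem fV_mul_fV {n : ℕ} {i j : Fin n} (h1 : (i : ℕ) + 1 ≠ j) (h2 : (j : ℕ) + 1 ≠ i)
    (h3 : (i : ℕ) ≠ j) : (fV i * fV j : Module.End ℂ (V n)) = 0 := by
  have := i.2
  have := j.2
  refine end_ext fun k => ?_
  simp only [Module.End.mul_apply, fV_vec, LinearMap.zero_apply]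
  unfold fAct
  split_ifs <;> simp only [fV_vec, map_zero] <;> unfold fAct <;> split_ifs <;>
    first | (exfalso; omega) | rfl

theorem eV_sq {n : ℕ} {i : Fin n} (h : (i : ℕ) + 1 ≠ n) :
    (eV i * eV i : Module.End ℂ (V n)) = 0 := by
  have := i.2
  refine end_ext fun k => ?_
  simp only [Module.End.mul_apply, eV_vec, LinearMap.zero_apply]
  unfold eAct
  split_ifs <;> simp only [eV_vec, map_neg, map_zero] <;> unfold eAct <;> split_ifs <;>
    first | (exfalso; omega) | rfl

theorem fV_sq {n : ℕ} {i : Fin n} (h : (i : ℕ) + 1 ≠ n) :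
    (fV i * fV i : Module.End ℂ (V n)) = 0 := by
  have := i.2
  refine end_ext fun k => ?_
  simp only [Module.End.mul_apply, fV_vec, LinearMap.zero_apply]
  unfold fAct
  split_ifs <;> simp only [fV_vec, map_zero] <;> unfold fAct <;> split_ifs <;>
    first | (exfalso; omega) | rfl

theorem eV_mul_mul {n : ℕ} {i j : Fin n} (h : (i : ℕ) + 1 ≠ n)
    (h2 : (i : ℕ) + 1 = j ∨ (j : ℕ) + 1 = i) :
    (eV i * (eV j * eV i) : Module.End ℂ (V n)) = 0 := by
  have := i.2
  have := j.2
  refine end_ext fun k => ?_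
  simp only [Module.End.mul_apply, eV_vec, LinearMap.zero_apply]
  unfold eAct
  split_ifs <;> simp only [eV_vec, map_neg, map_zero] <;> unfold eAct <;> split_ifs <;>
    first
    | (exfalso; omega)
    | (simp only [eV_vec, map_neg, map_zero] <;> unfold eAct <;> split_ifs <;>
        first | (exfalso; omega) | rfl | simp)
    | simp

theorem fV_mul_mul {n : ℕ} {i j : Fin n} (h : (i : ℕ) + 1 ≠ n)
    (h2 : (i : ℕ) + 1 = j ∨ (j : ℕ) + 1 = i) :
    (fV i * (fV j * fV i) : Module.End ℂ (V n)) = 0 := by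
  have := i.2
  have := j.2
  refine end_ext fun k => ?_
  simp only [Module.End.mul_apply, fV_vec, LinearMap.zero_apply]
  unfold fAct
  split_ifs <;> simp only [fV_vec, map_zero] <;> unfold fAct <;> split_ifs <;>
    first
    | (exfalso; omega)
    | (simp only [fV_vec, map_zero] <;> unfold fAct <;> split_ifs <;>
        first | (exfalso; omega) | rfl | simp)
    | simp

theorem eV_sq_last {n : ℕ} {i : Fin n} (h : (i : ℕ) + 1 = n) (k : ℤ) :
    eV i (eV i (vec k)) = if k = -(n : ℤ) then -(vec n : V n) else 0 := by
  have := i.2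
  simp only [eV_vec]
  unfold eAct
  split_ifs <;> simp only [eV_vec, map_neg, map_zero] <;> unfold eAct <;> split_ifs <;>
    first | (exfalso; omega) | rfl

theorem fV_sq_last {n : ℕ} {i : Fin n} (h : (i : ℕ) + 1 = n) (k : ℤ) :
    fV i (fV i (vec k)) = if k = n then (vec (-(n : ℤ)) : V n) else 0 := by
  have := i.2
  simp only [fV_vec]
  unfold fAct
  split_ifs <;> simp only [fV_vec, map_zero] <;> unfold fAct <;> split_ifs <;>
    first | (exfalso; omega) | rfl

theorem eV_cube {n : ℕ} {i : Fin n} (h : (i : ℕ) + 1 = n) :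
    (eV i * (eV i * eV i) : Module.End ℂ (V n)) = 0 := by
  have := i.2
  refine end_ext fun k => ?_
  simp only [Module.End.mul_apply, eV_sq_last h, LinearMap.zero_apply]
  split_ifs <;> simp only [eV_vec, map_neg, map_zero]
  unfold eAct
  split_ifs <;> first | (exfalso; omega) | simp

theorem fV_cube {n : ℕ} {i : Fin n} (h : (i : ℕ) + 1 = n) :
    (fV i * (fV i * fV i) : Module.End ℂ (V n)) = 0 := by
  have := i.2
  refine end_ext fun k => ?_
  simp only [Module.End.mul_apply, fV_sq_last h, LinearMap.zero_apply]
  split_ifs <;> simp only [fV_vec, map_zero]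
  unfold fAct
  split_ifs <;> first | (exfalso; omega) | rfl

theorem eV_four {n : ℕ} {i j : Fin n} (h : (i : ℕ) + 1 = n) (h2 : (j : ℕ) + 1 = i) :
    (eV i * (eV i * (eV j * eV i)) : Module.End ℂ (V n)) = 0 ∧
    (eV i * (eV j * (eV i * eV i)) : Module.End ℂ (V n)) = 0 := by
  have := i.2
  have := j.2
  constructor
  · refine end_ext fun k => ?_
    simp only [Module.End.mul_apply, eV_vec, LinearMap.zero_apply]
    unfold eAct
    split_ifs <;> simp only [eV_vec, map_neg, map_zero] <;> unfold eAct <;> split_ifs <;>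
      first
      | (exfalso; omega)
      | (simp only [eV_sq_last h, map_neg, map_zero] <;> split_ifs <;>
          first | (exfalso; omega) | rfl | simp)
      | simp
  · refine end_ext fun k => ?_
    simp only [Module.End.mul_apply, eV_sq_last h, LinearMap.zero_apply]
    split_ifs <;> simp only [eV_vec, map_neg, map_zero]
    unfold eAct
    split_ifs <;> first
      | (exfalso; omega)
      | (simp only [eV_vec, map_neg, map_zero] <;> unfold eAct <;> split_ifs <;>
          first | (exfalso; omega) | rfl | simp)
      | simp

theorem fV_four {n : ℕ} {i j : Fin n} (h : (i : ℕ) + 1 = n) (h2 : (j : ℕ) + 1 = i) :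
    (fV i * (fV i * (fV j * fV i)) : Module.End ℂ (V n)) = 0 ∧
    (fV i * (fV j * (fV i * fV i)) : Module.End ℂ (V n)) = 0 := by
  have := i.2
  have := j.2
  constructor
  · refine end_ext fun k => ?_
    simp only [Module.End.mul_apply, fV_vec, LinearMap.zero_apply]
    unfold fAct
    split_ifs <;> simp only [fV_vec, map_zero] <;> unfold fAct <;> split_ifs <;>
      first
      | (exfalso; omega)
      | (simp only [fV_sq_last h, map_zero] <;> split_ifs <;>
          first | (exfalso; omega) | rfl | simp)
      | simp
  · refine end_ext fun k => ?_
    simp only [Module.End.mul_apply, fV_sq_last h, LinearMap.zero_apply]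
    split_ifs <;> simp only [fV_vec, map_zero]
    unfold fAct
    split_ifs <;> first
      | (exfalso; omega)
      | (simp only [fV_vec, map_zero] <;> unfold fAct <;> split_ifs <;>
          first | (exfalso; omega) | rfl | simp)
      | simp

theorem serre_cases {n : ℕ} {i j : Fin n} (hij : i ≠ j) :
    ((i : ℕ) + 1 = n ∧ (j : ℕ) + 1 = i ∧ (1 - cartan i j).toNat = 3) ∨
    ((i : ℕ) + 1 ≠ n ∧ ((i : ℕ) + 1 = j ∨ (j : ℕ) + 1 = i) ∧ (1 - cartan i j).toNat = 2) ∨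
    ((i : ℕ) + 1 ≠ j ∧ (j : ℕ) + 1 ≠ i ∧ (1 - cartan i j).toNat = 1) := by
  have := i.2
  have := j.2
  simp only [cartan, simpleRoot_dot_simpleRoot, if_neg hij, if_true]
  rw [Fin.ext_iff.ne] at hij
  split_ifs <;> simp <;> omega

/-! Auxiliary: the `q`-Serre expressions once the conjugation by `K_i` has been carried out. -/

/-- `X_0 = y`, `X_{m+1} = x X_m - c d^m X_m x`. -/
def skew {A : Type*} [Ring A] [Algebra ℂ A] (c d : ℂ) (x y : A) : ℕ → A
  | 0 => y
  | m + 1 => x * skew c d x y m - (c * d ^ m) • (skew c d x y m * x)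

theorem neg_one_pow_mul {A : Type*} [Ring A] [Algebra ℂ A] (k : ℕ) (a : A) :
    (-1) ^ k * a = ((-1 : ℂ) ^ k) • a := by
  rcases Nat.even_or_odd k with h | h <;> simp [h.neg_one_pow]

theorem adPow_eq_skew {A : Type*} [Ring A] [Algebra ℂ A] {c d : ℂ} {px py : ℕ} {x k k' y : A}
    (h : k' * k = 1) (hx : k * x * k' = c • x) (hy : k * y * k' = d • y) (m : ℕ) :
    adPow px py x k k' y m = skew ((-1) ^ (px * py) * d) ((-1) ^ (px * px) * c) x y m := by
  suffices hh : k * adPow px py x k k' y m * k' = (d * c ^ m) • adPow px py x k k' y m ∧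
      adPow px py x k k' y m = skew ((-1) ^ (px * py) * d) ((-1) ^ (px * px) * c) x y m from hh.2
  induction m with
  | zero => simpa [adPow, skew] using hy
  | succ m ih =>
    obtain ⟨ih1, ih2⟩ := ih
    have e1 : adPow px py x k k' y (m + 1) = x * adPow px py x k k' y m -
        ((-1) ^ (px * (py + m * px)) * (d * c ^ m)) • (adPow px py x k k' y m * x) := by
      simp only [adPow]
      rw [ih1, neg_one_pow_mul, smul_mul_assoc, smul_smul]
    set X := adPow px py x k k' y m with hX
    have m1 : k * (x * X) * k' = (d * c ^ (m + 1)) • (x * X) := by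
      calc k * (x * X) * k' = k * x * 1 * X * k' := by simp only [mul_one, mul_assoc]
        _ = (k * x * k') * (k * X * k') := by rw [← h]; simp only [mul_assoc]
        _ = _ := by
          rw [hx, ih1, smul_mul_assoc, mul_smul_comm, smul_smul]; congr 1; ring
    have m2 : k * (X * x) * k' = (d * c ^ (m + 1)) • (X * x) := by
      calc k * (X * x) * k' = k * X * 1 * x * k' := by simp only [mul_one, mul_assoc]
        _ = (k * X * k') * (k * x * k') := by rw [← h]; simp only [mul_assoc]
        _ = _ := by
          rw [hx, ih1, smul_mul_assoc, mul_smul_comm, smul_smul]; congr 1; ring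
    constructor
    · rw [e1, mul_sub, sub_mul, m1, mul_smul_comm, smul_mul_assoc, m2, smul_sub, smul_comm]
    · rw [e1, ih2]
      simp only [skew]
      congr 2
      rw [Nat.mul_add, pow_add, mul_pow, ← pow_mul]
      have : px * (m * px) = px * px * m := by ring
      rw [this]; ring

theorem skew_one_eq_zero {A : Type*} [Ring A] [Algebra ℂ A] (c d : ℂ) {x y : A}
    (h1 : x * y = 0) (h2 : y * x = 0) : skew c d x y 1 = 0 := by
  simp [skew, h1, h2]

theorem skew_two_eq_zero {A : Type*} [Ring A] [Algebra ℂ A] (c d : ℂ) {x y : A}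
    (h1 : x * x = 0) (h2 : x * (y * x) = 0) : skew c d x y 2 = 0 := by
  have h3 : x * (x * y) = 0 := by rw [← mul_assoc, h1, zero_mul]
  simp [skew, mul_sub, sub_mul, mul_assoc, h1, h2, h3]

theorem skew_three_eq_zero {A : Type*} [Ring A] [Algebra ℂ A] (c d : ℂ) {x y : A}
    (h1 : x * (x * x) = 0) (h2 : x * (x * (y * x)) = 0) (h3 : x * (y * (x * x)) = 0) :
    skew c d x y 3 = 0 := by
  have h4 : x * (x * (x * y)) = 0 := by
    have : x * (x * (x * y)) = x * (x * x) * y := by simp only [mul_assoc]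
    rw [this, h1, zero_mul]
  simp [skew, mul_sub, sub_mul, mul_assoc, h1, h2, h3, h4]

theorem isURep_V {n : ℕ} {q : ℂ} (h0 : q ≠ 0) (h1 : q ^ 2 ≠ 1) :
    IsURep q (eV (n := n)) fV (fun i => KV q (simpleRoot i)) (fun i => KV q (-simpleRoot i)) := by
  have hKe : ∀ β : Weight n, ∀ j, KV q β * eV j * KV q (-β) =
      q ^ (β ⬝ᵥ simpleRoot j) • eV j := fun β j => by
    rw [KV_eV h0, smul_mul_assoc, mul_assoc, KV_mul_KV_neg h0, mul_one]
  have hKf : ∀ β : Weight n, ∀ j, KV q β * fV j * KV q (-β) =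
      q ^ (-(β ⬝ᵥ simpleRoot j)) • fV j := fun β j => by
    rw [KV_fV h0, smul_mul_assoc, mul_assoc, KV_mul_KV_neg h0, mul_one]
  have hKf' : ∀ β : Weight n, ∀ j, KV q (-β) * fV j * KV q β =
      q ^ (β ⬝ᵥ simpleRoot j) • fV j := fun β j => by
    have := hKf (-β) j
    rwa [neg_neg, neg_dotProduct, neg_neg] at this
  refine ⟨fun i j => ?_, fun i j => hKe _ j, fun i j => hKf _ j, fun i j => ?_, fun i j => ?_,
    fun i j => ?_, fun i => KV_mul_KV_neg h0 _, fun i => KV_neg_mul_KV h0 _, fun i j hij => ?_,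
    fun i j hij => ?_⟩
  · have hi := i.2
    have hj := j.2
    have hq : q - q⁻¹ ≠ 0 := fun h => h1 (by field_simp at h; linear_combination h)
    have hneg : (q - q⁻¹)⁻¹ * (q ^ (-1 : ℤ) - q ^ (-(-1) : ℤ)) = -1 := by
      rw [neg_neg, zpow_one, zpow_neg_one, ← neg_sub q q⁻¹, mul_neg, inv_mul_cancel₀ hq]
    refine end_ext fun k => ?_
    rw [neg_one_pow_mul]
    by_cases hij : i = j
    · subst hij
      rw [if_pos rfl]
      simp only [LinearMap.sub_apply, LinearMap.smul_apply, Module.End.mul_apply, eV_vec, fV_vec,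
        KV_vec, neg_dotProduct, simpleRoot_dot_eps, ← sub_smul, smul_smul, genParity]
      unfold eAct fAct
      split_ifs <;> simp only [eV_vec, fV_vec, map_neg, map_zero] <;> (try unfold eAct) <;>
        (try unfold fAct) <;> (try split_ifs) <;>
        first
        | (exfalso; omega)
        | (subst_vars; simp; done)
        | (subst_vars; simp [hq]; done)
        | (rw [hneg]; subst_vars; simp; done)
    · rw [if_neg hij]
      rw [Fin.ext_iff] at hij
      simp only [LinearMap.sub_apply, LinearMap.smul_apply, Module.End.mul_apply, eV_vec, fV_vec,
        LinearMap.zero_apply]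
      unfold eAct fAct
      split_ifs <;> simp only [eV_vec, fV_vec, map_neg, map_zero] <;> (try unfold eAct) <;>
        (try unfold fAct) <;> (try split_ifs) <;> first | (exfalso; omega) | simp
  · rw [KV_mul_KV h0, KV_mul_KV h0, add_comm]
  · rw [KV_mul_KV h0, KV_mul_KV h0, add_comm]
  · rw [KV_mul_KV h0, KV_mul_KV h0, add_comm]
  · rw [adPow_eq_skew (KV_neg_mul_KV h0 _) (hKe _ _) (hKe _ _)]
    obtain ⟨a, b, c⟩ | ⟨a, b, c⟩ | ⟨a, b, c⟩ := serre_cases hij <;> rw [c]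
    · exact skew_three_eq_zero _ _ (eV_cube a) (eV_four a b).1 (eV_four a b).2
    · exact skew_two_eq_zero _ _ (eV_sq a) (eV_mul_mul a b)
    · rw [Fin.ext_iff.ne] at hij
      exact skew_one_eq_zero _ _ (eV_mul_eV a b hij) (eV_mul_eV b a hij.symm)
  · rw [adPow_eq_skew (KV_mul_KV_neg h0 _) (hKf' _ _) (hKf' _ _)]
    obtain ⟨a, b, c⟩ | ⟨a, b, c⟩ | ⟨a, b, c⟩ := serre_cases hij <;> rw [c]
    · exact skew_three_eq_zero _ _ (fV_cube a) (fV_four a b).1 (fV_four a b).2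
    · exact skew_two_eq_zero _ _ (fV_sq a) (fV_mul_mul a b)
    · rw [Fin.ext_iff.ne] at hij
      exact skew_one_eq_zero _ _ (fV_mul_fV a b hij) (fV_mul_fV b a hij.symm)

theorem skew_succ {A : Type*} [Ring A] [Algebra ℂ A] (c d : ℂ) (x y : A) (m : ℕ) :
    skew c d x y (m + 1) = x * skew c d x y m - (c * d ^ m) • (skew c d x y m * x) := rfl

theorem skew_add_right {A : Type*} [Ring A] [Algebra ℂ A] (c d : ℂ) (x y z : A) (m : ℕ) :
    skew c d x (y + z) m = skew c d x y m + skew c d x z m := by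
  induction m with
  | zero => rfl
  | succ m ih => simp only [skew_succ, ih, mul_add, add_mul, smul_add]; abel

/-- The `q`-Serre relations pass to sums of `q`-commuting pairs. -/
theorem skew_add_eq_zero {A : Type*} [Ring A] [Algebra ℂ A] {c d : ℂ} {x₁ x₂ y₁ y₂ : A} {N : ℕ}
    (hxx : x₁ * x₂ = d • (x₂ * x₁)) (hxy : x₁ * y₂ = c • (y₂ * x₁))
    (hyx : y₁ * x₂ = c • (x₂ * y₁)) (h1 : skew c d x₁ y₁ N = 0) (h2 : skew c d x₂ y₂ N = 0)
    (hN : (N = 1 ∧ c ^ 2 = 1) ∨ (N = 2 ∧ c ^ 2 * d = 1) ∨ (N = 3 ∧ c ^ 2 * d ^ 2 = 1)) :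
    skew c d (x₁ + x₂) (y₁ + y₂) N = 0 := by
  have hB : ∀ m, x₁ * skew c d x₂ y₂ m = (c * d ^ m) • (skew c d x₂ y₂ m * x₁) ∧
      skew c d (x₁ + x₂) y₂ m = skew c d x₂ y₂ m := by
    intro m
    induction m with
    | zero => exact ⟨by simpa [skew] using hxy, rfl⟩
    | succ m ih =>
      obtain ⟨ih1, ih2⟩ := ih
      constructor
      · simp only [skew_succ, mul_sub, sub_mul, mul_smul_comm, smul_mul_assoc, smul_sub]
        rw [← mul_assoc, hxx, ← mul_assoc x₁, ih1]
        simp only [smul_mul_assoc, mul_assoc, ih1, hxx, mul_smul_comm, smul_smul]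
        congr 1 <;> congr 1 <;> ring
      · rw [skew_succ, ih2, skew_succ, add_mul, mul_add, ih1, smul_add]; abel
  rw [skew_add_right, (hB N).2, h2, add_zero]
  have hY : ∀ m, skew c d x₁ y₁ m * x₂ = (c * d ^ m) • (x₂ * skew c d x₁ y₁ m) := by
    intro m
    induction m with
    | zero => simpa [skew] using hyx
    | succ m ih =>
      simp only [skew_succ, mul_sub, sub_mul, mul_smul_comm, smul_mul_assoc, smul_sub]
      rw [mul_assoc, ih, mul_assoc, hxx]
      simp only [mul_smul_comm, smul_mul_assoc, ← mul_assoc, ih, hxx, smul_smul]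
      congr 1 <;> congr 1 <;> ring
  set Y := skew c d x₁ y₁ with hYdef
  have hs : ∀ m, x₁ * Y m = Y (m + 1) + (c * d ^ m) • (Y m * x₁) := fun m => by
    rw [hYdef, skew_succ]; abel
  have hx2 : ∀ m, x₁ * (x₂ * Y m) = d • (x₂ * Y (m + 1)) + (c * d ^ (m + 1)) • (x₂ * (Y m * x₁)) :=
    fun m => by
      rw [← mul_assoc, hxx, smul_mul_assoc, mul_assoc, hs, mul_add, smul_add, mul_smul_comm,
        smul_smul]
      congr 2; ring
  have s1 : skew c d (x₁ + x₂) y₁ 1 = Y 1 + (1 - c ^ 2) • (x₂ * Y 0) := by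
    have e0 : skew c d (x₁ + x₂) y₁ 0 = Y 0 := rfl
    have h0 := hY 0
    have h0' := hs 0
    simp only [pow_zero, mul_one, zero_add] at h0 h0'
    rw [skew_succ, e0, add_mul, mul_add, h0', h0]
    simp only [pow_zero, mul_one, smul_add, smul_smul]
    module
  have s2 : skew c d (x₁ + x₂) y₁ 2 = Y 2 + ((1 + d) * (1 - c ^ 2 * d)) • (x₂ * Y 1) +
      ((1 - c ^ 2) * (1 - c ^ 2 * d)) • (x₂ * (x₂ * Y 0)) := by
    rw [skew_succ, s1]
    simp only [add_mul, mul_add, mul_smul_comm, smul_mul_assoc, mul_assoc, hs, hx2, hY, smul_add,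
      smul_smul]
    module
  have hx3 : x₁ * (x₂ * (x₂ * Y 0)) = (d ^ 2) • (x₂ * (x₂ * Y 1)) +
      (c * d ^ 2) • (x₂ * (x₂ * (Y 0 * x₁))) := by
    rw [← mul_assoc, hxx, smul_mul_assoc, mul_assoc, hx2]
    simp only [mul_add, mul_smul_comm, smul_add, smul_smul]
    congr 2 <;> ring
  have s3 : skew c d (x₁ + x₂) y₁ 3 = Y 3 +
      ((1 - c ^ 2 * d ^ 4) + (1 + d) * (1 - c ^ 2 * d) * d) • (x₂ * Y 2) +
      ((1 + d) * (1 - c ^ 2 * d) * (1 - c ^ 2 * d ^ 3) + (1 - c ^ 2) * (1 - c ^ 2 * d) * d ^ 2) •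
        (x₂ * (x₂ * Y 1)) +
      ((1 - c ^ 2) * (1 - c ^ 2 * d) * (1 - c ^ 2 * d ^ 2)) • (x₂ * (x₂ * (x₂ * Y 0))) := by
    rw [skew_succ, s2]
    simp only [add_mul, mul_add, mul_smul_comm, smul_mul_assoc, mul_assoc, hs, hx2, hx3, hY,
      smul_add, smul_smul]
    module
  obtain ⟨rfl, hc⟩ | ⟨rfl, hc⟩ | ⟨rfl, hc⟩ := hN
  · rw [s1, h1, hc]; simp
  · rw [s2, h1, hc]; simp
  · have a1 : (1 - c ^ 2 * d ^ 4) + (1 + d) * (1 - c ^ 2 * d) * d = 0 := by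
      linear_combination (-(d ^ 2) - d - 1) * hc
    have a2 : (1 + d) * (1 - c ^ 2 * d) * (1 - c ^ 2 * d ^ 3) +
        (1 - c ^ 2) * (1 - c ^ 2 * d) * d ^ 2 = 0 := by
      linear_combination (1 - c ^ 2 * d) * (-(d ^ 2) - d - 1) * hc
    rw [s3, h1, a1, a2, hc]; simp

/-! ## The tensor powers `V^{⊗t}` -/

/-- The tensor power `V^{⊗t}`. -/
abbrev TV (n t : ℕ) : Type := PiTensorProduct ℂ fun _ : Fin t => V n

/-- The operator `l ⊗ … ⊗ l ⊗ x ⊗ r ⊗ … ⊗ r` on `V^{⊗t}`, with `x` in position `j`. -/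
def siteOp {n t : ℕ} (l x r : Module.End ℂ (V n)) (j : Fin t) : Module.End ℂ (TV n t) :=
  PiTensorProduct.map fun k => if k < j then l else if k = j then x else r

/-- The operator `∑_j l^{⊗(j-1)} ⊗ x ⊗ r^{⊗(t-j)}` on `V^{⊗t}`. -/
def sumOp {n : ℕ} (t : ℕ) (l x r : Module.End ℂ (V n)) : Module.End ℂ (TV n t) :=
  ∑ j, siteOp l x r j

/-- The operator `x ⊗ … ⊗ x` on `V^{⊗t}`. -/
def diagOp {n : ℕ} (t : ℕ) (x : Module.End ℂ (V n)) : Module.End ℂ (TV n t) :=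
  PiTensorProduct.map fun _ => x

/-- The action of `e_i` on `V^{⊗t}`.  The iterated coproduct of `Δ(e_i) = e_i ⊗ K_i + 1 ⊗ e_i` is
`∑_j 1^{⊗(j-1)} ⊗ e_i ⊗ K_i^{⊗(t-j)}`, and moving `e_i` past the first `j - 1` vectors produces
the sign `(-1)^{[e_i]([w_1] + … + [w_{j-1}])}`. -/
def eT {n : ℕ} (q : ℂ) (t : ℕ) (i : Fin n) : Module.End ℂ (TV n t) :=
  sumOp t (parityV n ^ genParity i) (eV i) (KV q (simpleRoot i))

/-- The action of `f_i` on `V^{⊗t}`.  The iterated coproduct of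
`Δ(f_i) = f_i ⊗ 1 + K_i⁻¹ ⊗ f_i` is `∑_j (K_i⁻¹)^{⊗(j-1)} ⊗ f_i ⊗ 1^{⊗(t-j)}`, with signs as for
`e_i`. -/
def fT {n : ℕ} (q : ℂ) (t : ℕ) (i : Fin n) : Module.End ℂ (TV n t) :=
  sumOp t (KV q (-simpleRoot i) * parityV n ^ genParity i) (fV i) 1

/-- The action of `K_i^{±1}` on `V^{⊗t}` (for `β = ± α_i`), from `Δ(K_i^{±1}) = K_i^{±1} ⊗ K_i^{±1}`.
-/
def KT {n : ℕ} (q : ℂ) (t : ℕ) (β : Weight n) : Module.End ℂ (TV n t) := diagOp t (KV q β)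

theorem map_mul_map_eq_smul {n t : ℕ} {f g f' g' : Fin t → Module.End ℂ (V n)} (c : Fin t → ℂ)
    (h : ∀ k, f k * g k = c k • (f' k * g' k)) :
    (PiTensorProduct.map f * PiTensorProduct.map g : Module.End ℂ (TV n t)) =
      (∏ k, c k) • (PiTensorProduct.map f' * PiTensorProduct.map g') := by
  rw [← PiTensorProduct.map_mul, ← PiTensorProduct.map_mul]
  have : (fun k => f k * g k) = fun k => c k • (f' k * g' k) := funext h
  rw [this]
  exact (PiTensorProduct.mapMultilinear ℂ (fun _ : Fin t => V n) (fun _ => V n)).map_smul_univ c _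

theorem siteOp_mul_lt {n t : ℕ} {l x r l' x' r' : Module.End ℂ (V n)} {c₁ c₂ : ℂ} {j k : Fin t}
    (hjk : j < k) (hll : l * l' = l' * l) (hxl : x * l' = c₁ • (l' * x)) (hrl : r * l' = l' * r)
    (hrx : r * x' = c₂ • (x' * r)) (hrr : r * r' = r' * r) :
    siteOp l x r j * siteOp l' x' r' k = (c₁ * c₂) • (siteOp l' x' r' k * siteOp l x r j) := by
  have := map_mul_map_eq_smul (t := t)
    (f := fun m => if m < j then l else if m = j then x else r)
    (g := fun m => if m < k then l' else if m = k then x' else r')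
    (f' := fun m => if m < k then l' else if m = k then x' else r')
    (g' := fun m => if m < j then l else if m = j then x else r)
    (fun m => (if m = j then c₁ else 1) * (if m = k then c₂ else 1)) (fun m => ?_)
  · unfold siteOp
    rw [this, Finset.prod_mul_distrib]
    simp
  · split_ifs <;> first | (exfalso; omega) | simp [*]

theorem diag_siteOp {n t : ℕ} {a b x l r : Module.End ℂ (V n)} {c : ℂ} (hl : a * l * b = l)
    (hr : a * r * b = r) (hx : a * x * b = c • x) (j : Fin t) :
    diagOp t a * siteOp l x r j * diagOp t b = c • siteOp l x r j := by
  unfold diagOp siteOp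
  rw [← PiTensorProduct.map_mul]
  have := map_mul_map_eq_smul (t := t)
    (f := fun m => a * (if m < j then l else if m = j then x else r)) (g := fun _ => b)
    (f' := fun m => if m < j then l else if m = j then x else r) (g' := fun _ => 1)
    (fun m => if m = j then c else 1) (fun m => ?_)
  · rw [this, PiTensorProduct.map_one, mul_one]
    simp
  · split_ifs <;> first | (exfalso; omega) | simp [*]

theorem diag_sumOp {n t : ℕ} {a b x l r : Module.End ℂ (V n)} {c : ℂ} (hl : a * l * b = l)
    (hr : a * r * b = r) (hx : a * x * b = c • x) :
    diagOp t a * sumOp t l x r * diagOp t b = c • sumOp t l x r := by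
  unfold sumOp
  rw [Finset.mul_sum, Finset.sum_mul, Finset.smul_sum]
  exact Finset.sum_congr rfl fun j _ => diag_siteOp hl hr hx j

theorem diagOp_mul {n t : ℕ} (a b : Module.End ℂ (V n)) :
    diagOp t a * diagOp t b = diagOp t (a * b) := (PiTensorProduct.map_mul _ _).symm

theorem diagOp_one {n t : ℕ} : diagOp t (1 : Module.End ℂ (V n)) = 1 := PiTensorProduct.map_one

theorem parityV_mul_self (n : ℕ) : parityV n * parityV n = 1 := by
  refine end_ext fun k => ?_
  rw [Module.End.mul_apply, parityV_vec, map_smul, parityV_vec, smul_smul, ← mul_pow]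
  simp

theorem parityV_KV {n : ℕ} (q : ℂ) (β : Weight n) : parityV n * KV q β = KV q β * parityV n := by
  refine end_ext fun k => ?_
  simp only [Module.End.mul_apply, parityV_vec, KV_vec, map_smul, smul_smul, mul_comm]

theorem parityV_eV {n : ℕ} (j : Fin n) :
    parityV n * eV j = (-1 : ℂ) ^ genParity j • (eV j * parityV n) := by
  have := j.2
  refine end_ext fun k => ?_
  simp only [Module.End.mul_apply, LinearMap.smul_apply, parityV_vec, map_smul, eV_vec, smul_smul]
  unfold eAct genParity vParity
  split_ifs <;> simp only [map_neg, map_zero, parityV_vec, vParity] <;> (try split_ifs) <;>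
    first | (exfalso; omega) | simp

theorem parityV_fV {n : ℕ} (j : Fin n) :
    parityV n * fV j = (-1 : ℂ) ^ genParity j • (fV j * parityV n) := by
  have := j.2
  refine end_ext fun k => ?_
  simp only [Module.End.mul_apply, LinearMap.smul_apply, parityV_vec, map_smul, fV_vec, smul_smul]
  unfold fAct genParity vParity
  split_ifs <;> simp only [map_zero, parityV_vec, vParity] <;> (try split_ifs) <;>
    first | (exfalso; omega) | simp

theorem genParity_le {n : ℕ} (i : Fin n) : genParity i = 0 ∨ genParity i = 1 := by
  unfold genParity; split_ifs <;> simp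

theorem parity_pow_mul_self {n : ℕ} (i : Fin n) :
    parityV n ^ genParity i * parityV n ^ genParity i = 1 := by
  rcases genParity_le i with h | h <;> simp [h, parityV_mul_self]

theorem parity_pow_KV {n : ℕ} (q : ℂ) (i : Fin n) (β : Weight n) :
    parityV n ^ genParity i * KV q β = KV q β * parityV n ^ genParity i := by
  rcases genParity_le i with h | h <;> simp [h, parityV_KV]

theorem eV_parity_pow {n : ℕ} (i j : Fin n) : eV j * parityV n ^ genParity i =
    (-1 : ℂ) ^ (genParity i * genParity j) • (parityV n ^ genParity i * eV j) := by
  rcases genParity_le i with h | h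
  · simp [h]
  · rw [h, pow_one, one_mul, parityV_eV, smul_smul, ← mul_pow]; simp

theorem fV_parity_pow {n : ℕ} (i j : Fin n) : fV j * parityV n ^ genParity i =
    (-1 : ℂ) ^ (genParity i * genParity j) • (parityV n ^ genParity i * fV j) := by
  rcases genParity_le i with h | h
  · simp [h]
  · rw [h, pow_one, one_mul, parityV_fV, smul_smul, ← mul_pow]; simp

theorem eV_KV {n : ℕ} {q : ℂ} (h0 : q ≠ 0) (β : Weight n) (j : Fin n) :
    eV j * KV q β = q ^ (-(β ⬝ᵥ simpleRoot j)) • (KV q β * eV j) := by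
  rw [KV_eV h0, smul_smul, ← zpow_add₀ h0]; simp

theorem fV_KV {n : ℕ} {q : ℂ} (h0 : q ≠ 0) (β : Weight n) (j : Fin n) :
    fV j * KV q β = q ^ (β ⬝ᵥ simpleRoot j) • (KV q β * fV j) := by
  rw [KV_fV h0, smul_smul, ← zpow_add₀ h0]; simp

/-- The sum over the first `m` positions. -/
def partialSum {n t : ℕ} (l x r : Module.End ℂ (V n)) (m : ℕ) : Module.End ℂ (TV n t) :=
  ∑ j ∈ Finset.univ.filter (fun j : Fin t => (j : ℕ) < m), siteOp l x r j

theorem partialSum_succ {n t : ℕ} (l x r : Module.End ℂ (V n)) {m : ℕ} (hm : m < t) :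
    partialSum (t := t) l x r (m + 1) = partialSum l x r m + siteOp l x r ⟨m, hm⟩ := by
  unfold partialSum
  have : (Finset.univ.filter fun j : Fin t => (j : ℕ) < m + 1) =
      insert ⟨m, hm⟩ (Finset.univ.filter fun j : Fin t => (j : ℕ) < m) := by
    ext j
    simp only [Finset.mem_filter, Finset.mem_univ, true_and, Finset.mem_insert, Fin.ext_iff]
    omega
  rw [this, Finset.sum_insert (by simp), add_comm]

theorem partialSum_self {n t : ℕ} (l x r : Module.End ℂ (V n)) :
    partialSum (t := t) l x r t = sumOp t l x r := by
  unfold partialSum sumOp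
  rw [Finset.filter_true_of_mem fun j _ => j.2]

theorem partialSum_mul_siteOp {n t : ℕ} {l x r l' x' r' : Module.End ℂ (V n)} {c : ℂ} {m : ℕ}
    (hm : m < t)
    (h : ∀ j k : Fin t, j < k →
      siteOp l x r j * siteOp l' x' r' k = c • (siteOp l' x' r' k * siteOp l x r j)) :
    partialSum l x r m * siteOp l' x' r' ⟨m, hm⟩ =
      c • (siteOp l' x' r' ⟨m, hm⟩ * partialSum l x r m) := by
  unfold partialSum
  rw [Finset.sum_mul, Finset.mul_sum, Finset.smul_sum]
  refine Finset.sum_congr rfl fun j hj => h j _ ?_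
  simpa [Fin.lt_def] using hj

theorem siteOp_mul_siteOp {n t : ℕ} (l x r l' x' r' : Module.End ℂ (V n)) (j : Fin t) :
    siteOp l x r j * siteOp l' x' r' j = siteOp (l * l') (x * x') (r * r') j := by
  unfold siteOp
  rw [← PiTensorProduct.map_mul]
  congr 1
  funext k
  split_ifs <;> rfl

theorem siteOp_eq_update {n t : ℕ} (l x r : Module.End ℂ (V n)) (j : Fin t) :
    siteOp l x r j = PiTensorProduct.mapMultilinear ℂ (fun _ : Fin t => V n) (fun _ => V n)
      (Function.update (fun k => if k < j then l else r) j x) := by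
  unfold siteOp
  rw [PiTensorProduct.mapMultilinear_apply]
  congr 1
  funext k
  by_cases h : k = j
  · subst h; simp
  · simp [h]

theorem siteOp_sub {n t : ℕ} (l x y r : Module.End ℂ (V n)) (j : Fin t) :
    siteOp l (x - y) r j = siteOp l x r j - siteOp l y r j := by
  have h : siteOp l (x - y) r j + siteOp l y r j = (siteOp l x r j : Module.End ℂ (TV n t)) := by
    rw [siteOp_eq_update, siteOp_eq_update, siteOp_eq_update, ← MultilinearMap.map_update_add,
      sub_add_cancel]
  exact eq_sub_of_add_eq h

theorem siteOp_smul {n t : ℕ} (c : ℂ) (l x r : Module.End ℂ (V n)) (j : Fin t) :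
    siteOp l (c • x) r j = c • siteOp l x r j := by
  rw [siteOp_eq_update, siteOp_eq_update]
  exact (PiTensorProduct.mapMultilinear ℂ (fun _ : Fin t => V n) (fun _ => V n)).map_update_smul
    _ _ _ _

theorem siteOp_zero {n t : ℕ} (l r : Module.End ℂ (V n)) (j : Fin t) :
    siteOp l 0 r j = 0 := by
  simpa using siteOp_smul 0 l 0 r j

theorem skew_siteOp {n t : ℕ} {l x r l' x' r' : Module.End ℂ (V n)} (hl : l * l' = l' * l)
    (hr : r * r' = r' * r) (c d : ℂ) (j : Fin t) (m : ℕ) :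
    skew c d (siteOp l x r j) (siteOp l' x' r' j) m =
      siteOp (l ^ m * l') (skew c d x x' m) (r ^ m * r') j := by
  induction m with
  | zero => simp [skew]
  | succ m ih =>
    have h1 : l ^ m * l' * l = l ^ (m + 1) * l' := by
      rw [mul_assoc, ← hl, ← mul_assoc, pow_succ]
    have h2 : r ^ m * r' * r = r ^ (m + 1) * r' := by
      rw [mul_assoc, ← hr, ← mul_assoc, pow_succ]
    rw [skew_succ, ih, siteOp_mul_siteOp, siteOp_mul_siteOp, h1, h2, ← mul_assoc, ← mul_assoc,
      ← pow_succ', ← pow_succ', skew_succ, siteOp_sub, siteOp_smul]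

theorem serre_coef {n : ℕ} {q : ℂ} (h0 : q ≠ 0) {i j : Fin n} (hij : i ≠ j) {c d : ℂ} {N : ℕ}
    (hc : c = (-1) ^ (genParity i * genParity j) * q ^ (simpleRoot i ⬝ᵥ simpleRoot j))
    (hd : d = (-1) ^ (genParity i * genParity i) * q ^ (simpleRoot i ⬝ᵥ simpleRoot i))
    (hN : N = (1 - cartan i j).toNat) :
    (N = 1 ∧ c ^ 2 = 1) ∨ (N = 2 ∧ c ^ 2 * d = 1) ∨ (N = 3 ∧ c ^ 2 * d ^ 2 = 1) := by
  have hi := i.2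
  have hj := j.2
  have hgg : genParity i * genParity j = 0 := by
    rw [Fin.ext_iff.ne] at hij
    unfold genParity
    split_ifs <;> first | (exfalso; omega) | simp
  rw [hgg, pow_zero, one_mul, simpleRoot_dot_simpleRoot, if_neg hij] at hc
  rw [simpleRoot_dot_simpleRoot, if_pos rfl] at hd
  obtain ⟨a, b, e⟩ | ⟨a, b, e⟩ | ⟨a, b, e⟩ := serre_cases hij
  · refine Or.inr (Or.inr ⟨hN.trans e, ?_⟩)
    rw [if_pos (Or.inr b)] at hc
    rw [if_pos a] at hd
    have : genParity i = 1 := by simp [genParity, a]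
    rw [hc, hd, this]
    simp [h0]
  · refine Or.inr (Or.inl ⟨hN.trans e, ?_⟩)
    rw [if_pos b] at hc
    rw [if_neg a] at hd
    have : genParity i = 0 := by simp [genParity, a]
    rw [hc, hd, this]
    field_simp
    simp
  · refine Or.inl ⟨hN.trans e, ?_⟩
    rw [if_neg (by tauto)] at hc
    rw [hc]; simp

theorem KV_comm {n : ℕ} {q : ℂ} (h0 : q ≠ 0) (β γ : Weight n) :
    KV q β * KV q γ = KV q γ * KV q β := by
  rw [KV_mul_KV h0, KV_mul_KV h0, add_comm]

theorem parity_pow_comm {n : ℕ} (i j : Fin n) :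
    parityV n ^ genParity i * parityV n ^ genParity j =
      parityV n ^ genParity j * parityV n ^ genParity i := by
  rw [← pow_add, ← pow_add, add_comm]

theorem siteOp_e_comm {n t : ℕ} {q : ℂ} (h0 : q ≠ 0) : ∀ (i j : Fin n) (a b : Fin t), a < b →
    siteOp (parityV n ^ genParity i) (eV i) (KV q (simpleRoot i)) a *
      siteOp (parityV n ^ genParity j) (eV j) (KV q (simpleRoot j)) b =
    ((-1) ^ (genParity i * genParity j) * q ^ (simpleRoot i ⬝ᵥ simpleRoot j)) •
      (siteOp (parityV n ^ genParity j) (eV j) (KV q (simpleRoot j)) b *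
        siteOp (parityV n ^ genParity i) (eV i) (KV q (simpleRoot i)) a) := by
  have hKK : ∀ β γ : Weight n, KV q β * KV q γ = KV q γ * KV q β := KV_comm h0
  have hσσ := parity_pow_comm (n := n)
  have hinv : ∀ β : Weight n, KV q β * KV q (-β) = 1 := KV_mul_KV_neg h0
  have hinv' : ∀ β : Weight n, KV q (-β) * KV q β = 1 := KV_neg_mul_KV h0
  intro i j a b hab
  refine siteOp_mul_lt hab (hσσ i j) ?_ (parity_pow_KV q j _).symm (KV_eV h0 _ j) (hKK _ _)
  rw [eV_parity_pow, mul_comm (genParity j)]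

theorem siteOp_f_comm {n t : ℕ} {q : ℂ} (h0 : q ≠ 0) : ∀ (i j : Fin n) (a b : Fin t), a < b →
    siteOp (KV q (-simpleRoot i) * parityV n ^ genParity i) (fV i) 1 b *
      siteOp (KV q (-simpleRoot j) * parityV n ^ genParity j) (fV j) 1 a =
    ((-1) ^ (genParity i * genParity j) * q ^ (simpleRoot i ⬝ᵥ simpleRoot j)) •
      (siteOp (KV q (-simpleRoot j) * parityV n ^ genParity j) (fV j) 1 a *
        siteOp (KV q (-simpleRoot i) * parityV n ^ genParity i) (fV i) 1 b) := by
  have hKK : ∀ β γ : Weight n, KV q β * KV q γ = KV q γ * KV q β := KV_comm h0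
  have hσσ := parity_pow_comm (n := n)
  have hinv : ∀ β : Weight n, KV q β * KV q (-β) = 1 := KV_mul_KV_neg h0
  have hinv' : ∀ β : Weight n, KV q (-β) * KV q β = 1 := KV_neg_mul_KV h0
  intro i j a b hab
  have key := siteOp_mul_lt (l := KV q (-simpleRoot j) * parityV n ^ genParity j) (x := fV j)
    (r := 1) (l' := KV q (-simpleRoot i) * parityV n ^ genParity i) (x' := fV i) (r' := 1)
    (c₁ := (-1) ^ (genParity i * genParity j) * q ^ (-(simpleRoot i ⬝ᵥ simpleRoot j)))
    (c₂ := 1) hab ?_ ?_ (by simp) (by simp) rfl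
  · rw [key, smul_smul, mul_one]
    have : ((-1 : ℂ) ^ (genParity i * genParity j) * q ^ (simpleRoot i ⬝ᵥ simpleRoot j)) *
        ((-1) ^ (genParity i * genParity j) * q ^ (-(simpleRoot i ⬝ᵥ simpleRoot j))) = 1 := by
      rw [mul_mul_mul_comm, ← mul_pow, ← zpow_add₀ h0]; simp
    rw [this, one_smul]
  · rw [mul_assoc, ← mul_assoc (parityV n ^ genParity j), parity_pow_KV, mul_assoc, hσσ,
      ← mul_assoc, ← mul_assoc, hKK, mul_assoc, mul_assoc,
      ← mul_assoc (KV q (-simpleRoot j)) (parityV n ^ genParity i), ← parity_pow_KV]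
    simp only [mul_assoc]
  · rw [← mul_assoc, fV_KV h0, smul_mul_assoc, mul_assoc, fV_parity_pow, mul_smul_comm, smul_smul,
      neg_dotProduct, ← mul_assoc, mul_comm ((-1 : ℂ) ^ _)]

theorem eT_fT {n : ℕ} {q : ℂ} (h0 : q ≠ 0) (h1 : q ^ 2 ≠ 1) (t : ℕ) (i j : Fin n) :
    eT q t i * fT q t j - ((-1 : ℂ) ^ (genParity i * genParity j)) • (fT q t j * eT q t i) =
      if i = j then (q - q⁻¹)⁻¹ • (KT q t (simpleRoot i) - KT q t (-simpleRoot i)) else 0 := by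
  have hV := isURep_V (n := n) h0 h1
  have hKK : ∀ β γ : Weight n, KV q β * KV q γ = KV q γ * KV q β := KV_comm h0
  have hσσ := parity_pow_comm (n := n)
  have hinv : ∀ β : Weight n, KV q β * KV q (-β) = 1 := KV_mul_KV_neg h0
  have hinv' : ∀ β : Weight n, KV q (-β) * KV q β = 1 := KV_neg_mul_KV h0
  set s : ℂ := (-1) ^ (genParity i * genParity j) with hs
  have hss : s * s = 1 := by rw [hs, ← mul_pow]; simp
  let Ei : Fin t → Module.End ℂ (TV n t) :=
    siteOp (parityV n ^ genParity i) (eV i) (KV q (simpleRoot i))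
  let Fj : Fin t → Module.End ℂ (TV n t) :=
    siteOp (KV q (-simpleRoot j) * parityV n ^ genParity j) (fV j) 1
  have hlt : ∀ a b : Fin t, a < b → Ei a * Fj b = s • (Fj b * Ei a) := by
    intro a b hab
    have key := siteOp_mul_lt (l := parityV n ^ genParity i) (x := eV i)
      (r := KV q (simpleRoot i)) (l' := KV q (-simpleRoot j) * parityV n ^ genParity j)
      (x' := fV j) (r' := 1)
      (c₁ := s * q ^ (simpleRoot i ⬝ᵥ simpleRoot j))
      (c₂ := q ^ (-(simpleRoot i ⬝ᵥ simpleRoot j))) hab ?_ ?_ ?_ (KV_fV h0 _ _) (by simp)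
    · have e : s * q ^ (simpleRoot i ⬝ᵥ simpleRoot j) * q ^ (-(simpleRoot i ⬝ᵥ simpleRoot j)) =
          s := by rw [mul_assoc, ← zpow_add₀ h0]; simp
      rw [e] at key
      exact key
    · rw [← mul_assoc, parity_pow_KV, mul_assoc, hσσ, mul_assoc]
    · rw [← mul_assoc, eV_KV h0, smul_mul_assoc, mul_assoc, eV_parity_pow, mul_smul_comm,
        smul_smul, neg_dotProduct, neg_neg, ← mul_assoc, mul_comm (q ^ _), hs,
        mul_comm (genParity j), dotProduct_comm (simpleRoot j)]
    · rw [← mul_assoc, hKK, mul_assoc, ← parity_pow_KV, mul_assoc]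
  have hgt : ∀ a b : Fin t, b < a → Ei a * Fj b = s • (Fj b * Ei a) := by
    intro a b hab
    have key := siteOp_mul_lt (l := KV q (-simpleRoot j) * parityV n ^ genParity j) (x := fV j)
      (r := 1) (l' := parityV n ^ genParity i) (x' := eV i) (r' := KV q (simpleRoot i))
      (c₁ := s) (c₂ := 1) hab ?_ (fV_parity_pow i j) (by simp) (by simp) (by simp)
    · rw [mul_one] at key
      change _ = s • (siteOp _ _ _ _ * siteOp _ _ _ _)
      rw [key, smul_smul, hss, one_smul]
    · rw [← mul_assoc, parity_pow_KV, mul_assoc, hσσ, mul_assoc]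
  have hdiag : ∀ a : Fin t, Ei a * Fj a - s • (Fj a * Ei a) =
      if i = j then (q - q⁻¹)⁻¹ • (siteOp (KV q (-simpleRoot i)) (KV q (simpleRoot i))
        (KV q (simpleRoot i)) a - siteOp (KV q (-simpleRoot i)) (KV q (-simpleRoot i))
        (KV q (simpleRoot i)) a) else 0 := by
    intro a
    have hl : KV q (-simpleRoot j) * parityV n ^ genParity j * parityV n ^ genParity i =
        parityV n ^ genParity i * (KV q (-simpleRoot j) * parityV n ^ genParity j) := by
      rw [← mul_assoc, parity_pow_KV, mul_assoc, hσσ, mul_assoc]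
    change siteOp _ _ _ _ * siteOp _ _ _ _ - s • (siteOp _ _ _ _ * siteOp _ _ _ _) = _
    rw [siteOp_mul_siteOp, siteOp_mul_siteOp, hl, one_mul, mul_one, ← siteOp_smul, ← siteOp_sub]
    have := hV.ef i j
    rw [neg_one_pow_mul, ← hs] at this
    rw [this]
    split_ifs with hij
    · subst hij
      rw [siteOp_smul, siteOp_sub, ← mul_assoc, parity_pow_KV, mul_assoc, parity_pow_mul_self,
        mul_one]
    · rw [siteOp_zero]
  have hsum : eT q t i * fT q t j - s • (fT q t j * eT q t i) =
      ∑ a, (Ei a * Fj a - s • (Fj a * Ei a)) := by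
    change (∑ a, Ei a) * (∑ b, Fj b) - s • ((∑ b, Fj b) * ∑ a, Ei a) = _
    rw [Finset.sum_mul_sum, Finset.sum_mul_sum, Finset.sum_comm (f := fun b a => Fj b * Ei a),
      Finset.smul_sum, ← Finset.sum_sub_distrib (f := fun a => ∑ b, Ei a * Fj b)]
    refine Finset.sum_congr rfl fun a _ => ?_
    rw [Finset.smul_sum, ← Finset.sum_sub_distrib (f := fun b => Ei a * Fj b)]
    refine Finset.sum_eq_single a (fun b _ hb => ?_) (fun h => absurd (Finset.mem_univ _) h)
    rcases lt_or_gt_of_ne hb with h | h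
    · rw [hgt a b h, sub_self]
    · rw [hlt a b h, sub_self]
  rw [hsum, Finset.sum_congr rfl fun a _ => hdiag a]
  split_ifs with hij
  · rw [← Finset.smul_sum]
    congr 1
    let G : ℕ → Module.End ℂ (TV n t) := fun m =>
      PiTensorProduct.map fun k : Fin t =>
        if (k : ℕ) < m then KV q (-simpleRoot i) else KV q (simpleRoot i)
    have hG : ∀ a : Fin t, siteOp (KV q (-simpleRoot i)) (KV q (simpleRoot i))
        (KV q (simpleRoot i)) a - siteOp (KV q (-simpleRoot i)) (KV q (-simpleRoot i))
        (KV q (simpleRoot i)) a = G a - G (a + 1) := by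
      intro a
      congr 1 <;> refine congrArg PiTensorProduct.map (funext fun k => ?_) <;>
        simp only [Fin.lt_def, Fin.ext_iff] <;> split_ifs <;> first | (exfalso; omega) | rfl
    rw [Finset.sum_congr rfl fun a _ => hG a,
      Fin.sum_univ_eq_sum_range (fun m => G m - G (m + 1))]
    refine (Finset.sum_range_sub' G t).trans ?_
    congr 1 <;> refine congrArg PiTensorProduct.map (funext fun k => ?_) <;> simp
  · simp

theorem serre_eT {n : ℕ} {q : ℂ} (h0 : q ≠ 0) (h1 : q ^ 2 ≠ 1) (t : ℕ) {i j : Fin n} (hij : i ≠ j)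
    {c d : ℂ} {N : ℕ} (hN : (1 - cartan i j).toNat = N)
    (hc : (-1 : ℂ) ^ (genParity i * genParity j) * q ^ (simpleRoot i ⬝ᵥ simpleRoot j) = c)
    (hd : (-1 : ℂ) ^ (genParity i * genParity i) * q ^ (simpleRoot i ⬝ᵥ simpleRoot i) = d) :
    skew c d (eT q t i) (eT q t j) N = 0 := by
  have hV := isURep_V (n := n) h0 h1
  have hee := siteOp_e_comm (n := n) (t := t) h0
  have hKK : ∀ β γ : Weight n, KV q β * KV q γ = KV q γ * KV q β := KV_comm h0
  have hσσ := parity_pow_comm (n := n)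
  have hinv : ∀ β : Weight n, KV q β * KV q (-β) = 1 := KV_mul_KV_neg h0
  have hinv' : ∀ β : Weight n, KV q (-β) * KV q β = 1 := KV_neg_mul_KV h0
  have hcoef := serre_coef h0 hij hc.symm hd.symm hN.symm
  have hVs : skew c d (eV i) (eV j) N = 0 := by
    have := hV.serre_e i j hij
    rwa [adPow_eq_skew (hinv' _) (hV.Ke i i) (hV.Ke i j), hc, hd, hN] at this
  have : ∀ m ≤ t, skew c d
      (partialSum (t := t) (parityV n ^ genParity i) (eV i) (KV q (simpleRoot i)) m)
      (partialSum (parityV n ^ genParity j) (eV j) (KV q (simpleRoot j)) m) N = 0 := by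
    intro m
    induction m with
    | zero =>
      intro _
      have : ∀ l x r : Module.End ℂ (V n), partialSum (t := t) l x r 0 = 0 := fun l x r => by
        simp [partialSum]
      rw [this, this]
      rcases hcoef with ⟨rfl, _⟩ | ⟨rfl, _⟩ | ⟨rfl, _⟩ <;> simp [skew]
    | succ m ih =>
      intro hm
      rw [partialSum_succ _ _ _ hm, partialSum_succ _ _ _ hm]
      refine skew_add_eq_zero ?_ ?_ ?_ (ih (by omega)) ?_ hcoef
      · rw [← hd]; exact partialSum_mul_siteOp hm (hee i i)
      · rw [← hc]; exact partialSum_mul_siteOp hm (hee i j)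
      · rw [← hc, mul_comm (genParity i), dotProduct_comm]
        exact partialSum_mul_siteOp hm (hee j i)
      · rw [skew_siteOp (hσσ i j) (hKK _ _), hVs, siteOp_zero]
  have h := this t le_rfl
  rwa [partialSum_self, partialSum_self] at h

theorem serre_fT {n : ℕ} {q : ℂ} (h0 : q ≠ 0) (h1 : q ^ 2 ≠ 1) (t : ℕ) {i j : Fin n} (hij : i ≠ j)
    {c d : ℂ} {N : ℕ} (hN : (1 - cartan i j).toNat = N)
    (hc : (-1 : ℂ) ^ (genParity i * genParity j) * q ^ (simpleRoot i ⬝ᵥ simpleRoot j) = c)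
    (hd : (-1 : ℂ) ^ (genParity i * genParity i) * q ^ (simpleRoot i ⬝ᵥ simpleRoot i) = d) :
    skew c d (fT q t i) (fT q t j) N = 0 := by
  have hV := isURep_V (n := n) h0 h1
  have hff := siteOp_f_comm (n := n) (t := t) h0
  have hKK : ∀ β γ : Weight n, KV q β * KV q γ = KV q γ * KV q β := KV_comm h0
  have hσσ := parity_pow_comm (n := n)
  have hinv : ∀ β : Weight n, KV q β * KV q (-β) = 1 := KV_mul_KV_neg h0
  have hinv' : ∀ β : Weight n, KV q (-β) * KV q β = 1 := KV_neg_mul_KV h0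
  have hcoef := serre_coef h0 hij hc.symm hd.symm hN.symm
  have hf : ∀ k : Fin n, KV q (-simpleRoot i) * fV k * KV q (simpleRoot i) =
      q ^ (simpleRoot i ⬝ᵥ simpleRoot k) • fV k := fun k => by
    rw [KV_fV h0, smul_mul_assoc, mul_assoc, hinv', mul_one, neg_dotProduct, neg_neg]
  have hVs : skew c d (fV i) (fV j) N = 0 := by
    have := hV.serre_f i j hij
    rwa [adPow_eq_skew (hinv _) (hf i) (hf j), hc, hd, hN] at this
  have hll : KV q (-simpleRoot i) * parityV n ^ genParity i *
      (KV q (-simpleRoot j) * parityV n ^ genParity j) =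
      KV q (-simpleRoot j) * parityV n ^ genParity j *
      (KV q (-simpleRoot i) * parityV n ^ genParity i) := by
    have e : ∀ a b : Fin n, KV q (-simpleRoot a) * parityV n ^ genParity a *
        (KV q (-simpleRoot b) * parityV n ^ genParity b) =
        KV q (-simpleRoot a) * KV q (-simpleRoot b) *
          (parityV n ^ genParity a * parityV n ^ genParity b) := fun a b => by
      rw [mul_assoc, ← mul_assoc (parityV n ^ genParity a), parity_pow_KV]
      simp only [mul_assoc]
    rw [e, e, hKK, hσσ]
  have : ∀ m ≤ t, skew c d
      (partialSum (t := t) (KV q (-simpleRoot i) * parityV n ^ genParity i) (fV i) 1 m)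
      (partialSum (KV q (-simpleRoot j) * parityV n ^ genParity j) (fV j) 1 m) N = 0 := by
    intro m
    induction m with
    | zero =>
      intro _
      have : ∀ l x r : Module.End ℂ (V n), partialSum (t := t) l x r 0 = 0 := fun l x r => by
        simp [partialSum]
      rw [this, this]
      rcases hcoef with ⟨rfl, _⟩ | ⟨rfl, _⟩ | ⟨rfl, _⟩ <;> simp [skew]
    | succ m ih =>
      intro hm
      rw [partialSum_succ _ _ _ hm, partialSum_succ _ _ _ hm, add_comm (partialSum _ _ _ _),
        add_comm (partialSum _ _ _ _)]
      have hswap : ∀ (a b : Fin n),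
          siteOp (KV q (-simpleRoot a) * parityV n ^ genParity a) (fV a) 1 ⟨m, hm⟩ *
            partialSum (KV q (-simpleRoot b) * parityV n ^ genParity b) (fV b) 1 m =
          ((-1 : ℂ) ^ (genParity a * genParity b) * q ^ (simpleRoot a ⬝ᵥ simpleRoot b)) •
            (partialSum (KV q (-simpleRoot b) * parityV n ^ genParity b) (fV b) 1 m *
              siteOp (KV q (-simpleRoot a) * parityV n ^ genParity a) (fV a) 1 ⟨m, hm⟩) := by
        intro a b
        unfold partialSum
        rw [Finset.sum_mul, Finset.mul_sum, Finset.smul_sum]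
        refine Finset.sum_congr rfl fun k hk => hff a b k _ ?_
        simpa [Fin.lt_def] using hk
      refine skew_add_eq_zero ?_ ?_ ?_ ?_ (ih (by omega)) hcoef
      · rw [← hd]; exact hswap i i
      · rw [← hc]; exact hswap i j
      · rw [← hc, mul_comm (genParity i), dotProduct_comm]; exact hswap j i
      · rw [skew_siteOp hll rfl, hVs, siteOp_zero]
  have h := this t le_rfl
  rwa [partialSum_self, partialSum_self] at h

theorem isURep_TV {n : ℕ} {q : ℂ} (h0 : q ≠ 0) (h1 : q ^ 2 ≠ 1) (t : ℕ) :
    IsURep q (eT (n := n) q t) (fT q t) (fun i => KT q t (simpleRoot i))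
      (fun i => KT q t (-simpleRoot i)) := by
  have hKK : ∀ β γ : Weight n, KV q β * KV q γ = KV q γ * KV q β := KV_comm h0
  have hσσ := parity_pow_comm (n := n)
  have hinv : ∀ β : Weight n, KV q β * KV q (-β) = 1 := KV_mul_KV_neg h0
  have hinv' : ∀ β : Weight n, KV q (-β) * KV q β = 1 := KV_neg_mul_KV h0
  have hKT : ∀ β : Weight n, KT q t β * KT q t (-β) = 1 := fun β => by
    unfold KT; rw [diagOp_mul, hinv, diagOp_one]
  have hKT' : ∀ β : Weight n, KT q t (-β) * KT q t β = 1 := fun β => by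
    unfold KT; rw [diagOp_mul, hinv', diagOp_one]
  have hKTK : ∀ β γ : Weight n, KT q t β * KT q t γ = KT q t γ * KT q t β := fun β γ => by
    unfold KT; rw [diagOp_mul, diagOp_mul, hKK]
  have hconj : ∀ (β : Weight n) (x : Module.End ℂ (V n)), KV q β * x = x * KV q β →
      KV q β * x * KV q (-β) = x := fun β x h => by
    rw [h, mul_assoc, hinv, mul_one]
  have hKe : ∀ (β : Weight n) (j : Fin n), KT q t β * eT q t j * KT q t (-β) =
      q ^ (β ⬝ᵥ simpleRoot j) • eT q t j := fun β j => by
    refine diag_sumOp (hconj _ _ (parity_pow_KV q j β).symm) (hconj _ _ (hKK _ _)) ?_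
    rw [KV_eV h0, smul_mul_assoc, mul_assoc, hinv, mul_one]
  have hKf : ∀ (β : Weight n) (j : Fin n), KT q t β * fT q t j * KT q t (-β) =
      q ^ (-(β ⬝ᵥ simpleRoot j)) • fT q t j := fun β j => by
    refine diag_sumOp (hconj _ _ ?_) (hconj _ _ (by rw [mul_one, one_mul])) ?_
    · rw [← mul_assoc, hKK, mul_assoc, mul_assoc, parity_pow_KV]
    · rw [KV_fV h0, smul_mul_assoc, mul_assoc, hinv, mul_one]
  have hKf' : ∀ (β : Weight n) (j : Fin n), KT q t (-β) * fT q t j * KT q t β =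
      q ^ (β ⬝ᵥ simpleRoot j) • fT q t j := fun β j => by
    have := hKf (-β) j
    rwa [neg_neg, neg_dotProduct, neg_neg] at this
  refine ⟨fun i j => by rw [neg_one_pow_mul]; exact eT_fT h0 h1 t i j, fun i j => hKe _ j, fun i j => hKf _ j, fun i j => hKTK _ _,
    fun i j => hKTK _ _, fun i j => hKTK _ _, fun i => hKT _, fun i => hKT' _, fun i j hij => ?_,
    fun i j hij => ?_⟩
  · rw [adPow_eq_skew (hKT' _) (hKe _ _) (hKe _ _)]
    exact serre_eT h0 h1 t hij rfl rfl rfl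
  · rw [adPow_eq_skew (hKT _) (hKf' _ _) (hKf' _ _)]
    exact serre_fT h0 h1 t hij rfl rfl rfl

/-! ## The representations of `U_q(osp(1|2n))` on `V` and on `V^{⊗t}` -/

/-- `q` is non-zero and not a root of unity. -/
def Generic (q : ℂ) : Prop := q ≠ 0 ∧ ∀ m : ℕ, 0 < m → q ^ m ≠ 1

variable {n : ℕ} {q : ℂ}

/-- The representation `π` of `U_q(osp(1|2n))` on the fundamental module `V`. -/
def piV (n : ℕ) (hq : Generic q) : Uq n q →ₐ[ℂ] Module.End ℂ (V n) :=
  Uq.lift (isURep_V hq.1 (hq.2 2 two_pos))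

/-- The representation of `U_q(osp(1|2n))` on `V^{⊗t}` given by the iterated coproduct. -/
def piTV (n t : ℕ) (hq : Generic q) : Uq n q →ₐ[ℂ] Module.End ℂ (TV n t) :=
  Uq.lift (isURep_TV hq.1 (hq.2 2 two_pos) t)

/-- The centraliser algebra `End_{U_q(osp(1|2n))}(V^{⊗t})`: the endomorphisms of the `ℤ_2`-graded
`U_q(osp(1|2n))`-module `V^{⊗t}`, i.e. the linear maps that commute with the action of
`U_q(osp(1|2n))` and are homogeneous of degree `0` (commute with the parity operator). -/
def EndU (n t : ℕ) (hq : Generic q) : Subalgebra ℂ (Module.End ℂ (TV n t)) :=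
  Subalgebra.centralizer ℂ (Set.range (piTV n t hq) ∪ {diagOp t (parityV n)})

/-! ## Normal orderings and root vectors -/

/-- `α ≺ β` for a total order given by listing its elements increasingly. -/
def Before (l : List (Weight n)) (α β : Weight n) : Prop := l.idxOf α < l.idxOf β

/-- `l` lists the elements of the reduced root system `φ` in a normal ordering: if `α ≺ β` and
`α + β ∈ φ`, then `α ≺ α + β ≺ β`. -/
structure IsNormalOrdering (l : List (Weight n)) : Prop where
  nodup : l.Nodup
  mem_iff : ∀ γ, γ ∈ l ↔ γ ∈ reducedRoots n
  normal : ∀ α ∈ reducedRoots n, ∀ β ∈ reducedRoots n, Before l α β → α + β ∈ reducedRoots n →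
    Before l α (α + β) ∧ Before l (α + β) β

/-- `γ = α + β` with `α ≺ β` in `φ`, and there are no `α', β' ∈ φ` with `α' + β' = γ`,
`α ≺ α' ≺ β` and `α ≺ β' ≺ β`. -/
structure IsMinimalPair (l : List (Weight n)) (γ α β : Weight n) : Prop where
  left_mem : α ∈ reducedRoots n
  right_mem : β ∈ reducedRoots n
  add_eq : α + β = γ
  before : Before l α β
  minimal : ¬ ∃ α' ∈ reducedRoots n, ∃ β' ∈ reducedRoots n, α' + β' = γ ∧
    (Before l α α' ∧ Before l α' β) ∧ (Before l α β' ∧ Before l β' β)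

/-- The `q`-bracket `[X_α, X_β]_q = X_α X_β - (-1)^{[X_α][X_β]} q^{(α,β)} X_β X_α` of root vectors
attached to the roots `±α` and `±β`. -/
def qBracket (q : ℂ) {A : Type*} [Ring A] [Algebra ℂ A] (α β : Weight n) (X Y : A) : A :=
  X * Y - ((-1) ^ (rootParity α * rootParity β) * q ^ (α ⬝ᵥ β)) • (Y * X)

/-- `E`, `F` are root vectors of `U_q(osp(1|2n))` constructed recursively from the normal ordering
`l`: `E_{α_i} = e_i`, `F_{α_i} = f_i`, and `E_γ = [E_α, E_β]_q`, `F_γ = [F_β, F_α]_{q⁻¹}` for a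
minimal pair `γ = α + β`, for each non-simple root `γ` in `φ`. -/
structure IsRootVectors (l : List (Weight n)) (E F : Weight n → Uq n q) : Prop where
  simple : ∀ i : Fin n, E (simpleRoot i) = Uq.e q i ∧ F (simpleRoot i) = Uq.f q i
  nonsimple : ∀ γ ∈ reducedRoots n, (∀ i : Fin n, γ ≠ simpleRoot i) →
    ∃ α β, IsMinimalPair l γ α β ∧ E γ = qBracket q α β (E α) (E β) ∧
      F γ = qBracket q⁻¹ β α (F β) (F α)

/-- The scalar `a_γ` with
`E_γ F_γ - (-1)^{[E_γ]} F_γ E_γ = a_γ (K_γ - K_γ⁻¹) / (q - q⁻¹)`, read off in the representation `V`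
(where `K_γ - K_γ⁻¹` is non-zero, so that there is at most one such scalar). -/
def rootScalar (hq : Generic q) (E F : Weight n → Uq n q) (γ : Weight n) : ℂ :=
  Classical.epsilon fun a : ℂ =>
    piV n hq (E γ * F γ - (-1) ^ rootParity γ * (F γ * E γ)) =
      (a / (q - q⁻¹)) • piV n hq (↑(Uq.Kweight q γ) - ↑(Uq.Kweight q γ)⁻¹)

/-! ## The `R`-matrix -/

/-- `[k]_x = (1 - x^k) / (1 - x)`. -/
def qNumber (x : ℂ) (k : ℕ) : ℂ := (1 - x ^ k) / (1 - x)

/-- `[k]_x! = [k]_x [k-1]_x ⋯ [1]_x`. -/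
def qFactorial (x : ℂ) (k : ℕ) : ℂ := ∏ m ∈ Finset.range k, qNumber x (m + 1)

/-- The action of `x ⊗ y` on `V ⊗ V`, where `x`, `y` act on `V` by `A`, `B` and `y` has parity `p`:
`(x ⊗ y)(v ⊗ w) = (-1)^{[y][v]} x v ⊗ y w`. -/
def superTensor (p : ℕ) (A B : Module.End ℂ (V n)) : Module.End ℂ (TensorProduct ℂ (V n) (V n)) :=
  TensorProduct.map (A * parityV n ^ p) B

/-- The action on `V ⊗ V` of
`R̃_γ = ∑_k ((-1)^{[e_γ]} (q - q⁻¹))^k (e_γ ⊗ f_γ)^k / [k]_{q_γ}!`, where `e_γ = E_γ`,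
`f_γ = F_γ / a_γ` and `q_γ = (-1)^{[e_γ]} q^{-(γ,γ)}`.  Only finitely many terms act by non-zero
operators. -/
def RtildeFactor (hq : Generic q) (E F : Weight n → Uq n q) (γ : Weight n) :
    Module.End ℂ (TensorProduct ℂ (V n) (V n)) :=
  ∑ᶠ k : ℕ, (((-1) ^ rootParity γ * (q - q⁻¹)) ^ k /
      qFactorial ((-1) ^ rootParity γ * q ^ (-(γ ⬝ᵥ γ))) k) •
    superTensor (rootParity γ) (piV n hq (E γ)) (piV n hq ((rootScalar hq E F γ)⁻¹ • F γ)) ^ k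

/-- The action of `R̃ = ∏_γ R̃_γ` on `V ⊗ V`, ordered by the normal ordering `l`. -/
def Rtilde (hq : Generic q) (l : List (Weight n)) (E F : Weight n → Uq n q) :
    Module.End ℂ (TensorProduct ℂ (V n) (V n)) :=
  (l.map (RtildeFactor hq E F)).prod

/-- The basis `v_k ⊗ v_m` of `V ⊗ V`. -/
def vvBasis (n : ℕ) : Module.Basis (Idx n × Idx n) ℂ (TensorProduct ℂ (V n) (V n)) :=
  (vBasis n).tensorProduct (vBasis n)

/-- The operator `v_λ ⊗ v_μ ↦ q^{(λ,μ)} v_λ ⊗ v_μ` on weight vectors of `V ⊗ V`. -/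
def weightOp (n : ℕ) (q : ℂ) : Module.End ℂ (TensorProduct ℂ (V n) (V n)) :=
  (vvBasis n).constr ℂ fun p =>
    q ^ ((eps (p.1 : ℤ) : Weight n) ⬝ᵥ eps (p.2 : ℤ)) • vvBasis n p

/-- The graded permutation `v ⊗ w ↦ (-1)^{[v][w]} w ⊗ v` of `V ⊗ V`. -/
def gradedPerm (n : ℕ) : Module.End ℂ (TensorProduct ℂ (V n) (V n)) :=
  (vvBasis n).constr ℂ fun p =>
    (-1 : ℂ) ^ (vParity (p.1 : ℤ) * vParity (p.2 : ℤ)) • vvBasis n p.swap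

/-- The permuted `R`-matrix `Ř_{V,V} = P ∘ R` on `V ⊗ V`, where `R = E_V R̃` and `E_V` acts by
`v_λ ⊗ v_μ ↦ q^{(λ,μ)} v_λ ⊗ v_μ`. -/
def Rcheck (hq : Generic q) (l : List (Weight n)) (E F : Weight n → Uq n q) :
    Module.End ℂ (TensorProduct ℂ (V n) (V n)) :=
  gradedPerm n * (weightOp n q * Rtilde hq l E F)

/-! ## The algebra `C_t` -/

/-- The operator `id ⊗ … ⊗ A ⊗ … ⊗ id` on `V^{⊗t}`, with `A` in position `j`. -/
def onSite (n : ℕ) {t : ℕ} (j : Fin t) : Module.End ℂ (V n) →ₗ[ℂ] Module.End ℂ (TV n t) :=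
  (PiTensorProduct.mapMultilinear ℂ (fun _ : Fin t => V n) fun _ => V n).toLinearMap 1 j

/-- The linear map `End(V ⊗ V) → End(V^{⊗t})` that sends `A ⊗ B` to the operator acting by `A` in
position `j`, by `B` in position `k` and by the identity elsewhere (for `j ≠ k`). -/
def onSites (n : ℕ) {t : ℕ} (j k : Fin t) :
    Module.End ℂ (TensorProduct ℂ (V n) (V n)) →ₗ[ℂ] Module.End ℂ (TV n t) :=
  TensorProduct.lift
      ((LinearMap.mul ℂ (Module.End ℂ (TV n t))).compl₁₂ (onSite n j) (onSite n k)) ∘ₗ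
    (homTensorHomEquiv ℂ (V n) (V n) (V n) (V n)).symm.toLinearMap

/-- `Ř_i = id^{⊗(i-1)} ⊗ Ř_{V,V} ⊗ id^{⊗(t-i-1)}`, acting on the positions `i`, `i + 1` of `V^{⊗t}`
(the index `i : Fin (t - 1)` stands for the mathematical index `i + 1`). -/
def Ri (hq : Generic q) (l : List (Weight n)) (E F : Weight n → Uq n q) {t : ℕ} (i : Fin (t - 1)) :
    Module.End ℂ (TV n t) :=
  onSites n (⟨i, by omega⟩ : Fin t) ⟨i + 1, by omega⟩ (Rcheck hq l E F)

/-- The algebra `C_t` generated by the operators `Ř_i^{±1}`, `1 ≤ i ≤ t - 1`. -/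
def Ct (hq : Generic q) (l : List (Weight n)) (E F : Weight n → Uq n q) (t : ℕ) :
    Subalgebra ℂ (Module.End ℂ (TV n t)) :=
  Algebra.adjoin ℂ (Set.range (fun i : Fin (t - 1) => Ri hq l E F i) ∪
    Set.range fun i : Fin (t - 1) => Ring.inverse (Ri hq l E F i))

/-! ## The Birman-Wenzl-Murakami algebra -/

/-- The generators `g_i` and `g_i⁻¹`, `1 ≤ i ≤ t - 1`. -/
inductive BWGen (t : ℕ) : Type
  | g (i : Fin (t - 1)) : BWGen t
  | ginv (i : Fin (t - 1)) : BWGen t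

namespace FreeBW

variable {t : ℕ}

/-- The free generator `g_i`. -/
def g (i : Fin (t - 1)) : FreeAlgebra ℂ (BWGen t) := FreeAlgebra.ι ℂ (BWGen.g i)

/-- The free generator `g_i⁻¹`. -/
def ginv (i : Fin (t - 1)) : FreeAlgebra ℂ (BWGen t) := FreeAlgebra.ι ℂ (BWGen.ginv i)

/-- The element `e_i`, defined by `(q - q⁻¹)(1 - e_i) = g_i - g_i⁻¹` (for `q² ≠ 1`). -/
def e (q : ℂ) (i : Fin (t - 1)) : FreeAlgebra ℂ (BWGen t) := 1 - (q - q⁻¹)⁻¹ • (g i - ginv i)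

end FreeBW

open FreeBW in
/-- The defining relations of the Birman-Wenzl-Murakami algebra. -/
inductive BWRel (t : ℕ) (r q : ℂ) : FreeAlgebra ℂ (BWGen t) → FreeAlgebra ℂ (BWGen t) → Prop
  | g_mul_ginv (i : Fin (t - 1)) : BWRel t r q (g i * ginv i) 1
  | ginv_mul_g (i : Fin (t - 1)) : BWRel t r q (ginv i * g i) 1
  | far (i j : Fin (t - 1)) (hij : (i : ℕ) + 1 < j ∨ (j : ℕ) + 1 < i) :
      BWRel t r q (g i * g j) (g j * g i)
  | braid (i j : Fin (t - 1)) (hij : (j : ℕ) = i + 1) :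
      BWRel t r q (g i * g j * g i) (g j * g i * g j)
  | e_mul_g (i : Fin (t - 1)) : BWRel t r q (e q i * g i) (r⁻¹ • e q i)
  | e_g_e (i j : Fin (t - 1)) (hij : (i : ℕ) = j + 1) :
      BWRel t r q (e q i * g j * e q i) (r • e q i)
  | e_ginv_e (i j : Fin (t - 1)) (hij : (i : ℕ) = j + 1) :
      BWRel t r q (e q i * ginv j * e q i) (r⁻¹ • e q i)

/-- The Birman-Wenzl-Murakami algebra `BW_t(r, q)`. -/
abbrev BW (t : ℕ) (r q : ℂ) : Type := RingQuot (BWRel t r q)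

/-- The generator `g_i` of `BW_t(r, q)`. -/
def BW.g {t : ℕ} (r q : ℂ) (i : Fin (t - 1)) : BW t r q :=
  RingQuot.mkAlgHom ℂ (BWRel t r q) (FreeBW.g i)

end

end OspBMW

/-!
The permuted `R`-matrix on `V ⊗ V` is computed explicitly, and all relations are then checked for the
explicit operator `braidOp`.

*The `R`-matrix.* With the basis of `V` listed by decreasing weight (`bv x`, `-n ≤ x ≤ n`), a reduced
root is a pair `x < y` up to the mirror image `(-y, -x)` (`rt`), and a decomposition of it into two
roots is a label between `x` and `y`. A root vector acts on `V` by a combination of two matrix units.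
By induction along minimal pairs the ratio of the two coefficients is a sign times a power of `q`,
whose exponent `ordExp` counts for each intermediate label which of the two roots comes first
(`rootForm`); convexity of the normal ordering makes this count additive. The factor of `R̃` for a
root only depends on this ratio (`RtildeFactor_eq`). On vectors of non-zero weight at most one factor
acts non-trivially (`Rtilde_bv`). On the zero weight space the factors are elementary column
operations, and the entries of the partial products have a closed form, in which the exponent of `q`
counts the roots already passed (`ColumnRec.eq_partEntry`). The induction closes only for entries on
one side of the antidiagonal; the others follow by the same induction for the products of the last
factors and the reversed ordering (`zeroCoord_Rtilde`). The result does not depend on the ordering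
and is `braidOp` (`Rcheck_eq_braidOp`).

*The relations.* The module `V ⊗ W` is generated by `v ⊗ W` under the `f_i`, where `v` is the highest
weight vector (`eq_zero_of_fTensor`), and `braidOp` merely permutes `v` with the other factor. Hence
identities between operators that are linear with respect to the `f_i` need only be compared on
`v ⊗ W`. Linearity of `braidOp` with respect to the `f_i` is a direct computation
(`braidOp_fTensor`). The method then gives linearity with respect to the `e_i` (`braidOp_eTensor`), the
braid relation (`braidOp_braid`), the inverse `braidOp + (q - q⁻¹)(1 - cupCap)`, where `cupCap` is the
operator of rank one built from the invariant vector and the invariant functional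
(`braidInv_mul_braidOp`), the twist (`capFun_braidOp`) and the partial traces of `braidOp` and of its
inverse (`partialTrace_braidOp`, `partialTrace_braidInv`). So `cupCap` is the image of the elements
`e_i`, and the last two facts are the relations for `e_i g_i` and `e_i g_{i-1}^{±1} e_i`. Everything
is transported to `V^{⊗t}` by letting operators act in neighbouring positions (`onSites`,
`onThreeSites`). Uniqueness is clear, as the `g_i` and their inverses generate the algebra.
-/

namespace OspBMW

noncomputable section

variable {n : ℕ} {q : ℂ}

/-! ### The fundamental module in the order of its weights -/

/-- The involution of `[-n, n]` that lists the labels of the basis of `V` by decreasing weight: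
`-n ≤ x ≤ n` stands for the label `x + n + 1` if `x < 0`, for `x - n - 1` if `x > 0`, and for `0`
if `x = 0`. It commutes with `x ↦ -x`. -/
def lev (n : ℕ) (x : ℤ) : ℤ := if x < 0 then x + n + 1 else if 0 < x then x - n - 1 else 0

/-- The basis of `V` in the order `v_1, …, v_n, v_0, v_{-n}, …, v_{-1}` of decreasing weight,
indexed by `-n ≤ x ≤ n` (and `0` for other `x`). -/
def bv {n : ℕ} (x : ℤ) : V n := if -(n : ℤ) ≤ x ∧ x ≤ n then vec (lev n x) else 0

/-- The weight of `bv x`. -/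
def wt {n : ℕ} (x : ℤ) : Weight n := fun a =>
  (if x = (a : ℤ) - n then 1 else 0) - (if x = n - (a : ℤ) then 1 else 0)

/-- The sign `(-1)^{[v]}` of the vector `v = bv x`. -/
def sg (x : ℤ) : ℂ := if x = 0 then 1 else -1

variable {n : ℕ} {q : ℂ}

theorem bv_of_not {x : ℤ} (h : ¬ (-(n : ℤ) ≤ x ∧ x ≤ n)) : (bv x : V n) = 0 := if_neg h

theorem lev_lev {x : ℤ} (h : -(n : ℤ) ≤ x ∧ x ≤ n) : lev n (lev n x) = x := by
  unfold lev; split_ifs <;> omega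

theorem lev_mem {x : ℤ} (h : -(n : ℤ) ≤ x ∧ x ≤ n) : -(n : ℤ) ≤ lev n x ∧ lev n x ≤ n := by
  unfold lev; split_ifs <;> omega

theorem vec_eq_bv {k : ℤ} (h : -(n : ℤ) ≤ k ∧ k ≤ n) : (vec k : V n) = bv (lev n k) := by
  rw [bv, if_pos (lev_mem h), lev_lev h]

theorem bv_eq_vec {x : ℤ} (h : -(n : ℤ) ≤ x ∧ x ≤ n) : (bv x : V n) = vec (lev n x) := if_pos h

theorem eps_lev {x : ℤ} (h : -(n : ℤ) ≤ x ∧ x ≤ n) : (eps (lev n x) : Weight n) = wt x := by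
  funext a
  have := a.2
  unfold eps wt lev
  split_ifs <;> omega

theorem hom_ext_bv {M : Type*} [AddCommGroup M] [Module ℂ M] {f g : V n →ₗ[ℂ] M}
    (h : ∀ x : ℤ, -(n : ℤ) ≤ x → x ≤ n → f (bv x) = g (bv x)) : f = g :=
  end_ext fun k => by
    by_cases hk : -(n : ℤ) ≤ k ∧ k ≤ n
    · rw [vec_eq_bv hk]; exact h _ (lev_mem hk).1 (lev_mem hk).2
    · rw [vec_eq_zero hk, map_zero, map_zero]

theorem hom_ext_bv₂ {M : Type*} [AddCommGroup M] [Module ℂ M] {f g : V n ⊗[ℂ] V n →ₗ[ℂ] M}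
    (h : ∀ x y : ℤ, -(n : ℤ) ≤ x → x ≤ n → -(n : ℤ) ≤ y → y ≤ n →
      f (bv x ⊗ₜ bv y) = g (bv x ⊗ₜ bv y)) : f = g :=
  TensorProduct.ext <| hom_ext_bv fun x h1 h2 => hom_ext_bv fun y h3 h4 => h x y h1 h2 h3 h4

/-- The linear map with prescribed values on the vectors `bv x`. -/
def bvLift {M : Type*} [AddCommGroup M] [Module ℂ M] (F : ℤ → M) : V n →ₗ[ℂ] M :=
  (vBasis n).constr ℂ fun k : Idx n => F (lev n k)

theorem bvLift_bv {M : Type*} [AddCommGroup M] [Module ℂ M] (F : ℤ → M) {x : ℤ}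
    (h1 : -(n : ℤ) ≤ x) (h2 : x ≤ n) : bvLift F (bv x : V n) = F x := by
  have h : -(n : ℤ) ≤ x ∧ x ≤ n := ⟨h1, h2⟩
  have h' : lev n x ∈ Set.Icc (-(n : ℤ)) n := lev_mem h
  have : (bv x : V n) = vBasis n ⟨lev n x, h'⟩ := by
    rw [bv_eq_vec h, vec, dif_pos h']
  rw [this, bvLift, Module.Basis.constr_basis, lev_lev h]

theorem eV_bv (i : Fin n) (x : ℤ) : eV i (bv x : V n) =
    if x = (i : ℤ) - n + 1 then bv ((i : ℤ) - n) else
      if x = n - (i : ℤ) then (if (i : ℤ) = n - 1 then (-1 : ℂ) else 1) • bv (n - 1 - (i : ℤ))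
      else 0 := by
  have := i.2
  by_cases h : -(n : ℤ) ≤ x ∧ x ≤ n
  · rw [bv_eq_vec h, eV_vec]
    unfold eAct lev bv lev
    split_ifs <;> first | (exfalso; omega) | skip
    all_goals try simp only [one_smul, neg_smul]
    all_goals first | rfl | (congr 1; omega)
  · rw [bv_of_not h, map_zero]
    split_ifs <;> first | rfl | (exfalso; omega)

theorem fV_bv (i : Fin n) (x : ℤ) : fV i (bv x : V n) =
    if x = (i : ℤ) - n then bv ((i : ℤ) - n + 1) else
      if x = n - 1 - (i : ℤ) then bv (n - (i : ℤ)) else 0 := by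
  have := i.2
  by_cases h : -(n : ℤ) ≤ x ∧ x ≤ n
  · rw [bv_eq_vec h, fV_vec]
    unfold fAct lev bv lev
    split_ifs <;> first | (exfalso; omega) | skip
    all_goals first | rfl | (congr 1; omega)
  · rw [bv_of_not h, map_zero]
    split_ifs <;> first | rfl | (exfalso; omega)

theorem KV_bv (β : Weight n) (x : ℤ) : KV q β (bv x) = q ^ (β ⬝ᵥ wt x) • bv x := by
  by_cases h : -(n : ℤ) ≤ x ∧ x ≤ n
  · rw [bv_eq_vec h, KV_vec, eps_lev h]
  · rw [bv_of_not h, map_zero, smul_zero]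

theorem parityV_bv (x : ℤ) : parityV n (bv x) = sg x • bv x := by
  by_cases h : -(n : ℤ) ≤ x ∧ x ≤ n
  · rw [bv_eq_vec h, parityV_vec]
    congr 1
    unfold vParity lev sg
    split_ifs <;> first | (exfalso; omega) | simp
  · rw [bv_of_not h, map_zero, smul_zero]

theorem wt_zero : (wt 0 : Weight n) = 0 := by
  funext a
  have := a.2
  simp only [wt, Pi.zero_apply]
  split_ifs <;> omega

theorem wt_neg (x : ℤ) : (wt (-x) : Weight n) = -wt x := by
  funext a
  simp only [wt, Pi.neg_apply]
  split_ifs <;> omega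

theorem wt_single (i : Fin n) : (wt ((i : ℤ) - n) : Weight n) = Pi.single i 1 := by
  funext a
  have := a.2
  simp only [wt, Pi.single_apply, Fin.ext_iff]
  split_ifs <;> omega

theorem single_dot (i : Fin n) (x : ℤ) : (Pi.single i 1 : Weight n) ⬝ᵥ wt x = wt x i := by
  simp

theorem wt_dot {x : ℤ} (hx : -(n : ℤ) ≤ x ∧ x ≤ n) (y : ℤ) : (wt x : Weight n) ⬝ᵥ wt y =
    if x = 0 then 0 else if y = x then 1 else if y = -x then -1 else 0 := by
  rcases lt_trichotomy x 0 with h | rfl | h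
  · obtain ⟨i, rfl⟩ : ∃ i : Fin n, x = (i : ℤ) - n := ⟨⟨(x + n).toNat, by omega⟩, by simp; omega⟩
    have := i.2
    rw [wt_single, single_dot]
    simp only [wt]
    split_ifs <;> omega
  · simp [wt_zero]
  · obtain ⟨i, rfl⟩ : ∃ i : Fin n, x = -((i : ℤ) - n) :=
      ⟨⟨(n - x).toNat, by omega⟩, by simp; omega⟩
    have := i.2
    rw [wt_neg, wt_single, neg_dotProduct, single_dot]
    simp only [wt]
    split_ifs <;> omega

theorem simpleRoot_eq (i : Fin n) :
    simpleRoot i = (wt ((i : ℤ) - n) - wt ((i : ℤ) - n + 1) : Weight n) := by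
  have := i.2
  funext a
  have := a.2
  simp only [simpleRoot_apply, Pi.sub_apply, wt, Fin.ext_iff]
  split_ifs <;> omega

/-- The matrix unit `bv y ↦ bv x`. -/
def un (x y : ℤ) : Module.End ℂ (V n) := bvLift fun w => if w = y then bv x else 0

theorem un_bv {x y : ℤ} (h1 : -(n : ℤ) ≤ y) (h2 : y ≤ n) (w : ℤ) :
    un x y (bv w : V n) = if w = y then bv x else 0 := by
  by_cases h : -(n : ℤ) ≤ w ∧ w ≤ n
  · rw [un, bvLift_bv _ h.1 h.2]
  · rw [bv_of_not h, map_zero, if_neg (by omega)]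

theorem un_mul_un {x y x' y' : ℤ} (h1 : -(n : ℤ) ≤ y) (h2 : y ≤ n) (h3 : -(n : ℤ) ≤ y')
    (h4 : y' ≤ n) : (un x y * un x' y' : Module.End ℂ (V n)) = if x' = y then un x y' else 0 := by
  refine hom_ext_bv fun w _ _ => ?_
  rw [Module.End.mul_apply, un_bv h3 h4]
  split_ifs with ha hb hb
  · rw [un_bv h1 h2, un_bv h3 h4, if_pos hb, if_pos ha]
  · rw [un_bv h1 h2, if_neg hb]; rfl
  · rw [un_bv h3 h4, if_neg ha, map_zero]
  · rw [map_zero]; rfl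

theorem eV_eq_un (i : Fin n) : eV i = un ((i : ℤ) - n) ((i : ℤ) - n + 1) +
    (if (i : ℤ) = n - 1 then (-1 : ℂ) else 1) • un (-((i : ℤ) - n + 1)) (-((i : ℤ) - n)) := by
  have := i.2
  refine hom_ext_bv fun w _ _ => ?_
  rw [LinearMap.add_apply, LinearMap.smul_apply, un_bv (by omega) (by omega),
    un_bv (by omega) (by omega), eV_bv, show -((i : ℤ) - n + 1) = n - 1 - i by ring,
    show -((i : ℤ) - n) = n - i by ring]
  split_ifs <;> first | (exfalso; omega) | simp

theorem fV_eq_un (i : Fin n) : fV i = un ((i : ℤ) - n + 1) ((i : ℤ) - n) +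
    un (-((i : ℤ) - n)) (-((i : ℤ) - n + 1)) := by
  have := i.2
  refine hom_ext_bv fun w _ _ => ?_
  rw [LinearMap.add_apply, un_bv (by omega) (by omega),
    un_bv (by omega) (by omega), fV_bv, show -((i : ℤ) - n + 1) = n - 1 - i by ring,
    show -((i : ℤ) - n) = n - i by ring]
  split_ifs <;> first | (exfalso; omega) | simp

/-! ### The explicit braid operator -/

/-- The coefficients of the invariant vector `∑_y cupC y • bv y ⊗ bv (-y)` of `V ⊗ V`. -/
def cupC (q : ℂ) (y : ℤ) : ℂ :=
  if y = 0 then 1 else if y < 0 then -(-q) ^ (-y - 1) else -(-q) ^ (-y)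

/-- The values of the invariant functional on `V ⊗ V` at the vectors `bv x ⊗ bv (-x)`. -/
def capC (q : ℂ) (x : ℤ) : ℂ :=
  if x = 0 then 1 else if x < 0 then -(-q) ^ (-x) else -(-q) ^ (1 - x)

/-- The part `∑_{i < x} cupC (-i) • bv (-i) ⊗ bv i` of the invariant vector. -/
def cupPart (n : ℕ) (q : ℂ) (x : ℤ) : V n ⊗[ℂ] V n :=
  ∑ i ∈ Finset.Ico (-(n : ℤ)) x, cupC q (-i) • (bv (-i) ⊗ₜ bv i)

/-- The scalar `(-1)^{[v][w]} q^{(λ, μ)}` for `v = bv x` of weight `λ` and `w = bv y` of weight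
`μ`. -/
def swapC (q : ℂ) (x y : ℤ) : ℂ :=
  if x = 0 ∨ y = 0 then 1 else if y = x then -q else if y = -x then -q⁻¹ else -1

/-- The explicit form of the permuted `R`-matrix on `V ⊗ V`. In the zero weight space the vector
`bv x ⊗ bv (-x)` is moved to a part of the invariant vector, apart from the terms that appear in all
weight spaces. -/
def braidOp (n : ℕ) (q : ℂ) : Module.End ℂ (V n ⊗[ℂ] V n) :=
  TensorProduct.lift <| bvLift fun x => bvLift fun y =>
    swapC q x y • (bv y ⊗ₜ bv x) - (if y < x then (q - q⁻¹) • (bv x ⊗ₜ bv y) else 0) +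
      if y = -x then ((q - q⁻¹) * capC q x) • cupPart n q x else 0

theorem braidOp_bv {x y : ℤ} (h1 : -(n : ℤ) ≤ x) (h2 : x ≤ n) (h3 : -(n : ℤ) ≤ y) (h4 : y ≤ n) :
    braidOp n q (bv x ⊗ₜ bv y) =
    swapC q x y • (bv y ⊗ₜ bv x) - (if y < x then (q - q⁻¹) • (bv x ⊗ₜ bv y) else 0) +
      if y = -x then ((q - q⁻¹) * capC q x) • cupPart n q x else 0 := by
  rw [braidOp, TensorProduct.lift.tmul, bvLift_bv _ h1 h2, bvLift_bv _ h3 h4]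

/-- The factor `K_i⁻¹ (-1)^{[f_i]}` in the action of `Δ(f_i) = f_i ⊗ 1 + K_i⁻¹ ⊗ f_i`. -/
def kf (q : ℂ) (i : Fin n) : Module.End ℂ (V n) :=
  KV q (-simpleRoot i) * parityV n ^ genParity i

/-- The action of `f_i` on `V ⊗ W`, where `f_i` acts on `W` by `G`. -/
def fTensor {W : Type*} [AddCommGroup W] [Module ℂ W] (q : ℂ) (i : Fin n) (G : Module.End ℂ W) :
    Module.End ℂ (V n ⊗[ℂ] W) :=
  TensorProduct.map (fV i) 1 + TensorProduct.map (kf q i) G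

/-- The eigenvalue of `kf q i` at `bv x`, for `j = i - n`; then `f_i` maps `bv j` to `bv (j + 1)`
and `bv (-j - 1)` to `bv (-j)`. -/
def kfC (q : ℂ) (j x : ℤ) : ℂ :=
  (if j = -1 ∧ x ≠ 0 then -1 else 1) * q ^ ((if x = j + 1 then 1 else 0) +
    (if x = -j then 1 else 0) - (if x = j then 1 else 0) - (if x = -j - 1 then 1 else 0) : ℤ)

theorem kf_bv {i : Fin n} {j : ℤ} (hj : j = (i : ℤ) - n) {x : ℤ} :
    kf q i (bv x : V n) = kfC q j x • bv x := by
  have := i.2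
  have e1 : (parityV n ^ genParity i) (bv x : V n) =
      (if j = -1 ∧ x ≠ 0 then (-1 : ℂ) else 1) • bv x := by
    unfold genParity
    split_ifs with h1 h2 h2
    · rw [pow_one, parityV_bv, sg, if_neg h2.2]
    · rw [pow_one, parityV_bv, sg, if_pos (by omega)]
    · omega
    · simp
  by_cases hx : -(n : ℤ) ≤ x ∧ x ≤ n
  · rw [kf, Module.End.mul_apply, e1, map_smul, KV_bv, smul_smul, kfC]
    congr 3
    rw [neg_dotProduct, simpleRoot_eq, sub_dotProduct, wt_dot (by omega), wt_dot (by omega)]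
    split_ifs <;> omega
  · rw [bv_of_not hx]; simp

theorem f_j {i : Fin n} {j : ℤ} (hj : j = (i : ℤ) - n) : fV i (bv j : V n) = bv (j + 1) := by
  have := i.2
  rw [fV_bv, if_pos hj, hj]

theorem f_j' {i : Fin n} {j : ℤ} (hj : j = (i : ℤ) - n) : fV i (bv (-j - 1) : V n) = bv (-j) := by
  have := i.2
  rw [fV_bv, if_neg (by omega), if_pos (by omega)]; congr 1; omega

theorem f_other {i : Fin n} {j x : ℤ} (hj : j = (i : ℤ) - n) (h1 : x ≠ j) (h2 : x ≠ -j - 1) :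
    fV i (bv x : V n) = 0 := by
  rw [fV_bv, if_neg (by omega), if_neg (by omega)]

theorem fTensor_bv {i : Fin n} {j : ℤ} (hj : j = (i : ℤ) - n) (x y : ℤ) :
    fTensor q i (fV i) (bv x ⊗ₜ bv y : V n ⊗[ℂ] V n) =
      fV i (bv x) ⊗ₜ bv y + kfC q j x • (bv x ⊗ₜ fV i (bv y)) := by
  simp only [fTensor, LinearMap.add_apply, TensorProduct.map_tmul, kf_bv hj, Module.End.one_apply,
    TensorProduct.smul_tmul']

theorem cupPart_succ {x : ℤ} (hx : -(n : ℤ) ≤ x) :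
    cupPart n q (x + 1) = cupPart n q x + cupC q (-x) • (bv (-x) ⊗ₜ bv x) := by
  have : Finset.Ico (-(n : ℤ)) (x + 1) = insert x (Finset.Ico (-(n : ℤ)) x) := by
    ext a; simp only [Finset.mem_insert, Finset.mem_Ico]; omega
  rw [cupPart, this, Finset.sum_insert (by simp), add_comm]; rfl

theorem cupPart_start : cupPart n q (-(n : ℤ)) = 0 := by simp [cupPart]

theorem cupC_succ (h0 : q ≠ 0) {y : ℤ} (h1 : y ≠ 0) (h2 : y ≠ -1) :
    cupC q y = -q * cupC q (y + 1) := by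
  have h : -q ≠ 0 := neg_ne_zero.2 h0
  unfold cupC
  split_ifs <;> first | (exfalso; omega) | skip
  · rw [show -y - 1 = -(y + 1) - 1 + 1 by ring, zpow_add_one₀ h]; ring
  · rw [show -y = -(y + 1) + 1 by ring, zpow_add_one₀ h]; ring

theorem capC_succ (h0 : q ≠ 0) {y : ℤ} (h1 : y ≠ 0) (h2 : y ≠ -1) :
    capC q y = -q * capC q (y + 1) := by
  have h : -q ≠ 0 := neg_ne_zero.2 h0
  unfold capC
  split_ifs <;> first | (exfalso; omega) | skip
  · rw [show -y = -(y + 1) + 1 by ring, zpow_add_one₀ h]; ring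
  · rw [show 1 - y = 1 - (y + 1) + 1 by ring, zpow_add_one₀ h]; ring

theorem cupC_zero : cupC q 0 = 1 := by simp [cupC]
theorem cupC_neg_one : cupC q (-1) = -1 := by simp [cupC]
theorem cupC_one : cupC q 1 = q⁻¹ := by simp [cupC, inv_neg]
theorem capC_zero : capC q 0 = 1 := by simp [capC]
theorem capC_neg_one : capC q (-1) = q := by simp [capC]
theorem capC_one : capC q 1 = -1 := by simp [capC]

theorem f_of_eq {i : Fin n} {j : ℤ} (hj : j = (i : ℤ) - n) {x : ℤ} (hx : x = j) :
    fV i (bv x : V n) = bv (j + 1) := by rw [hx, f_j hj]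

theorem f_of_eq' {i : Fin n} {j : ℤ} (hj : j = (i : ℤ) - n) {x : ℤ} (hx : x = -j - 1) :
    fV i (bv x : V n) = bv (-j) := by rw [hx, f_j' hj]

theorem kfC_up {j x : ℤ} (h : j < -1) (hx : x = j ∨ x = -j - 1) : kfC q j x = q⁻¹ := by
  have : ((if x = j + 1 then 1 else 0) + (if x = -j then 1 else 0) -
    (if x = j then 1 else 0) - (if x = -j - 1 then 1 else 0) : ℤ) = -1 := by
    split_ifs <;> omega
  rw [kfC, if_neg (by omega), one_mul, this, zpow_neg_one]

theorem kfC_down {j x : ℤ} (h : j < -1) (hx : x = j + 1 ∨ x = -j) : kfC q j x = q := by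
  have : ((if x = j + 1 then 1 else 0) + (if x = -j then 1 else 0) -
    (if x = j then 1 else 0) - (if x = -j - 1 then 1 else 0) : ℤ) = 1 := by
    split_ifs <;> omega
  rw [kfC, if_neg (by omega), one_mul, this, zpow_one]

theorem kfC_other {j x : ℤ} (h : j < -1) (h1 : x ≠ j) (h2 : x ≠ j + 1) (h3 : x ≠ -j)
    (h4 : x ≠ -j - 1) : kfC q j x = 1 := by
  rw [kfC, if_neg (by omega), one_mul, if_neg h1, if_neg h2, if_neg h3, if_neg h4]; rfl

theorem kfC_last_up {j x : ℤ} (h : j = -1) (hx : x = -1) : kfC q j x = -q⁻¹ := by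
  subst h hx; simp [kfC]

theorem kfC_last_zero {j x : ℤ} (h : j = -1) (hx : x = 0) : kfC q j x = 1 := by
  subst h hx; simp [kfC]

theorem kfC_last_down {j x : ℤ} (h : j = -1) (hx : x = 1) : kfC q j x = -q := by
  subst h hx; simp [kfC]

theorem kfC_last_other {j x : ℤ} (h : j = -1) (h1 : x ≠ -1) (h2 : x ≠ 0) (h3 : x ≠ 1) :
    kfC q j x = -1 := by
  rw [kfC, if_pos ⟨h, h2⟩, if_neg (by omega), if_neg (by omega), if_neg (by omega),
    if_neg (by omega)]; simp

/-- Applying `f_i` to a part of the invariant vector leaves at most the boundary term. -/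
theorem fTensor_cupPart (h0 : q ≠ 0) {i : Fin n} {j : ℤ} (hj : j = (i : ℤ) - n) {x : ℤ}
    (hx : -(n : ℤ) ≤ x) : fTensor q i (fV i) (cupPart n q x) =
      if x = j + 1 then cupC q (-j) • fTensor q i (fV i) (bv (-j) ⊗ₜ bv j)
      else if x = -j then -(cupC q j • fTensor q i (fV i) (bv j ⊗ₜ bv (-j))) else 0 := by
  have := i.2
  induction x, hx using Int.leInduction with
  | base => rw [cupPart_start, map_zero, if_neg (by omega)]; split_ifs <;> first | rfl | omega
  | succ x hx ih =>
    rw [cupPart_succ hx, map_add, ih, map_smul]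
    rcases eq_or_ne j (-1) with h1 | h1
    · by_cases a1 : x = -1
      · subst a1 h1; simp
      by_cases a2 : x = 0
      · subst a2 h1
        simp (disch := omega) only [fTensor_bv hj, f_of_eq hj, f_of_eq' hj, f_other hj, if_pos,
          if_neg, kfC_last_up, kfC_last_zero, kfC_last_down]
        simp [cupC_zero, cupC_neg_one, cupC_one, smul_smul, h0]
      by_cases a3 : x = 1
      · subst a3 h1
        simp (disch := omega) only [fTensor_bv hj, f_of_eq hj, f_other hj, if_pos,
          if_neg, kfC_last_up]
        simp [cupC_neg_one]
      simp (disch := omega) only [fTensor_bv hj, f_of_eq hj, f_other hj,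
        if_neg]
      simp
    · by_cases a1 : x = j
      · subst a1
        simp (disch := omega) only [if_neg, zero_add, if_true]
      by_cases a2 : x = j + 1
      · subst a2
        simp (disch := omega) only [fTensor_bv hj, f_of_eq hj, f_of_eq' hj, f_other hj,
          if_neg, kfC_up, kfC_down]
        rw [show -(j + 1) = -j - 1 by ring, cupC_succ h0 (y := -j - 1) (by omega) (by omega)]
        simp [smul_smul, mul_comm]
      by_cases a3 : x = -j - 1
      · subst a3
        simp (disch := omega) only [fTensor_bv hj, f_of_eq hj, f_of_eq' hj, f_other hj, if_pos,
          if_neg, kfC_up, kfC_down]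
        rw [show -(-j - 1) = j + 1 by ring, cupC_succ h0 (y := j) (by omega) (by omega)]
        simp [smul_smul, mul_comm]
      by_cases a4 : x = -j
      · subst a4
        simp (disch := omega) only [if_neg, neg_neg, neg_add_cancel, if_true]
      simp (disch := omega) only [fTensor_bv hj, f_of_eq hj, f_other hj,
        if_neg]
      simp

/-- The functional `bv x ⊗ bv (-x) ↦ capC x` on `V ⊗ V`. -/
def capFun (n : ℕ) (q : ℂ) : V n ⊗[ℂ] V n →ₗ[ℂ] ℂ :=
  TensorProduct.lift <| bvLift fun x => bvLift fun y => if y = -x then capC q x else 0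

theorem capFun_bv {x y : ℤ} (h1 : -(n : ℤ) ≤ x) (h2 : x ≤ n) (h3 : -(n : ℤ) ≤ y) (h4 : y ≤ n) :
    capFun n q (bv x ⊗ₜ bv y) = if y = -x then capC q x else 0 := by
  rw [capFun, TensorProduct.lift.tmul, bvLift_bv _ h1 h2, bvLift_bv _ h3 h4]

theorem capC_ne_zero (h0 : q ≠ 0) (x : ℤ) : capC q x ≠ 0 := by
  have h : -q ≠ 0 := neg_ne_zero.2 h0
  unfold capC
  split_ifs
  · exact one_ne_zero
  · exact neg_ne_zero.2 (zpow_ne_zero _ h)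
  · exact neg_ne_zero.2 (zpow_ne_zero _ h)

theorem cupC_neg (h0 : q ≠ 0) (x : ℤ) : cupC q (-x) = (capC q x)⁻¹ := by
  have h : -q ≠ 0 := neg_ne_zero.2 h0
  refine eq_inv_of_mul_eq_one_left ?_
  unfold capC cupC
  split_ifs <;> first | (exfalso; omega) | skip
  · simp
  · rw [neg_mul_neg, ← zpow_add₀ h, show - -x - 1 + (1 - x) = 0 by ring, zpow_zero]
  · rw [neg_mul_neg, ← zpow_add₀ h, neg_add_cancel, zpow_zero]

theorem capFun_fTensor (h0 : q ≠ 0) (i : Fin n) : capFun n q ∘ₗ fTensor q i (fV i) = 0 := by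
  have := i.2
  obtain ⟨j, hj⟩ : ∃ j : ℤ, j = (i : ℤ) - n := ⟨_, rfl⟩
  refine hom_ext_bv₂ fun x y h1 h2 h3 h4 => ?_
  rw [LinearMap.comp_apply, LinearMap.zero_apply]
  by_cases h : j = -1
  · have hx : x = -1 ∨ x = 0 ∨ x = 1 ∨ (x ≠ -1 ∧ x ≠ 0 ∧ x ≠ 1) := by omega
    have hy : y = -1 ∨ y = 0 ∨ y = 1 ∨ (y ≠ -1 ∧ y ≠ 0 ∧ y ≠ 1) := by omega
    rcases hx with hx | hx | hx | hx <;> rcases hy with hy | hy | hy | hy <;>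
      simp (disch := omega) only [fTensor_bv hj, f_of_eq hj, f_of_eq' hj, f_other hj, if_true,
        kfC_last_up, kfC_last_zero, kfC_last_down, kfC_last_other, TensorProduct.zero_tmul,
        TensorProduct.tmul_zero, map_add, map_smul, map_zero, smul_zero, add_zero, zero_add,
        capFun_bv, if_neg, hx, hy, h, neg_zero, neg_neg, neg_add_cancel] <;>
      simp [capC_zero, capC_one, capC_neg_one, h0]
  · have hx : x = j ∨ x = j + 1 ∨ x = -j - 1 ∨ x = -j ∨
      (x ≠ j ∧ x ≠ j + 1 ∧ x ≠ -j - 1 ∧ x ≠ -j) := by omega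
    have hy : y = j ∨ y = j + 1 ∨ y = -j - 1 ∨ y = -j ∨
      (y ≠ j ∧ y ≠ j + 1 ∧ y ≠ -j - 1 ∧ y ≠ -j) := by omega
    have e1 := capC_succ h0 (y := j) (by omega) (by omega)
    have e2 : capC q (-j - 1) = -q * capC q (-j) := by
      rw [capC_succ h0 (y := -j - 1) (by omega) (by omega), sub_add_cancel]
    rcases hx with hx | hx | hx | hx | hx <;> rcases hy with hy | hy | hy | hy | hy <;>
      simp (disch := omega) only [fTensor_bv hj, f_of_eq hj, f_of_eq' hj, f_other hj, if_true,
        kfC_up, kfC_down, kfC_other, TensorProduct.zero_tmul, TensorProduct.tmul_zero, map_add,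
        map_smul, map_zero, smul_zero, add_zero, zero_add, capFun_bv, if_pos, if_neg, hx, hy, e1,
        e2] <;>
      simp [h0]

set_option maxHeartbeats 2000000 in
/-- The case of the odd generator `f_n`. -/
theorem braidOp_fTensor_last (h0 : q ≠ 0) {i : Fin n} {j : ℤ} (hj : j = (i : ℤ) - n)
    (h : j = -1) {x y : ℤ} (h1 : -(n : ℤ) ≤ x) (h2 : x ≤ n) (h3 : -(n : ℤ) ≤ y) (h4 : y ≤ n) :
    braidOp n q (fTensor q i (fV i) (bv x ⊗ₜ bv y)) =
      fTensor q i (fV i) (braidOp n q (bv x ⊗ₜ bv y)) := by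
  have := i.2
  have hlt : y < x ∨ ¬ y < x := em _
  have hng : y = -x ∨ y ≠ -x := em _
  have hx : x = -1 ∨ x = 0 ∨ x = 1 ∨ (x ≠ -1 ∧ x ≠ 0 ∧ x ≠ 1) := by omega
  have hy : y = -1 ∨ y = 0 ∨ y = 1 ∨ (y ≠ -1 ∧ y ≠ 0 ∧ y ≠ 1) := by omega
  have s0 : cupPart n q 0 = cupPart n q (-1) + cupC q 1 • (bv 1 ⊗ₜ bv (-1)) :=
    cupPart_succ (x := -1) (by omega)
  have s1 : cupPart n q 1 = cupPart n q 0 + cupC q 0 • (bv 0 ⊗ₜ bv 0) :=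
    cupPart_succ (x := 0) (by omega)
  rw [cupC_one] at s0
  rw [cupC_zero, s0] at s1
  rw [braidOp_bv h1 h2 h3 h4, map_add, map_sub, map_smul]
  rcases hx with hx | hx | hx | hx <;> rcases hy with hy | hy | hy | hy <;>
    rcases hlt with hlt | hlt <;> rcases hng with hng | hng <;> first | (exfalso; omega) | skip
  all_goals
    simp (disch := omega) only [fTensor_bv hj, f_of_eq hj, f_of_eq' hj, f_other hj, if_true,
      kfC_last_up, kfC_last_zero, kfC_last_down, kfC_last_other, TensorProduct.zero_tmul,
      TensorProduct.tmul_zero, map_add, map_smul, map_zero, smul_zero, add_zero, zero_add,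
      braidOp_bv, swapC, if_pos, if_neg, fTensor_cupPart h0 hj, hx, hy, h, true_or, or_true,
      or_false, false_or, if_false, sub_zero, neg_zero,
      neg_neg, neg_add_cancel, s0, s1, capC_zero, capC_one, capC_neg_one, cupC_neg_one, cupC_one]
  all_goals match_scalars <;> first | (field_simp; ring) | field_simp

set_option maxHeartbeats 2000000 in
/-- The case of the even generators. -/
theorem braidOp_fTensor_of_ne (h0 : q ≠ 0) {i : Fin n} {j : ℤ} (hj : j = (i : ℤ) - n)
    (h : j ≠ -1) {x y : ℤ} (h1 : -(n : ℤ) ≤ x) (h2 : x ≤ n) (h3 : -(n : ℤ) ≤ y) (h4 : y ≤ n) :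
    braidOp n q (fTensor q i (fV i) (bv x ⊗ₜ bv y)) =
      fTensor q i (fV i) (braidOp n q (bv x ⊗ₜ bv y)) := by
  have := i.2
  have hlt : y < x ∨ ¬ y < x := em _
  have hng : y = -x ∨ y ≠ -x := em _
  have hx : x = j ∨ x = j + 1 ∨ x = -j - 1 ∨ x = -j ∨
    (x = 0 ∧ x ≠ j ∧ x ≠ j + 1 ∧ x ≠ -j - 1 ∧ x ≠ -j) ∨
    (x ≠ 0 ∧ x ≠ j ∧ x ≠ j + 1 ∧ x ≠ -j - 1 ∧ x ≠ -j) := by omega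
  have hy : y = j ∨ y = j + 1 ∨ y = -j - 1 ∨ y = -j ∨
    (y = 0 ∧ y ≠ j ∧ y ≠ j + 1 ∧ y ≠ -j - 1 ∧ y ≠ -j) ∨
    (y ≠ 0 ∧ y ≠ j ∧ y ≠ j + 1 ∧ y ≠ -j - 1 ∧ y ≠ -j) := by omega
  have e1 := capC_succ h0 (y := j) (by omega) (by omega)
  have e2 : capC q (-j - 1) = -q * capC q (-j) := by
    rw [capC_succ h0 (y := -j - 1) (by omega) (by omega), sub_add_cancel]
  have c1 : capC q (j + 1) ≠ 0 := capC_ne_zero h0 _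
  have c2 : capC q (-j) ≠ 0 := capC_ne_zero h0 _
  have d1 : cupC q (-j) = (-q * capC q (j + 1))⁻¹ := by rw [cupC_neg h0, e1]
  have d2 : cupC q j = (capC q (-j))⁻¹ := by rw [← cupC_neg h0, neg_neg]
  have d3 : cupC q (j + 1) = (-q * capC q (-j))⁻¹ := by
    rw [← e2, ← cupC_neg h0]; congr 1; ring
  have s1 : cupPart n q (j + 1) = cupPart n q j + cupC q (-j) • (bv (-j) ⊗ₜ bv j) :=
    cupPart_succ (by omega)
  have s2 : cupPart n q (-j) = cupPart n q (-j - 1) +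
      cupC q (j + 1) • (bv (j + 1) ⊗ₜ bv (-j - 1)) := by
    have := cupPart_succ (n := n) (q := q) (x := -j - 1) (by omega)
    rwa [sub_add_cancel, show -(-j - 1) = j + 1 by ring] at this
  rw [braidOp_bv h1 h2 h3 h4, map_add, map_sub, map_smul]
  rcases hx with hx | hx | hx | hx | hx | hx <;> rcases hy with hy | hy | hy | hy | hy | hy <;>
    rcases hlt with hlt | hlt <;> rcases hng with hng | hng <;> first | (exfalso; omega) | skip
  all_goals
    simp (disch := omega) only [fTensor_bv hj, f_of_eq hj, f_of_eq' hj, f_other hj, if_true,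
      kfC_up, kfC_down, kfC_other, TensorProduct.zero_tmul, TensorProduct.tmul_zero, map_add,
      map_smul, map_zero, smul_zero, add_zero, zero_add, braidOp_bv, swapC, if_pos, if_neg,
      fTensor_cupPart h0 hj, hx, hy, true_or, or_true, or_false, false_or, if_false, sub_zero,
      e1, e2, s1, s2, d1, d2, d3]
  all_goals match_scalars <;> first | (field_simp; ring) | field_simp

/-- The braid operator is linear with respect to the `f_i`, by comparison of the values on all
`bv x ⊗ bv y`. -/
theorem braidOp_fTensor (h0 : q ≠ 0) (i : Fin n) :
    braidOp n q * fTensor q i (fV i) = fTensor q i (fV i) * braidOp n q := by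
  refine hom_ext_bv₂ fun x y h1 h2 h3 h4 => ?_
  by_cases h : (i : ℤ) - n = -1
  · exact braidOp_fTensor_last h0 rfl h h1 h2 h3 h4
  · exact braidOp_fTensor_of_ne h0 rfl h h1 h2 h3 h4

/-! ### Generation by the highest weight vector -/

/-- Every basis vector `bv (x + 1)` is of the form `f_i (bv x)`. -/
theorem exists_fV_bv {x : ℤ} (h1 : -(n : ℤ) ≤ x) (h2 : x < n) :
    ∃ i : Fin n, fV i (bv x : V n) = bv (x + 1) := by
  rcases lt_or_ge x 0 with h | h
  · exact ⟨⟨(x + n).toNat, by omega⟩, f_j (by simp; omega)⟩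
  · refine ⟨⟨(-x - 1 + n).toNat, by omega⟩, ?_⟩
    rw [f_of_eq' (j := -x - 1) (by simp; omega) (by ring)]; congr 1; ring

/-- `V ⊗ W` is generated by `v ⊗ W` under the operators `f_i`, where `v` is the highest weight
vector of `V`. -/
theorem eq_zero_of_fTensor {W Z : Type*} [AddCommGroup W] [Module ℂ W] [AddCommGroup Z]
    [Module ℂ Z] {G : Fin n → Module.End ℂ W} {X : V n ⊗[ℂ] W →ₗ[ℂ] Z}
    (H : Fin n → Z →ₗ[ℂ] Z) (hX : ∀ i, X ∘ₗ fTensor q i (G i) = H i ∘ₗ X)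
    (hv : ∀ w, X (bv (-(n : ℤ)) ⊗ₜ w) = 0) : X = 0 := by
  refine TensorProduct.ext (hom_ext_bv fun x h1 _ => LinearMap.ext fun w => ?_)
  change X (bv x ⊗ₜ w) = 0
  induction x, h1 using Int.leInduction generalizing w with
  | base => exact hv w
  | succ x hx ih =>
    obtain ⟨i, hi⟩ := exists_fV_bv hx (by omega)
    have h := LinearMap.congr_fun (hX i) (bv x ⊗ₜ w)
    simp only [LinearMap.comp_apply, fTensor, LinearMap.add_apply, TensorProduct.map_tmul, hi,
      kf_bv rfl, Module.End.one_apply, map_add, ← TensorProduct.smul_tmul', map_smul,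
      ih (by omega), map_zero, smul_zero, add_zero] at h
    exact h

/-- `V` is generated by its highest weight vector under the operators `f_i`. -/
theorem eq_zero_of_fV {Z : Type*} [AddCommGroup Z] [Module ℂ Z] {X : V n →ₗ[ℂ] Z}
    (H : Fin n → Z →ₗ[ℂ] Z) (hX : ∀ i, X ∘ₗ fV i = H i ∘ₗ X)
    (hv : X (bv (-(n : ℤ))) = 0) : X = 0 := by
  refine hom_ext_bv fun x h1 _ => ?_
  change X (bv x) = 0
  induction x, h1 using Int.leInduction with
  | base => exact hv
  | succ x hx ih =>
    obtain ⟨i, hi⟩ := exists_fV_bv hx (by omega)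
    have h := LinearMap.congr_fun (hX i) (bv x)
    simpa only [LinearMap.comp_apply, hi, ih (by omega), map_zero] using h

/-! ### The inverse of the braid operator and the action on the invariant functional -/

/-- The braid operator commutes with `D ⊗ D` for diagonal operators `D` whose eigenvalues on
opposite weights are inverse to each other. -/
theorem braidOp_map_diag {D : Module.End ℂ (V n)} {d : ℤ → ℂ} (hD : ∀ x, D (bv x) = d x • bv x)
    (hd : ∀ x, d x * d (-x) = 1) :
    braidOp n q * TensorProduct.map D D = TensorProduct.map D D * braidOp n q := by
  have hc : ∀ x, TensorProduct.map D D (cupPart n q x) = cupPart n q x := fun x => by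
    rw [cupPart, map_sum]
    refine Finset.sum_congr rfl fun i _ => ?_
    rw [map_smul, TensorProduct.map_tmul, hD, hD, TensorProduct.smul_tmul_smul, mul_comm, hd,
      one_smul]
  refine hom_ext_bv₂ fun x y h1 h2 h3 h4 => ?_
  have hs : ∀ a b : ℤ, D (bv a) ⊗ₜ[ℂ] D (bv b) = (d a * d b) • (bv a ⊗ₜ bv b : V n ⊗[ℂ] V n) :=
    fun a b => by rw [hD, hD, TensorProduct.smul_tmul_smul]
  simp only [Module.End.mul_apply, TensorProduct.map_tmul, hs, map_smul, braidOp_bv h1 h2 h3 h4,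
    map_add, map_sub]
  have e1 : TensorProduct.map D D (if y < x then (q - q⁻¹) • (bv x ⊗ₜ bv y) else 0) =
      (d x * d y) • (if y < x then (q - q⁻¹) • (bv x ⊗ₜ bv y) else 0 : V n ⊗[ℂ] V n) := by
    split_ifs
    · rw [map_smul, TensorProduct.map_tmul, hs, smul_comm]
    · simp
  have e2 : TensorProduct.map D D
      (if y = -x then ((q - q⁻¹) * capC q x) • cupPart n q x else 0) =
      (d x * d y) • (if y = -x then ((q - q⁻¹) * capC q x) • cupPart n q x else 0) := by
    split_ifs with h
    · rw [map_smul, hc, h, hd, one_smul]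
    · simp
  rw [e1, e2, smul_add, smul_sub, smul_comm (d x * d y), mul_comm (d y)]

theorem braidOp_map_KV (h0 : q ≠ 0) (β : Weight n) :
    braidOp n q * TensorProduct.map (KV q β) (KV q β) =
      TensorProduct.map (KV q β) (KV q β) * braidOp n q :=
  braidOp_map_diag (d := fun x => q ^ (β ⬝ᵥ wt x)) (KV_bv β) fun x => by
    rw [wt_neg, dotProduct_neg, zpow_neg, mul_inv_cancel₀ (zpow_ne_zero _ h0)]

theorem braidOp_map_parityV :
    braidOp n q * TensorProduct.map (parityV n) (parityV n) =
      TensorProduct.map (parityV n) (parityV n) * braidOp n q :=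
  braidOp_map_diag (d := sg) parityV_bv fun x => by
    unfold sg; split_ifs <;> first | omega | simp

theorem braidOp_map_mul {A B : Module.End ℂ (V n)}
    (hA : braidOp n q * TensorProduct.map A A = TensorProduct.map A A * braidOp n q)
    (hB : braidOp n q * TensorProduct.map B B = TensorProduct.map B B * braidOp n q) :
    braidOp n q * TensorProduct.map (A * B) (A * B) =
      TensorProduct.map (A * B) (A * B) * braidOp n q := by
  rw [TensorProduct.map_mul, ← mul_assoc, hA, mul_assoc, hB, mul_assoc]

theorem braidOp_map_parity_pow (i : Fin n) :
    braidOp n q * TensorProduct.map (parityV n ^ genParity i) (parityV n ^ genParity i) =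
      TensorProduct.map (parityV n ^ genParity i) (parityV n ^ genParity i) * braidOp n q := by
  rcases genParity_le i with h | h <;> rw [h]
  · simp [TensorProduct.map_one]
  · simpa using braidOp_map_parityV

theorem braidOp_map_kf (h0 : q ≠ 0) (i : Fin n) :
    braidOp n q * TensorProduct.map (kf q i) (kf q i) =
      TensorProduct.map (kf q i) (kf q i) * braidOp n q :=
  braidOp_map_mul (braidOp_map_KV h0 _) (braidOp_map_parity_pow i)

/-- The scalars by which the braid operator permutes the highest weight vector of `V` with the
other vectors of `V`. -/
def swapV (n : ℕ) (q : ℂ) : Module.End ℂ (V n) := parityV n * KV q (wt (-(n : ℤ)))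

theorem swapV_bv (hn : 1 ≤ n) {y : ℤ} : swapV n q (bv y) = swapC q (-(n : ℤ)) y • bv y := by
  rw [swapV, Module.End.mul_apply, KV_bv, map_smul, parityV_bv, smul_smul, wt_dot (by omega)]
  congr 1
  unfold swapC sg
  split_ifs <;> first | (exfalso; omega) | simp

/-- The braid operator only permutes the highest weight vector with the other vectors. -/
theorem braidOp_highest (hn : 1 ≤ n) (w : V n) :
    braidOp n q (bv (-(n : ℤ)) ⊗ₜ w) = swapV n q w ⊗ₜ bv (-(n : ℤ)) := by
  suffices h : braidOp n q ∘ₗ TensorProduct.mk ℂ (V n) (V n) (bv (-(n : ℤ))) =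
    (TensorProduct.mk ℂ (V n) (V n)).flip (bv (-(n : ℤ))) ∘ₗ swapV n q from LinearMap.congr_fun h w
  refine hom_ext_bv fun y h1 h2 => ?_
  change braidOp n q (bv (-(n : ℤ)) ⊗ₜ bv y) = swapV n q (bv y) ⊗ₜ bv (-(n : ℤ))
  rw [braidOp_bv (by omega) (by omega) h1 h2, swapV_bv hn, if_neg (by omega), sub_zero,
    cupPart_start, smul_zero, ite_self, add_zero, TensorProduct.smul_tmul']

/-- The invariant vector of `V ⊗ V`. -/
def cupV (n : ℕ) (q : ℂ) : V n ⊗[ℂ] V n := cupPart n q (n + 1)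

theorem fTensor_cupV (h0 : q ≠ 0) (i : Fin n) : fTensor q i (fV i) (cupV n q) = 0 := by
  have := i.2
  rw [cupV, fTensor_cupPart h0 rfl (by omega), if_neg (by omega), if_neg (by omega)]

/-- The rank one operator `cupV ∘ capFun`, a multiple of the projection of `V ⊗ V` onto its trivial
submodule. -/
def cupCap (n : ℕ) (q : ℂ) : Module.End ℂ (V n ⊗[ℂ] V n) := (capFun n q).smulRight (cupV n q)

theorem cupCap_apply (u : V n ⊗[ℂ] V n) : cupCap n q u = capFun n q u • cupV n q := rfl

theorem cupCap_fTensor (h0 : q ≠ 0) (i : Fin n) : cupCap n q * fTensor q i (fV i) = 0 := by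
  ext1; ext a b
  have := LinearMap.congr_fun (capFun_fTensor (n := n) h0 i) (a ⊗ₜ b)
  simp only [LinearMap.comp_apply, LinearMap.zero_apply] at this
  simp [cupCap_apply, this]

theorem fTensor_cupCap (h0 : q ≠ 0) (i : Fin n) : fTensor q i (fV i) * cupCap n q = 0 := by
  ext1; ext a b
  simp [cupCap_apply, fTensor_cupV h0]

/-- The inverse of the braid operator. -/
def braidInv (n : ℕ) (q : ℂ) : Module.End ℂ (V n ⊗[ℂ] V n) :=
  braidOp n q + (q - q⁻¹) • (1 - cupCap n q)

theorem braidInv_fTensor (h0 : q ≠ 0) (i : Fin n) :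
    braidInv n q * fTensor q i (fV i) = fTensor q i (fV i) * braidInv n q := by
  simp only [braidInv, add_mul, mul_add, smul_mul_assoc, mul_smul_comm, sub_mul, mul_sub,
    cupCap_fTensor h0, fTensor_cupCap h0, braidOp_fTensor h0, one_mul, mul_one]

/-- Both sides are linear with respect to the `f_i`, so that they need only be compared on `v ⊗ V`
for the highest weight vector `v`. -/
theorem braidInv_mul_braidOp (hn : 1 ≤ n) (h0 : q ≠ 0) : braidInv n q * braidOp n q = 1 := by
  rw [← sub_eq_zero]
  refine eq_zero_of_fTensor (q := q) (G := fV) (fun i => fTensor q i (fV i)) (fun i => ?_)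
    fun w => ?_
  · change (braidInv n q * braidOp n q - 1) * fTensor q i (fV i) =
      fTensor q i (fV i) * (braidInv n q * braidOp n q - 1)
    rw [sub_mul, mul_sub, mul_assoc, braidOp_fTensor h0, ← mul_assoc, braidInv_fTensor h0,
      mul_assoc, one_mul, mul_one]
  · suffices h : (braidInv n q * braidOp n q - 1) ∘ₗ
      TensorProduct.mk ℂ (V n) (V n) (bv (-(n : ℤ))) = 0 from LinearMap.congr_fun h w
    refine hom_ext_bv fun y h1 h2 => ?_
    change (braidInv n q * braidOp n q - 1) (bv (-(n : ℤ)) ⊗ₜ bv y) = 0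
    rw [LinearMap.sub_apply, Module.End.mul_apply, braidOp_highest hn, swapV_bv hn,
      ← TensorProduct.smul_tmul', map_smul, Module.End.one_apply, sub_eq_zero]
    simp only [braidInv, LinearMap.add_apply, LinearMap.smul_apply, LinearMap.sub_apply,
      Module.End.one_apply, cupCap_apply]
    rw [braidOp_bv h1 h2 (by omega) (by omega), capFun_bv h1 h2 (by omega) (by omega)]
    rcases eq_or_ne y n with rfl | hy
    · have hc : cupV n q = cupPart n q n + (capC q n)⁻¹ • (bv (-(n : ℤ)) ⊗ₜ bv (n : ℤ)) := by
        rw [cupV, cupPart_succ (by omega), cupC_neg h0]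
      have hne := capC_ne_zero h0 n
      simp (disch := omega) only [if_pos, if_neg, if_true, hc, swapC]
      match_scalars <;> field_simp <;> ring
    · rcases eq_or_ne y (-(n : ℤ)) with rfl | hy'
      · simp (disch := omega) only [if_neg, if_true, swapC]
        match_scalars <;> field_simp <;> ring
      · rcases eq_or_ne y 0 with rfl | hy''
        · simp (disch := omega) only [if_pos, if_neg, if_true, swapC, true_or, or_true]
          match_scalars <;> field_simp <;> ring
        · simp (disch := omega) only [if_pos, if_neg, swapC]
          match_scalars <;> field_simp <;> ring

theorem braidOp_mul_braidInv (hn : 1 ≤ n) (h0 : q ≠ 0) : braidOp n q * braidInv n q = 1 :=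
  mul_eq_one_comm.1 (braidInv_mul_braidOp hn h0)

/-- The twist of `V`: the invariant functional is an eigenvector of the braid operator. -/
theorem capFun_braidOp (hn : 1 ≤ n) (h0 : q ≠ 0) :
    capFun n q ∘ₗ braidOp n q = (q ^ (2 * n))⁻¹ • capFun n q := by
  rw [← sub_eq_zero]
  refine eq_zero_of_fTensor (q := q) (G := fV) (fun i => 0) (fun i => ?_) fun w => ?_
  · have h1 := capFun_fTensor (n := n) h0 i
    have h2 : braidOp n q ∘ₗ fTensor q i (fV i) = fTensor q i (fV i) ∘ₗ braidOp n q :=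
      braidOp_fTensor h0 i
    rw [LinearMap.sub_comp, LinearMap.comp_assoc, h2, ← LinearMap.comp_assoc, h1,
      LinearMap.smul_comp, h1]
    simp
  · suffices h : (capFun n q ∘ₗ braidOp n q - (q ^ (2 * n))⁻¹ • capFun n q) ∘ₗ
      TensorProduct.mk ℂ (V n) (V n) (bv (-(n : ℤ))) = 0 from LinearMap.congr_fun h w
    refine hom_ext_bv fun y h1 h2 => ?_
    change (capFun n q ∘ₗ braidOp n q - (q ^ (2 * n))⁻¹ • capFun n q) (bv (-(n : ℤ)) ⊗ₜ bv y) = 0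
    rw [LinearMap.sub_apply, LinearMap.comp_apply, braidOp_highest hn, swapV_bv hn,
      ← TensorProduct.smul_tmul', map_smul, LinearMap.smul_apply, capFun_bv h1 h2 (by omega)
      (by omega), capFun_bv (by omega) (by omega) h1 h2]
    rcases eq_or_ne y n with rfl | hy
    · have h : -q ≠ 0 := neg_ne_zero.2 h0
      have e : (q ^ (2 * n) : ℂ) = (-q) ^ n * (-q) ^ n := by rw [← pow_add, neg_pow, ← two_mul]; simp
      have e1 : capC q n = q * ((-q) ^ n)⁻¹ := by
        rw [capC, if_neg (by omega), if_neg (by omega), zpow_sub₀ h, zpow_one, zpow_natCast]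
        field_simp
      have e2 : capC q (-n) = -(-q) ^ n := by
        rw [capC, if_neg (by omega), if_pos (by omega), neg_neg, zpow_natCast]
      have h3 : (-q) ^ n ≠ 0 := pow_ne_zero _ h
      simp (disch := omega) only [if_neg, if_true, swapC, neg_neg, e, e1, e2, smul_eq_mul]
      field_simp
      ring
    · rw [if_neg (by omega), if_neg (by omega)]; simp

/-! ### Linearity with respect to the raising operators -/

/-- The action of `e_i` on `V ⊗ V`. -/
def eTensor (q : ℂ) (i : Fin n) : Module.End ℂ (V n ⊗[ℂ] V n) :=
  TensorProduct.map (eV i) (KV q (simpleRoot i)) +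
    TensorProduct.map (parityV n ^ genParity i) (eV i)

theorem eTensor_fTensor (h0 : q ≠ 0) (h1 : q ^ 2 ≠ 1) (i j : Fin n) :
    eTensor q i * fTensor q j (fV j) =
      (-1 : ℂ) ^ (genParity i * genParity j) • (fTensor q j (fV j) * eTensor q i) +
        if i = j then (q - q⁻¹)⁻¹ • (TensorProduct.map (KV q (simpleRoot i)) (KV q (simpleRoot i)) -
          TensorProduct.map (KV q (-simpleRoot i)) (KV q (-simpleRoot i))) else 0 := by
  set s : ℂ := (-1) ^ (genParity i * genParity j) with hs
  have hss : s * s = 1 := by rw [hs, ← mul_pow]; simp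
  have hV := (isURep_V (n := n) h0 h1).ef i j
  rw [neg_one_pow_mul, ← hs, sub_eq_iff_eq_add'] at hV
  have a1 : eV i * kf q j = (s * q ^ (simpleRoot i ⬝ᵥ simpleRoot j)) • (kf q j * eV i) := by
    rw [kf, ← mul_assoc, eV_KV h0, smul_mul_assoc, mul_assoc, eV_parity_pow, mul_smul_comm,
      smul_smul, neg_dotProduct, neg_neg, ← mul_assoc, hs, mul_comm (genParity j),
      dotProduct_comm (simpleRoot j), mul_comm]
  have a2 : KV q (simpleRoot i) * fV j =
      q ^ (-(simpleRoot i ⬝ᵥ simpleRoot j)) • (fV j * KV q (simpleRoot i)) := KV_fV h0 _ _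
  have a3 : parityV n ^ genParity i * fV j = s • (fV j * parityV n ^ genParity i) := by
    rw [fV_parity_pow, smul_smul, ← hs, hss, one_smul]
  have a4 : parityV n ^ genParity i * kf q j = kf q j * parityV n ^ genParity i := by
    rw [kf, ← mul_assoc, parity_pow_KV, mul_assoc, parity_pow_comm, mul_assoc]
  have a5 : i = j → kf q j * parityV n ^ genParity i = KV q (-simpleRoot i) := by
    rintro rfl
    rw [kf, mul_assoc, parity_pow_mul_self, mul_one]
  have hqq : q ^ (simpleRoot i ⬝ᵥ simpleRoot j) * q ^ (-(simpleRoot i ⬝ᵥ simpleRoot j)) = 1 := by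
    rw [← zpow_add₀ h0]; simp
  simp only [eTensor, fTensor, add_mul, mul_add, ← TensorProduct.map_mul, mul_one, one_mul]
  rw [hV, a1, a2, a3, a4]
  simp only [TensorProduct.map_smul_left, TensorProduct.map_smul_right, smul_smul,
    TensorProduct.map_add_left, TensorProduct.map_add_right, smul_add]
  split_ifs with hij
  · rw [a5 hij]
    simp only [TensorProduct.map_smul_left, TensorProduct.map_smul_right]
    have d1 : TensorProduct.map (KV q (simpleRoot i) - KV q (-simpleRoot i))
        (KV q (simpleRoot i)) = TensorProduct.map (KV q (simpleRoot i)) (KV q (simpleRoot i)) -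
          TensorProduct.map (KV q (-simpleRoot i)) (KV q (simpleRoot i)) := by
      ext; simp [TensorProduct.sub_tmul]
    have d2 : TensorProduct.map (KV q (-simpleRoot i))
        (KV q (simpleRoot i) - KV q (-simpleRoot i)) =
        TensorProduct.map (KV q (-simpleRoot i)) (KV q (simpleRoot i)) -
          TensorProduct.map (KV q (-simpleRoot i)) (KV q (-simpleRoot i)) := by
      ext; simp [TensorProduct.tmul_sub]
    rw [d1, d2]
    have : q ^ (-(simpleRoot i ⬝ᵥ simpleRoot j)) * (s * q ^ (simpleRoot i ⬝ᵥ simpleRoot j)) = s := by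
      rw [mul_left_comm, mul_comm (q ^ _), hqq, mul_one]
    match_scalars <;> first | ring1 | linear_combination this
  · simp only [TensorProduct.map_zero_left, TensorProduct.map_zero_right, add_zero]
    have : q ^ (-(simpleRoot i ⬝ᵥ simpleRoot j)) * (s * q ^ (simpleRoot i ⬝ᵥ simpleRoot j)) = s := by
      rw [mul_left_comm, mul_comm (q ^ _), hqq, mul_one]
    match_scalars <;> first | ring1 | linear_combination this

theorem eV_highest (i : Fin n) : eV i (bv (-(n : ℤ)) : V n) = 0 := by
  have := i.2
  rw [eV_bv, if_neg (by omega), if_neg (by omega)]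

/-- Linearity with respect to the `e_i` follows from linearity with respect to the `f_i`: the
commutator of the braid operator with `e_i` again commutes with the `f_j` up to sign, and it
vanishes on the generators `v ⊗ V`, where `v` is the highest weight vector. -/
theorem braidOp_eTensor (hn : 1 ≤ n) (h0 : q ≠ 0) (h1 : q ^ 2 ≠ 1) (i : Fin n) :
    braidOp n q * eTensor q i = eTensor q i * braidOp n q := by
  rw [← sub_eq_zero]
  refine eq_zero_of_fTensor (q := q) (G := fV)
    (fun j => (-1 : ℂ) ^ (genParity i * genParity j) • fTensor q j (fV j)) (fun j => ?_) fun w => ?_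
  · change (braidOp n q * eTensor q i - eTensor q i * braidOp n q) * fTensor q j (fV j) =
      ((-1 : ℂ) ^ (genParity i * genParity j) • fTensor q j (fV j)) *
        (braidOp n q * eTensor q i - eTensor q i * braidOp n q)
    rw [sub_mul, mul_assoc, mul_assoc, braidOp_fTensor h0, ← mul_assoc (eTensor q i),
      eTensor_fTensor h0 h1, add_mul, mul_add, mul_smul_comm, ← mul_assoc, braidOp_fTensor h0,
      mul_sub, smul_mul_assoc, smul_mul_assoc, smul_mul_assoc, mul_assoc, mul_assoc]
    have : braidOp n q * (if i = j then (q - q⁻¹)⁻¹ •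
        (TensorProduct.map (KV q (simpleRoot i)) (KV q (simpleRoot i)) -
          TensorProduct.map (KV q (-simpleRoot i)) (KV q (-simpleRoot i))) else 0) =
        (if i = j then (q - q⁻¹)⁻¹ •
        (TensorProduct.map (KV q (simpleRoot i)) (KV q (simpleRoot i)) -
          TensorProduct.map (KV q (-simpleRoot i)) (KV q (-simpleRoot i))) else 0) *
          braidOp n q := by
      split_ifs
      · rw [mul_smul_comm, smul_mul_assoc, mul_sub, sub_mul, braidOp_map_KV h0, braidOp_map_KV h0]
      · simp
    rw [this]
    abel
  · have hP : (parityV n ^ genParity i) (bv (-(n : ℤ)) : V n) =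
        (-1 : ℂ) ^ genParity i • bv (-(n : ℤ)) := by
      rcases genParity_le i with h | h <;> rw [h]
      · simp
      · rw [pow_one, parityV_bv, sg, if_neg (by omega), pow_one]
    have hS : swapV n q (eV i w) = ((-1 : ℂ) ^ genParity i *
        q ^ (wt (-(n : ℤ)) ⬝ᵥ simpleRoot i)) • eV i (swapV n q w) := by
      refine LinearMap.congr_fun (f := swapV n q * eV i) (g := ((-1 : ℂ) ^ genParity i *
        q ^ (wt (-(n : ℤ)) ⬝ᵥ simpleRoot i)) • (eV i * swapV n q)) ?_ w
      rw [swapV, mul_assoc, KV_eV h0, mul_smul_comm, ← mul_assoc, parityV_eV, smul_mul_assoc,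
        smul_smul, mul_assoc, mul_comm]
    rw [LinearMap.sub_apply, Module.End.mul_apply, Module.End.mul_apply, braidOp_highest hn]
    simp only [eTensor, LinearMap.add_apply, TensorProduct.map_tmul, eV_highest, hP, KV_bv,
      TensorProduct.zero_tmul, TensorProduct.tmul_zero, zero_add, add_zero,
      ← TensorProduct.smul_tmul', map_smul, braidOp_highest hn, hS, TensorProduct.tmul_smul,
      smul_smul]
    rw [← mul_assoc, ← mul_pow, dotProduct_comm]
    simp

/-! ### The braid relation -/

/-- The action of `X ⊗ 1` on `V ⊗ (V ⊗ V)`. -/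
def op12 (X : Module.End ℂ (V n ⊗[ℂ] V n)) : Module.End ℂ (V n ⊗[ℂ] (V n ⊗[ℂ] V n)) :=
  (TensorProduct.assoc ℂ (V n) (V n) (V n)).toLinearMap ∘ₗ TensorProduct.map X 1 ∘ₗ
    (TensorProduct.assoc ℂ (V n) (V n) (V n)).symm.toLinearMap

/-- The action of `1 ⊗ X` on `V ⊗ (V ⊗ V)`. -/
def op23 (X : Module.End ℂ (V n ⊗[ℂ] V n)) : Module.End ℂ (V n ⊗[ℂ] (V n ⊗[ℂ] V n)) :=
  TensorProduct.map 1 X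

/-- The action of `f_i` on `V ⊗ (V ⊗ V)`. -/
def fTensor₃ (q : ℂ) (i : Fin n) : Module.End ℂ (V n ⊗[ℂ] (V n ⊗[ℂ] V n)) :=
  fTensor q i (fTensor q i (fV i))

theorem op12_assoc (X : Module.End ℂ (V n ⊗[ℂ] V n)) (u : V n ⊗[ℂ] V n) (c : V n) :
    op12 X (TensorProduct.assoc ℂ (V n) (V n) (V n) (u ⊗ₜ c)) =
      TensorProduct.assoc ℂ (V n) (V n) (V n) (X u ⊗ₜ c) := by
  simp [op12]

theorem hom_ext_assoc {M : Type*} [AddCommGroup M] [Module ℂ M]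
    {f g : V n ⊗[ℂ] (V n ⊗[ℂ] V n) →ₗ[ℂ] M}
    (h : ∀ u c, f (TensorProduct.assoc ℂ (V n) (V n) (V n) (u ⊗ₜ c)) =
      g (TensorProduct.assoc ℂ (V n) (V n) (V n) (u ⊗ₜ c))) : f = g := by
  refine TensorProduct.ext_threefold' fun a b c => ?_
  simpa using h (a ⊗ₜ b) c

theorem fTensor₃_assoc (i : Fin n) (u : V n ⊗[ℂ] V n) (c : V n) :
    fTensor₃ q i (TensorProduct.assoc ℂ (V n) (V n) (V n) (u ⊗ₜ c)) =
      TensorProduct.assoc ℂ (V n) (V n) (V n) (fTensor q i (fV i) u ⊗ₜ c +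
        TensorProduct.map (kf q i) (kf q i) u ⊗ₜ fV i c) := by
  induction u with
  | zero => simp
  | add u v hu hv => simp only [TensorProduct.add_tmul, map_add, hu, hv]; abel
  | tmul a b =>
    simp only [fTensor₃, fTensor, LinearMap.add_apply, TensorProduct.map_tmul,
      TensorProduct.assoc_tmul, Module.End.one_apply, TensorProduct.add_tmul, map_add,
      TensorProduct.tmul_add]
    abel

/-- `X ⊗ 1` commutes with `f_i` as soon as `X` commutes with `f_i` and with `kf q i ⊗ kf q i`, since
the coproduct of `f_i` has the left factor `kf q i` in front of the last position. -/
theorem op12_fTensor₃ {X : Module.End ℂ (V n ⊗[ℂ] V n)} {i : Fin n}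
    (h1 : X * fTensor q i (fV i) = fTensor q i (fV i) * X)
    (h2 : X * TensorProduct.map (kf q i) (kf q i) = TensorProduct.map (kf q i) (kf q i) * X) :
    op12 X * fTensor₃ q i = fTensor₃ q i * op12 X :=
  hom_ext_assoc fun u c => by
    have e1 := LinearMap.congr_fun h1 u
    have e2 := LinearMap.congr_fun h2 u
    simp only [Module.End.mul_apply] at e1 e2 ⊢
    rw [fTensor₃_assoc, op12_assoc, fTensor₃_assoc, map_add, map_add, map_add, op12_assoc,
      op12_assoc, e1, e2]

theorem op23_fTensor₃ {X : Module.End ℂ (V n ⊗[ℂ] V n)} {i : Fin n}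
    (h1 : X * fTensor q i (fV i) = fTensor q i (fV i) * X) :
    op23 X * fTensor₃ q i = fTensor₃ q i * op23 X := by
  rw [op23, fTensor₃, fTensor.eq_1 q i (fTensor q i (fV i))]
  simp only [mul_add, add_mul, ← TensorProduct.map_mul, mul_one, one_mul, h1]

/-- Two crossings move the highest weight vector past `V ⊗ V`. -/
theorem op12_highest (hn : 1 ≤ n) (u : V n ⊗[ℂ] V n) :
    op23 (braidOp n q) (op12 (braidOp n q) (bv (-(n : ℤ)) ⊗ₜ u)) =
      TensorProduct.assoc ℂ (V n) (V n) (V n)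
        (TensorProduct.map (swapV n q) (swapV n q) u ⊗ₜ bv (-(n : ℤ))) := by
  induction u with
  | zero => simp
  | add u v hu hv => simp only [TensorProduct.tmul_add, TensorProduct.add_tmul, map_add, hu, hv]
  | tmul a b =>
    have := op12_assoc (braidOp n q) (bv (-(n : ℤ)) ⊗ₜ a) b
    rw [TensorProduct.assoc_tmul] at this
    rw [this, braidOp_highest hn, TensorProduct.assoc_tmul, op23, TensorProduct.map_tmul,
      braidOp_highest hn, TensorProduct.map_tmul, TensorProduct.assoc_tmul]; rfl

/-- The braid relation: both sides are linear with respect to the `f_i` and agree on `v ⊗ V ⊗ V`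
for the highest weight vector `v`, where they move `v` to the right. -/
theorem braidOp_braid (hn : 1 ≤ n) (h0 : q ≠ 0) :
    op12 (braidOp n q) * op23 (braidOp n q) * op12 (braidOp n q) =
      op23 (braidOp n q) * op12 (braidOp n q) * op23 (braidOp n q) := by
  rw [← sub_eq_zero]
  refine eq_zero_of_fTensor (q := q) (G := fun i => fTensor q i (fV i)) (fTensor₃ q)
    (fun i => ?_) fun u => ?_
  · have e1 := op12_fTensor₃ (braidOp_fTensor (n := n) h0 i) (braidOp_map_kf h0 i)
    have e2 := op23_fTensor₃ (braidOp_fTensor (n := n) h0 i)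
    set A := op12 (braidOp n q)
    set B := op23 (braidOp n q)
    change (A * B * A - B * A * B) * fTensor₃ q i = fTensor₃ q i * (A * B * A - B * A * B)
    rw [sub_mul, mul_sub, mul_assoc, e1, ← mul_assoc, mul_assoc A, e2, ← mul_assoc, e1,
      mul_assoc (B * A), e2, ← mul_assoc, mul_assoc B, e1, ← mul_assoc, e2]
    simp only [mul_assoc]
  · rw [LinearMap.sub_apply, sub_eq_zero, mul_assoc, Module.End.mul_apply, Module.End.mul_apply,
      op12_highest hn, op12_assoc, Module.End.mul_apply]
    have e : op23 (braidOp n q) (bv (-(n : ℤ)) ⊗ₜ u) = bv (-(n : ℤ)) ⊗ₜ braidOp n q u := rfl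
    rw [e, Module.End.mul_apply, op12_highest hn]
    have h := LinearMap.congr_fun (braidOp_map_mul (n := n) (braidOp_map_parityV (q := q))
      (braidOp_map_KV h0 (wt (-(n : ℤ))))) u
    exact congrArg (fun w => TensorProduct.assoc ℂ (V n) (V n) (V n) (w ⊗ₜ bv (-(n : ℤ)))) h

/-! ### The tangle relations -/

/-- The contraction of the last two factors of `V ⊗ (V ⊗ V)` by the invariant functional. -/
def cap23 (n : ℕ) (q : ℂ) : V n ⊗[ℂ] (V n ⊗[ℂ] V n) →ₗ[ℂ] V n :=
  (TensorProduct.rid ℂ (V n)).toLinearMap ∘ₗ TensorProduct.map LinearMap.id (capFun n q)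

theorem cap23_tmul (a : V n) (u : V n ⊗[ℂ] V n) : cap23 n q (a ⊗ₜ u) = capFun n q u • a := by
  simp [cap23]

/-- The partial trace of an operator on `V ⊗ V` that is given by the invariant vector and the
invariant functional. -/
def partialTrace (q : ℂ) (X : Module.End ℂ (V n ⊗[ℂ] V n)) : Module.End ℂ (V n) :=
  cap23 n q ∘ₗ op12 X ∘ₗ (TensorProduct.mk ℂ (V n) (V n ⊗[ℂ] V n)).flip (cupV n q)

theorem partialTrace_apply (X : Module.End ℂ (V n ⊗[ℂ] V n)) (a : V n) :
    partialTrace q X a = cap23 n q (op12 X (a ⊗ₜ cupV n q)) := rfl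

/-- Between two copies of `cupCap`, an operator acts through its partial trace. -/
theorem cupCap_op12_cupCap {X : Module.End ℂ (V n ⊗[ℂ] V n)} {c : ℂ}
    (h : partialTrace q X = c • 1) :
    op23 (cupCap n q) * op12 X * op23 (cupCap n q) = c • op23 (cupCap n q) := by
  have key : ∀ u, op23 (cupCap n q) u = cap23 n q u ⊗ₜ cupV n q := fun u => by
    induction u with
    | zero => simp
    | add u v hu hv => rw [map_add, map_add, hu, hv, TensorProduct.add_tmul]
    | tmul a u =>
      rw [cap23_tmul, op23, TensorProduct.map_tmul, cupCap_apply, TensorProduct.tmul_smul,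
        TensorProduct.smul_tmul']; rfl
  refine LinearMap.ext fun u => ?_
  rw [Module.End.mul_apply, Module.End.mul_apply, key, key u, ← partialTrace_apply, h,
    LinearMap.smul_apply, LinearMap.smul_apply, Module.End.one_apply, key u,
    TensorProduct.smul_tmul']

/-- By linearity with respect to the `f_i`, a partial trace is determined by its value on the
highest weight vector. -/
theorem partialTrace_eq (h0 : q ≠ 0) {X : Module.End ℂ (V n ⊗[ℂ] V n)} {c : ℂ}
    (h1 : ∀ i, X * fTensor q i (fV i) = fTensor q i (fV i) * X)
    (h2 : ∀ i, X * TensorProduct.map (kf q i) (kf q i) = TensorProduct.map (kf q i) (kf q i) * X)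
    (hc : partialTrace q X (bv (-(n : ℤ))) = c • bv (-(n : ℤ))) : partialTrace q X = c • 1 := by
  rw [← sub_eq_zero]
  refine eq_zero_of_fV fV (fun i => LinearMap.ext fun a => ?_) ?_
  · have e1 : (fV i a) ⊗ₜ[ℂ] cupV n q = fTensor₃ q i (a ⊗ₜ cupV n q) := by
      simp [fTensor₃, fTensor.eq_1 q i (fTensor q i (fV i)), fTensor_cupV h0]
    have e2 : ∀ u, cap23 n q (fTensor₃ q i u) = fV i (cap23 n q u) := fun u => by
      induction u with
      | zero => simp
      | add u v hu hv => simp only [map_add, hu, hv]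
      | tmul a u =>
        have := LinearMap.congr_fun (capFun_fTensor (n := n) h0 i) u
        simp only [LinearMap.comp_apply, LinearMap.zero_apply] at this
        simp [fTensor₃, fTensor.eq_1 q i (fTensor q i (fV i)), cap23_tmul, this]
    have e3 := LinearMap.congr_fun (op12_fTensor₃ (h1 i) (h2 i)) (a ⊗ₜ cupV n q)
    simp only [Module.End.mul_apply] at e3
    simp only [LinearMap.comp_apply, LinearMap.sub_apply, LinearMap.smul_apply,
      Module.End.one_apply, partialTrace_apply, map_sub, map_smul, e1, e3, e2]
  · rw [LinearMap.sub_apply, hc, LinearMap.smul_apply, Module.End.one_apply, sub_self]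

theorem partialTrace_highest (X : Module.End ℂ (V n ⊗[ℂ] V n)) :
    partialTrace q X (bv (-(n : ℤ))) = ∑ i ∈ Finset.Ico (-(n : ℤ)) (n + 1), cupC q (-i) •
      cap23 n q (TensorProduct.assoc ℂ (V n) (V n) (V n)
        (X (bv (-(n : ℤ)) ⊗ₜ bv (-i)) ⊗ₜ bv i)) := by
  rw [partialTrace_apply, cupV, cupPart, TensorProduct.tmul_sum, map_sum, map_sum]
  refine Finset.sum_congr rfl fun i _ => ?_
  rw [TensorProduct.tmul_smul, map_smul, map_smul, ← op12_assoc, TensorProduct.assoc_tmul]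

theorem cap23_bv {x y z : ℤ} (h3 : -(n : ℤ) ≤ y) (h4 : y ≤ n)
    (h5 : -(n : ℤ) ≤ z) (h6 : z ≤ n) : cap23 n q (TensorProduct.assoc ℂ (V n) (V n) (V n)
      (bv x ⊗ₜ bv y ⊗ₜ bv z)) = if z = -y then capC q y • bv x else 0 := by
  rw [TensorProduct.assoc_tmul, cap23_tmul, capFun_bv h3 h4 h5 h6]
  split_ifs <;> simp

theorem partialTrace_braidOp (hn : 1 ≤ n) (h0 : q ≠ 0) :
    partialTrace q (braidOp n q) = (q ^ (2 * n)) • 1 := by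
  refine partialTrace_eq h0 (fun i => braidOp_fTensor h0 i) (fun i => braidOp_map_kf h0 i) ?_
  rw [partialTrace_highest, Finset.sum_eq_single (n : ℤ)]
  · have h : -q ≠ 0 := neg_ne_zero.2 h0
    rw [braidOp_highest hn, swapV_bv hn, ← TensorProduct.smul_tmul', ← TensorProduct.smul_tmul',
      map_smul, map_smul, cap23_bv (by omega) (by omega) (by omega) (by omega),
      if_pos (by omega), smul_smul, smul_smul]
    congr 1
    rw [swapC, if_neg (by omega), if_pos rfl, capC, if_neg (by omega), if_pos (by omega), cupC,
      if_neg (by omega), if_pos (by omega), neg_neg, zpow_sub₀ h, zpow_natCast, zpow_one, two_mul,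
      pow_add]
    field_simp
    rw [neg_pow, mul_pow, ← pow_mul, mul_comm n 2, pow_mul]; simp
  · intro i hi hin
    rw [Finset.mem_Ico] at hi
    rw [braidOp_highest hn, swapV_bv hn, ← TensorProduct.smul_tmul', ← TensorProduct.smul_tmul',
      map_smul, map_smul, cap23_bv (by omega) (by omega) (by omega) (by omega),
      if_neg (by omega)]
    simp
  · intro h; exact absurd (Finset.mem_Ico.2 ⟨by omega, by omega⟩) h

theorem commute_braidInv (hn : 1 ≤ n) (h0 : q ≠ 0) {Y : Module.End ℂ (V n ⊗[ℂ] V n)}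
    (h : braidOp n q * Y = Y * braidOp n q) : braidInv n q * Y = Y * braidInv n q := by
  calc braidInv n q * Y = braidInv n q * Y * (braidOp n q * braidInv n q) := by
        rw [braidOp_mul_braidInv hn h0, mul_one]
    _ = braidInv n q * (braidOp n q * Y) * braidInv n q := by rw [h]; simp only [mul_assoc]
    _ = Y * braidInv n q := by rw [← mul_assoc, braidInv_mul_braidOp hn h0, one_mul]

theorem sub_inv_ne_zero (h0 : q ≠ 0) (h1 : q ^ 2 ≠ 1) : q - q⁻¹ ≠ 0 := fun h =>
  h1 (by field_simp at h; linear_combination h)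

theorem cupCap_eq (h0 : q ≠ 0) (h1 : q ^ 2 ≠ 1) :
    cupCap n q = 1 - (q - q⁻¹)⁻¹ • (braidInv n q - braidOp n q) := by
  rw [braidInv, add_sub_cancel_left, inv_smul_smul₀ (sub_inv_ne_zero h0 h1), sub_sub_cancel]

theorem commute_cupCap (hn : 1 ≤ n) (h0 : q ≠ 0) (h1 : q ^ 2 ≠ 1)
    {Y : Module.End ℂ (V n ⊗[ℂ] V n)} (h : braidOp n q * Y = Y * braidOp n q) :
    cupCap n q * Y = Y * cupCap n q := by
  rw [cupCap_eq h0 h1, sub_mul, mul_sub, smul_mul_assoc, mul_smul_comm, sub_mul, mul_sub, h,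
    commute_braidInv hn h0 h, one_mul, mul_one]

theorem partialTrace_cupCap (hn : 1 ≤ n) (h0 : q ≠ 0) (h1 : q ^ 2 ≠ 1) :
    partialTrace q (cupCap n q) = (1 : ℂ) • 1 := by
  have hk : ∀ i : Fin n, cupCap n q * TensorProduct.map (kf q i) (kf q i) =
      TensorProduct.map (kf q i) (kf q i) * cupCap n q := fun i =>
    commute_cupCap hn h0 h1 (braidOp_map_kf h0 i)
  refine partialTrace_eq h0 (fun i => by rw [cupCap_fTensor h0, fTensor_cupCap h0]) hk ?_
  rw [partialTrace_highest, Finset.sum_eq_single (-(n : ℤ))]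
  · rw [cupCap_apply, capFun_bv (by omega) (by omega) (by omega) (by omega), if_pos rfl,
      ← TensorProduct.smul_tmul', map_smul, map_smul, cupV, cupPart, TensorProduct.sum_tmul,
      map_sum, map_sum, Finset.sum_eq_single (n : ℤ)]
    · rw [← TensorProduct.smul_tmul', map_smul, map_smul, cap23_bv (by omega) (by omega)
        (by omega) (by omega), if_pos rfl, smul_smul, smul_smul, smul_smul]
      congr 1
      rw [cupC_neg h0, cupC_neg h0, inv_mul_cancel₀ (capC_ne_zero h0 _), one_mul,
        inv_mul_cancel₀ (capC_ne_zero h0 _)]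
    · intro i hi hin
      rw [Finset.mem_Ico] at hi
      rw [← TensorProduct.smul_tmul', map_smul, map_smul, cap23_bv (by omega) (by omega)
        (by omega) (by omega), if_neg (by omega), smul_zero]
    · intro h; exact absurd (Finset.mem_Ico.2 ⟨by omega, by omega⟩) h
  · intro i hi hin
    rw [Finset.mem_Ico] at hi
    rw [cupCap_apply, capFun_bv (by omega) (by omega) (by omega) (by omega), if_neg (by omega)]
    simp
  · intro h; exact absurd (Finset.mem_Ico.2 ⟨by omega, by omega⟩) h

theorem capFun_ne_zero (hn : 1 ≤ n) (h0 : q ≠ 0) : capFun n q ≠ 0 := fun h => by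
  have := LinearMap.congr_fun h (bv n ⊗ₜ bv (-(n : ℤ)))
  rw [capFun_bv (by omega) (by omega) (by omega) (by omega), if_pos rfl] at this
  exact capC_ne_zero h0 _ this

/-- The value of a circle, from the action of the skein relation on the invariant functional. -/
theorem capFun_cupV (hn : 1 ≤ n) (h0 : q ≠ 0) :
    (q - q⁻¹) * (1 - capFun n q (cupV n q)) = q ^ (2 * n) - (q ^ (2 * n))⁻¹ := by
  obtain ⟨u, hu⟩ : ∃ u, capFun n q u ≠ 0 := by
    by_contra! h
    exact capFun_ne_zero hn h0 (LinearMap.ext h)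
  have hq : q ^ (2 * n) ≠ 0 := pow_ne_zero _ h0
  have e1 : capFun n q (braidInv n q u) = q ^ (2 * n) * capFun n q u := by
    have e := LinearMap.congr_fun (capFun_braidOp (n := n) hn h0) (braidInv n q u)
    have e' := LinearMap.congr_fun (braidOp_mul_braidInv (n := n) hn h0) u
    simp only [Module.End.mul_apply, Module.End.one_apply] at e'
    simp only [LinearMap.comp_apply, LinearMap.smul_apply, smul_eq_mul, e'] at e
    rw [e, mul_inv_cancel_left₀ hq]
  have e2 := LinearMap.congr_fun (capFun_braidOp (n := n) hn h0) u
  simp only [LinearMap.comp_apply, LinearMap.smul_apply, smul_eq_mul] at e2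
  simp only [braidInv, LinearMap.add_apply, LinearMap.smul_apply, LinearMap.sub_apply,
    Module.End.one_apply, cupCap_apply, map_add, map_smul, map_sub, smul_eq_mul, e2] at e1
  refine mul_right_cancel₀ hu ?_
  linear_combination e1

/-- The partial trace of the inverse follows from the skein relation and the value of a circle. -/
theorem partialTrace_braidInv (hn : 1 ≤ n) (h0 : q ≠ 0) (h1 : q ^ 2 ≠ 1) :
    partialTrace q (braidInv n q) = (q ^ (2 * n))⁻¹ • 1 := by
  refine LinearMap.ext fun a => ?_
  have e1 := LinearMap.congr_fun (partialTrace_braidOp (n := n) hn h0) a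
  have e2 := LinearMap.congr_fun (partialTrace_cupCap (n := n) hn h0 h1) a
  have e3 : ∀ u, op12 (braidInv n q) u =
      op12 (braidOp n q) u + (q - q⁻¹) • (u - op12 (cupCap n q) u) := fun u => by
    obtain ⟨u, rfl⟩ := (TensorProduct.assoc ℂ (V n) (V n) (V n)).surjective u
    induction u with
    | zero => simp
    | add u v hu hv => simp only [map_add, hu, hv]; module
    | tmul u c =>
      simp only [op12_assoc, braidInv, LinearMap.add_apply, LinearMap.smul_apply,
        LinearMap.sub_apply, Module.End.one_apply, TensorProduct.add_tmul,
        TensorProduct.sub_tmul, ← TensorProduct.smul_tmul', map_add, map_smul, map_sub]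
  rw [partialTrace_apply] at e1 e2 ⊢
  rw [e3, map_add, e1, map_smul, map_sub, e2, cap23_tmul]
  simp only [LinearMap.smul_apply, Module.End.one_apply]
  have := capFun_cupV (n := n) hn h0
  match_scalars
  linear_combination -this

/-! ### Operators on tensor powers acting on neighbouring positions -/

section TensorRep

variable {M N T : Type*} [AddCommGroup M] [Module ℂ M] [Module.Free ℂ M] [Module.Finite ℂ M]
  [AddCommGroup N] [Module ℂ N] [Module.Free ℂ N] [Module.Finite ℂ N]
  [AddCommGroup T] [Module ℂ T]

/-- The linear map `End(M ⊗ N) → End(T)` with `A ⊗ B ↦ φ(A) ψ(B)`. -/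
def tensorRep (φ : Module.End ℂ M →ₗ[ℂ] Module.End ℂ T) (ψ : Module.End ℂ N →ₗ[ℂ] Module.End ℂ T) :
    Module.End ℂ (M ⊗[ℂ] N) →ₗ[ℂ] Module.End ℂ T :=
  TensorProduct.lift ((LinearMap.mul ℂ (Module.End ℂ T)).compl₁₂ φ ψ) ∘ₗ
    (homTensorHomEquiv ℂ M N M N).symm.toLinearMap

theorem tensorRep_map (φ : Module.End ℂ M →ₗ[ℂ] Module.End ℂ T)
    (ψ : Module.End ℂ N →ₗ[ℂ] Module.End ℂ T) (A : Module.End ℂ M) (B : Module.End ℂ N) :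
    tensorRep φ ψ (TensorProduct.map A B) = φ A * ψ B := by
  have : TensorProduct.map A B = homTensorHomEquiv ℂ M N M N (A ⊗ₜ[ℂ] B) := by
    rw [homTensorHomEquiv_apply, TensorProduct.homTensorHomMap_apply]
  rw [tensorRep, LinearMap.comp_apply, this, LinearEquiv.coe_coe, LinearEquiv.symm_apply_apply]
  rfl

theorem end_tensor_induction {P : Module.End ℂ (M ⊗[ℂ] N) → Prop} (h0 : P 0)
    (hmap : ∀ A B, P (TensorProduct.map A B)) (hadd : ∀ X Y, P X → P Y → P (X + Y))
    (X : Module.End ℂ (M ⊗[ℂ] N)) : P X := by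
  obtain ⟨x, rfl⟩ := (homTensorHomEquiv ℂ M N M N).surjective X
  induction x with
  | zero => simpa using h0
  | tmul A B =>
    rw [homTensorHomEquiv_apply, TensorProduct.homTensorHomMap_apply]
    exact hmap A B
  | add x y hx hy => rw [map_add]; exact hadd _ _ hx hy

theorem tensorRep_mul {φ : Module.End ℂ M →ₗ[ℂ] Module.End ℂ T}
    {ψ : Module.End ℂ N →ₗ[ℂ] Module.End ℂ T} (hφ : ∀ A B, φ (A * B) = φ A * φ B)
    (hψ : ∀ A B, ψ (A * B) = ψ A * ψ B) (h : ∀ A B, Commute (φ A) (ψ B))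
    (X Y : Module.End ℂ (M ⊗[ℂ] N)) :
    tensorRep φ ψ (X * Y) = tensorRep φ ψ X * tensorRep φ ψ Y := by
  induction X using end_tensor_induction with
  | h0 => simp
  | hadd X X' hX hX' => rw [add_mul, map_add, hX, hX', map_add, add_mul]
  | hmap A B =>
    induction Y using end_tensor_induction with
    | h0 => simp
    | hadd X X' hX hX' => rw [mul_add, map_add, hX, hX', map_add, mul_add]
    | hmap C D =>
      rw [← TensorProduct.map_mul]
      simp only [tensorRep_map, hφ, hψ, mul_assoc]
      rw [← mul_assoc (φ C), (h C B).eq, mul_assoc]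

theorem commute_tensorRep {φ : Module.End ℂ M →ₗ[ℂ] Module.End ℂ T}
    {ψ : Module.End ℂ N →ₗ[ℂ] Module.End ℂ T} {Z : Module.End ℂ T} (hφ : ∀ A, Commute Z (φ A))
    (hψ : ∀ A, Commute Z (ψ A)) (X : Module.End ℂ (M ⊗[ℂ] N)) :
    Commute Z (tensorRep φ ψ X) := by
  induction X using end_tensor_induction with
  | h0 => simp
  | hadd X X' hX hX' => rw [map_add]; exact hX.add_right hX'
  | hmap A B => rw [tensorRep_map]; exact (hφ A).mul_right (hψ B)

end TensorRep

variable {t : ℕ}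

theorem onSite_apply (j : Fin t) (A : Module.End ℂ (V n)) :
    onSite n j A = PiTensorProduct.map (Function.update 1 j A) := rfl

theorem onSite_mul (j : Fin t) (A B : Module.End ℂ (V n)) :
    onSite n j (A * B) = onSite n j A * onSite n j B := by
  simp only [onSite_apply, ← PiTensorProduct.map_mul]
  congr 1
  funext k
  by_cases h : k = j
  · subst h; simp
  · simp [h]

theorem onSite_one (j : Fin t) : onSite n j 1 = 1 := by
  rw [onSite_apply, ← PiTensorProduct.map_one]
  congr 1
  funext k
  by_cases h : k = j
  · subst h; simp
  · simp [h]

theorem commute_map_onSite {f : Fin t → Module.End ℂ (V n)} {j : Fin t} (hf : f j = 1)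
    (A : Module.End ℂ (V n)) :
    Commute (PiTensorProduct.map f : Module.End ℂ (TV n t)) (onSite n j A) := by
  rw [Commute, SemiconjBy, onSite_apply, ← PiTensorProduct.map_mul, ← PiTensorProduct.map_mul]
  congr 1
  funext k
  by_cases h : k = j
  · subst h; simp [hf]
  · simp [h]

theorem commute_onSite {j k : Fin t} (h : j ≠ k) (A B : Module.End ℂ (V n)) :
    Commute (onSite n j A) (onSite n k B) :=
  commute_map_onSite (by simp [h.symm]) B

theorem onSites_map (j k : Fin t) (A B : Module.End ℂ (V n)) :
    onSites n j k (TensorProduct.map A B) = onSite n j A * onSite n k B :=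
  tensorRep_map _ _ A B

theorem onSites_mul {j k : Fin t} (h : j ≠ k) (X Y : Module.End ℂ (V n ⊗[ℂ] V n)) :
    onSites n j k (X * Y) = onSites n j k X * onSites n j k Y :=
  tensorRep_mul (onSite_mul j) (onSite_mul k) (commute_onSite h) X Y

theorem onSites_one (j k : Fin t) : onSites n j k 1 = 1 := by
  rw [← TensorProduct.map_one, onSites_map, onSite_one, onSite_one, mul_one]

theorem commute_onSites {Z : Module.End ℂ (TV n t)} {j k : Fin t}
    (hj : ∀ A, Commute Z (onSite n j A)) (hk : ∀ A, Commute Z (onSite n k A))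
    (X : Module.End ℂ (V n ⊗[ℂ] V n)) : Commute Z (onSites n j k X) :=
  commute_tensorRep hj hk X

theorem commute_onSites_onSites {j k j' k' : Fin t} (h1 : j ≠ j') (h2 : j ≠ k') (h3 : k ≠ j')
    (h4 : k ≠ k') (X Y : Module.End ℂ (V n ⊗[ℂ] V n)) :
    Commute (onSites n j k X) (onSites n j' k' Y) :=
  commute_onSites (fun _ => (commute_onSites (fun _ => commute_onSite h1.symm _ _)
      (fun _ => commute_onSite h3.symm _ _) X).symm)
    (fun _ => (commute_onSites (fun _ => commute_onSite h2.symm _ _)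
      (fun _ => commute_onSite h4.symm _ _) X).symm) Y

/-- The linear map `End(V ⊗ (V ⊗ V)) → End(V^{⊗t})` given by the action in the positions
`j`, `k`, `l`. -/
def onThreeSites (n : ℕ) {t : ℕ} (j k l : Fin t) :
    Module.End ℂ (V n ⊗[ℂ] (V n ⊗[ℂ] V n)) →ₗ[ℂ] Module.End ℂ (TV n t) :=
  tensorRep (onSite n j) (onSites n k l)

theorem onThreeSites_mul {j k l : Fin t} (hjk : j ≠ k) (hjl : j ≠ l) (hkl : k ≠ l)
    (X Y : Module.End ℂ (V n ⊗[ℂ] (V n ⊗[ℂ] V n))) :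
    onThreeSites n j k l (X * Y) = onThreeSites n j k l X * onThreeSites n j k l Y :=
  tensorRep_mul (onSite_mul j) (onSites_mul hkl)
    (fun _ B => commute_onSites (fun _ => commute_onSite hjk _ _)
      (fun _ => commute_onSite hjl _ _) B) X Y

theorem onThreeSites_op23 (j k l : Fin t) (X : Module.End ℂ (V n ⊗[ℂ] V n)) :
    onThreeSites n j k l (op23 X) = onSites n k l X := by
  rw [op23, onThreeSites, tensorRep_map, onSite_one, one_mul]

theorem op12_add (X Y : Module.End ℂ (V n ⊗[ℂ] V n)) : op12 (X + Y) = op12 X + op12 Y :=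
  hom_ext_assoc fun u c => by
    simp only [op12_assoc, LinearMap.add_apply, TensorProduct.add_tmul, map_add]

theorem op12_map (A B : Module.End ℂ (V n)) :
    op12 (TensorProduct.map A B) = TensorProduct.map A (TensorProduct.map B 1) := by
  refine TensorProduct.ext_threefold' fun a b c => ?_
  simp [op12]

theorem onThreeSites_op12 (j k l : Fin t) (X : Module.End ℂ (V n ⊗[ℂ] V n)) :
    onThreeSites n j k l (op12 X) = onSites n j k X := by
  induction X using end_tensor_induction with
  | h0 =>
    have : op12 (0 : Module.End ℂ (V n ⊗[ℂ] V n)) = 0 :=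
      hom_ext_assoc fun u c => by simp [op12_assoc]
    rw [this, map_zero, map_zero]
  | hadd X Y hX hY => rw [op12_add, map_add, map_add, hX, hY]
  | hmap A B =>
    rw [op12_map, onThreeSites, tensorRep_map, onSites_map, onSites_map, onSite_one, mul_one]

/-- A pure tensor of operators is the product of its parts away from and at the positions `j`,
`k`. -/
theorem map_eq_mul_onSites {j k : Fin t} (h : j ≠ k) (f : Fin t → Module.End ℂ (V n)) :
    (PiTensorProduct.map f : Module.End ℂ (TV n t)) =
      PiTensorProduct.map (Function.update (Function.update f j 1) k 1) *
        onSites n j k (TensorProduct.map (f j) (f k)) := by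
  rw [onSites_map, onSite_apply, onSite_apply, ← PiTensorProduct.map_mul,
    ← PiTensorProduct.map_mul]
  congr 1
  funext m
  by_cases h1 : m = k
  · subst h1; simp [h.symm]
  · by_cases h2 : m = j
    · subst h2; simp [h]
    · simp [h1, h2]

theorem commute_onSites_map {j k : Fin t} (h : j ≠ k) {X : Module.End ℂ (V n ⊗[ℂ] V n)}
    {f : Fin t → Module.End ℂ (V n)} (hf : Commute X (TensorProduct.map (f j) (f k))) :
    Commute (onSites n j k X) (PiTensorProduct.map f : Module.End ℂ (TV n t)) := by
  rw [map_eq_mul_onSites h]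
  refine Commute.mul_right (Commute.symm ?_) ?_
  · exact commute_onSites (fun A => commute_map_onSite (by simp [h]) A)
      (fun A => commute_map_onSite (by simp) A) X
  · rw [Commute, SemiconjBy, ← onSites_mul h, ← onSites_mul h, hf.eq]

/-- An operator on `V ⊗ V` that commutes with `l ⊗ l`, with `r ⊗ r` and with the iterated coproduct
`x ⊗ r + l ⊗ x` commutes, when placed in neighbouring positions of `V^{⊗t}`, with
`∑_m l ⊗ … ⊗ x ⊗ … ⊗ r`. -/
theorem commute_onSites_sumOp {j k : Fin t} (h : (k : ℕ) = j + 1)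
    {X : Module.End ℂ (V n ⊗[ℂ] V n)} {l x r : Module.End ℂ (V n)}
    (hl : Commute X (TensorProduct.map l l)) (hr : Commute X (TensorProduct.map r r))
    (hx : Commute X (TensorProduct.map x r + TensorProduct.map l x)) :
    Commute (onSites n j k X) (sumOp t l x r) := by
  have hjk : j ≠ k := by rintro rfl; omega
  have hjk' : j < k := Fin.lt_def.2 (by omega)
  rw [sumOp, ← Finset.add_sum_erase _ _ (Finset.mem_univ j),
    ← Finset.add_sum_erase _ _ (Finset.mem_erase.2 ⟨hjk.symm, Finset.mem_univ k⟩), ← add_assoc]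
  refine Commute.add_right ?_ (Commute.sum_right _ _ _ fun m hm => ?_)
  · have e : siteOp l x r j + siteOp l x r k =
        PiTensorProduct.map (Function.update (Function.update
          (fun m => if m < j then l else r) j 1) k 1) *
        onSites n j k (TensorProduct.map x r + TensorProduct.map l x) := by
      rw [siteOp, siteOp, map_eq_mul_onSites hjk, map_eq_mul_onSites hjk fun m =>
        if m < k then l else if m = k then x else r, map_add, mul_add]
      congr 1
      · congr 1
        · congr 1
          funext m
          by_cases h1 : m = k
          · subst h1; simp
          · by_cases h2 : m = j
            · subst h2; simp [h1]
            · simp [h1, h2]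
        · simp [hjk.symm, not_lt.2 hjk'.le]
      · congr 1
        · congr 1
          funext m
          by_cases h1 : m = k
          · subst h1; simp
          · by_cases h2 : m = j
            · subst h2; simp [h1]
            · have h3 : m < k ↔ m < j := by
                rw [Fin.lt_def, Fin.lt_def]
                rw [Fin.ext_iff] at h2
                omega
              simp [h1, h2, h3]
        · simp [hjk']
    rw [e]
    refine Commute.mul_right (Commute.symm ?_) ?_
    · exact commute_onSites (fun A => commute_map_onSite (by simp [hjk]) A)
        (fun A => commute_map_onSite (by simp) A) X
    · rw [Commute, SemiconjBy, ← onSites_mul hjk, ← onSites_mul hjk, hx.eq]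
  · simp only [Finset.mem_erase, Finset.mem_univ, and_true] at hm
    refine commute_onSites_map hjk ?_
    rw [if_neg (Ne.symm hm.2), if_neg (Ne.symm hm.1)]
    rw [Fin.ext_iff.ne, Fin.ext_iff.ne] at hm
    by_cases h1 : j < m
    · rw [if_pos h1, if_pos]
      · exact hl
      · rw [Fin.lt_def] at *; omega
    · rw [if_neg h1, if_neg]
      · exact hr
      · rw [Fin.lt_def] at *; omega

/-! ### The centraliser algebra -/

theorem mem_EndU_of_commute {hq : Generic q} {X : Module.End ℂ (TV n t)}
    (he : ∀ i, Commute X (eT q t i)) (hf : ∀ i, Commute X (fT q t i))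
    (hK : ∀ β, Commute X (KT q t β)) (hP : Commute X (diagOp t (parityV n))) :
    X ∈ EndU n t hq := by
  rw [EndU, Subalgebra.mem_centralizer_iff]
  rintro g (⟨u, rfl⟩ | rfl)
  · refine Commute.eq (Commute.symm ?_)
    obtain ⟨u, rfl⟩ := RingQuot.mkAlgHom_surjective ℂ (URel n q) u
    rw [piTV, Uq.lift, RingQuot.liftAlgHom_mkAlgHom_apply]
    induction u using FreeAlgebra.induction with
    | grade0 c => rw [AlgHom.commutes]; exact (Algebra.commutes c X).symm
    | grade1 x =>
      rw [FreeAlgebra.lift_ι_apply]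
      cases x with
      | e i => exact he i
      | f i => exact hf i
      | K i => exact hK _
      | Kinv i => exact hK _
    | mul a b ha hb => rw [map_mul]; exact ha.mul_right hb
    | add a b ha hb => rw [map_add]; exact ha.add_right hb
  · exact hP.symm.eq

theorem onSites_braidOp_mem_EndU (hn : 1 ≤ n) (hq : Generic q) {j k : Fin t}
    (h : (k : ℕ) = j + 1) : onSites n j k (braidOp n q) ∈ EndU n t hq := by
  have h0 := hq.1
  have hjk : j ≠ k := by rintro rfl; omega
  refine mem_EndU_of_commute (fun i => ?_) (fun i => ?_) (fun β => ?_) ?_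
  · exact commute_onSites_sumOp h (braidOp_map_parity_pow i) (braidOp_map_KV h0 _)
      (braidOp_eTensor hn h0 (hq.2 2 two_pos) i)
  · refine commute_onSites_sumOp h (braidOp_map_kf h0 i) ?_ (braidOp_fTensor h0 i)
    rw [TensorProduct.map_one]
    exact Commute.one_right _
  · exact commute_onSites_map hjk (braidOp_map_KV h0 β)
  · exact commute_onSites_map hjk braidOp_map_parityV

theorem onSites_mul_inv (hn : 1 ≤ n) (h0 : q ≠ 0) {j k : Fin t} (h : j ≠ k) :
    onSites n j k (braidOp n q) * onSites n j k (braidInv n q) = 1 := by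
  rw [← onSites_mul h, braidOp_mul_braidInv hn h0, onSites_one]

theorem onSites_inv_mul (hn : 1 ≤ n) (h0 : q ≠ 0) {j k : Fin t} (h : j ≠ k) :
    onSites n j k (braidInv n q) * onSites n j k (braidOp n q) = 1 := by
  rw [← onSites_mul h, braidInv_mul_braidOp hn h0, onSites_one]

theorem cupCap_mul_braidOp (hn : 1 ≤ n) (h0 : q ≠ 0) :
    cupCap n q * braidOp n q = (q ^ (2 * n))⁻¹ • cupCap n q := by
  refine LinearMap.ext fun u => ?_
  have := LinearMap.congr_fun (capFun_braidOp hn h0) u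
  simp only [LinearMap.comp_apply, LinearMap.smul_apply] at this
  rw [Module.End.mul_apply, LinearMap.smul_apply, cupCap_apply, cupCap_apply, this, smul_eq_mul,
    mul_smul]

/-! ### The homomorphism from the Birman-Wenzl-Murakami algebra -/

-- The laws for signs are restated for `End(V^{⊗t})`, so that rewriting with them does not have to
-- find the ring structure through `TV n t`.

theorem tv_neg_mul (A B : Module.End ℂ (TV n t)) : -A * B = -(A * B) := neg_mul A B

theorem tv_mul_neg (A B : Module.End ℂ (TV n t)) : A * -B = -(A * B) := mul_neg A B

theorem tv_neg_mul_neg (A B : Module.End ℂ (TV n t)) : -A * -B = A * B := neg_mul_neg A B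

theorem tv_neg_smul (c : ℂ) (A : Module.End ℂ (TV n t)) : -c • A = -(c • A) := neg_smul c A

/-- The images of the generators `g_i^{±1}` in `End(V^{⊗t})`. -/
def bmwGen (n : ℕ) (q : ℂ) : BWGen t → Module.End ℂ (TV n t)
  | BWGen.g i => -onSites n (⟨i, by omega⟩ : Fin t) ⟨i + 1, by omega⟩ (braidOp n q)
  | BWGen.ginv i => -onSites n (⟨i, by omega⟩ : Fin t) ⟨i + 1, by omega⟩ (braidInv n q)

theorem lift_bmwGen_e (h0 : q ≠ 0) (h1 : q ^ 2 ≠ 1) (i : Fin (t - 1)) :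
    FreeAlgebra.lift ℂ (bmwGen n q) (FreeBW.e q i) =
      onSites n (⟨i, by omega⟩ : Fin t) ⟨i + 1, by omega⟩ (cupCap n q) := by
  simp only [FreeBW.e, FreeBW.g, FreeBW.ginv, map_sub, map_one, map_smul,
    FreeAlgebra.lift_ι_apply, bmwGen, cupCap_eq h0 h1, onSites_one]
  congr 2
  abel

/-- The operators `-Ř_i` satisfy the relations of the Birman-Wenzl-Murakami algebra. -/
theorem bmwGen_rel (hn : 1 ≤ n) (h0 : q ≠ 0) (h1 : q ^ 2 ≠ 1) {x y : FreeAlgebra ℂ (BWGen t)}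
    (h : BWRel t (-q ^ (2 * n)) q x y) :
    FreeAlgebra.lift ℂ (bmwGen n q) x = FreeAlgebra.lift ℂ (bmwGen n q) y := by
  have hg : ∀ i, FreeAlgebra.lift ℂ (bmwGen n q) (FreeBW.g (t := t) i) =
      -onSites n (⟨i, by omega⟩ : Fin t) ⟨i + 1, by omega⟩ (braidOp n q) := fun i =>
    FreeAlgebra.lift_ι_apply _ _
  have hg' : ∀ i, FreeAlgebra.lift ℂ (bmwGen n q) (FreeBW.ginv (t := t) i) =
      -onSites n (⟨i, by omega⟩ : Fin t) ⟨i + 1, by omega⟩ (braidInv n q) := fun i =>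
    FreeAlgebra.lift_ι_apply _ _
  have he := lift_bmwGen_e (n := n) (t := t) h0 h1
  have hne : ∀ {a b : ℕ} (ha : a < t) (hb : b < t), a ≠ b → (⟨a, ha⟩ : Fin t) ≠ ⟨b, hb⟩ := by
    intro a b ha hb hab h'
    exact hab (Fin.mk.inj h')
  -- the relations `e_i g_j^{±1} e_i = r^{±1} e_i` come from the partial traces
  have htl : ∀ (i j : Fin (t - 1)), (i : ℕ) = j + 1 →
      ∀ (X : Module.End ℂ (V n ⊗[ℂ] V n)) (c : ℂ), partialTrace q X = c • 1 →
      onSites n (⟨i, by omega⟩ : Fin t) ⟨i + 1, by omega⟩ (cupCap n q) *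
        onSites n (⟨j, by omega⟩ : Fin t) ⟨j + 1, by omega⟩ X *
        onSites n (⟨i, by omega⟩ : Fin t) ⟨i + 1, by omega⟩ (cupCap n q) =
      c • onSites n (⟨i, by omega⟩ : Fin t) ⟨i + 1, by omega⟩ (cupCap n q) := by
    rintro ⟨i, hi⟩ ⟨j, hj⟩ (rfl : i = j + 1) X c hX
    have hb := congrArg (onThreeSites n (⟨j, by omega⟩ : Fin t) ⟨j + 1, by omega⟩
      ⟨j + 1 + 1, by omega⟩) (cupCap_op12_cupCap hX)
    rw [onThreeSites_mul, onThreeSites_mul, map_smul, onThreeSites_op12, onThreeSites_op23] at hb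
    · exact hb
    all_goals exact hne _ _ (by omega)
  cases h with
  | g_mul_ginv i =>
    rw [map_mul, hg, hg', tv_neg_mul_neg, onSites_mul_inv hn h0 (hne _ _ (by omega)), map_one]
  | ginv_mul_g i =>
    rw [map_mul, hg, hg', tv_neg_mul_neg, onSites_inv_mul hn h0 (hne _ _ (by omega)), map_one]
  | far i j hij =>
    rw [map_mul, map_mul, hg, hg, tv_neg_mul_neg, tv_neg_mul_neg]
    refine (commute_onSites_onSites ?_ ?_ ?_ ?_ _ _).eq <;> exact hne _ _ (by omega)
  | braid i j hij =>
    obtain ⟨j, hj⟩ := j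
    obtain ⟨i, hi⟩ := i
    obtain rfl : j = i + 1 := hij
    simp only [map_mul, hg]
    have hb := congrArg (onThreeSites n (⟨i, by omega⟩ : Fin t) ⟨i + 1, by omega⟩
      ⟨i + 1 + 1, by omega⟩) (braidOp_braid (n := n) hn h0)
    rw [onThreeSites_mul, onThreeSites_mul, onThreeSites_mul, onThreeSites_mul,
      onThreeSites_op12, onThreeSites_op23] at hb
    · simp only [tv_neg_mul, tv_mul_neg, neg_neg, hb]
    all_goals exact hne _ _ (by omega)
  | e_mul_g i =>
    rw [map_mul, map_smul, hg, he, tv_mul_neg, ← onSites_mul (hne _ _ (by omega)),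
      cupCap_mul_braidOp hn h0, map_smul, inv_neg, tv_neg_smul]
  | e_g_e i j hij =>
    rw [map_mul, map_mul, map_smul, hg, he, tv_mul_neg, tv_neg_mul,
      htl i j hij _ _ (partialTrace_braidOp hn h0), tv_neg_smul]
  | e_ginv_e i j hij =>
    rw [map_mul, map_mul, map_smul, hg', he, tv_mul_neg, tv_neg_mul,
      htl i j hij _ _ (partialTrace_braidInv hn h0 h1), inv_neg, tv_neg_smul]

/-- All assertions about the operators `Ř_i`, given that `Ř` is the explicit braid operator. -/
theorem exists_unique_of_Rcheck_eq (hn : 1 ≤ n) (hq : Generic q) {l : List (Weight n)}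
    {E F : Weight n → Uq n q} (hR : Rcheck hq l E F = braidOp n q) (t : ℕ) :
    (∀ i : Fin (t - 1), IsUnit (Ri hq l E F i) ∧ Ri hq l E F i ∈ EndU n t hq) ∧
    Ct hq l E F t ≤ EndU n t hq ∧
    ∃! Υ : BW t (-q ^ (2 * n)) q →ₐ[ℂ] Ct hq l E F t,
      ∀ i : Fin (t - 1), (Υ (BW.g (-q ^ (2 * n)) q i) : Module.End ℂ (TV n t)) =
        -Ri hq l E F i := by
  have h0 := hq.1
  have h1 := hq.2 2 two_pos
  have hne : ∀ i : Fin (t - 1), (⟨i, by omega⟩ : Fin t) ≠ ⟨i + 1, by omega⟩ := by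
    intro i h'
    have := Fin.mk.inj h'
    omega
  have hRi : ∀ i : Fin (t - 1), Ri hq l E F i =
      onSites n (⟨i, by omega⟩ : Fin t) ⟨i + 1, by omega⟩ (braidOp n q) := fun i => by
    rw [Ri, hR]
  have hunit : ∀ i : Fin (t - 1), IsUnit (Ri hq l E F i) := fun i => by
    rw [hRi]
    exact ⟨⟨_, _, onSites_mul_inv hn h0 (hne i), onSites_inv_mul hn h0 (hne i)⟩, rfl⟩
  have hinv : ∀ i : Fin (t - 1), Ring.inverse (Ri hq l E F i) =
      onSites n (⟨i, by omega⟩ : Fin t) ⟨i + 1, by omega⟩ (braidInv n q) := fun i => by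
    refine left_inv_eq_right_inv (Ring.inverse_mul_cancel _ (hunit i)) ?_
    rw [hRi]
    exact onSites_mul_inv hn h0 (hne i)
  have hmem : ∀ i : Fin (t - 1), Ri hq l E F i ∈ EndU n t hq := fun i => by
    rw [hRi]
    exact onSites_braidOp_mem_EndU hn hq rfl
  refine ⟨fun i => ⟨hunit i, hmem i⟩, Algebra.adjoin_le ?_, ?_⟩
  · rintro _ (⟨i, rfl⟩ | ⟨i, rfl⟩)
    · exact hmem i
    · -- the inverse of an element of a centraliser lies in the centraliser
      rw [SetLike.mem_coe, EndU, Subalgebra.mem_centralizer_iff]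
      intro g hg
      have := Subalgebra.mem_centralizer_iff ℂ |>.1 (hmem i) g hg
      obtain ⟨u, hu⟩ := hunit i
      simp only [← hu, Ring.inverse_unit] at this ⊢
      exact (Commute.units_inv_right (show Commute g ↑u from this)).eq
  · let Φ : BW t (-q ^ (2 * n)) q →ₐ[ℂ] Module.End ℂ (TV n t) :=
      RingQuot.liftAlgHom ℂ ⟨FreeAlgebra.lift ℂ (bmwGen n q), fun _ _ h => bmwGen_rel hn h0 h1 h⟩
    have hΦ : ∀ x, Φ x ∈ Ct hq l E F t := by
      intro x
      obtain ⟨x, rfl⟩ := RingQuot.mkAlgHom_surjective ℂ (BWRel t (-q ^ (2 * n)) q) x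
      simp only [Φ]
      rw [RingQuot.liftAlgHom_mkAlgHom_apply]
      induction x using FreeAlgebra.induction with
      | grade0 c => rw [AlgHom.commutes]; exact Subalgebra.algebraMap_mem _ c
      | grade1 x =>
        rw [FreeAlgebra.lift_ι_apply]
        cases x with
        | g i =>
          rw [bmwGen, ← hRi]
          exact neg_mem (Algebra.subset_adjoin (Or.inl ⟨i, rfl⟩))
        | ginv i =>
          rw [bmwGen, ← hinv]
          exact neg_mem (Algebra.subset_adjoin (Or.inr ⟨i, rfl⟩))
      | mul a b ha hb => rw [map_mul]; exact mul_mem ha hb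
      | add a b ha hb => rw [map_add]; exact add_mem ha hb
    refine ⟨Φ.codRestrict _ hΦ, fun i => ?_, fun Ψ hΨ => ?_⟩
    · rw [AlgHom.coe_codRestrict, BW.g]
      simp only [Φ]
      rw [RingQuot.liftAlgHom_mkAlgHom_apply, FreeBW.g, FreeAlgebra.lift_ι_apply, bmwGen, hRi]
    · refine RingQuot.ringQuot_ext' ℂ _ _ (FreeAlgebra.hom_ext (funext fun x => ?_))
      have hgg : ∀ i, Ψ (BW.g _ q i) = Φ.codRestrict _ hΦ (BW.g _ q i) := fun i =>
        Subtype.ext <| by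
          rw [hΨ, AlgHom.coe_codRestrict, BW.g]
          simp only [Φ]
          rw [RingQuot.liftAlgHom_mkAlgHom_apply, FreeBW.g, FreeAlgebra.lift_ι_apply, bmwGen, hRi]
      -- the image of `g_i⁻¹` is determined by that of `g_i`
      cases x with
      | g i => exact hgg i
      | ginv i =>
        have r1 := RingQuot.mkAlgHom_rel ℂ (BWRel.ginv_mul_g (r := -q ^ (2 * n)) (q := q) i)
        have r2 := RingQuot.mkAlgHom_rel ℂ (BWRel.g_mul_ginv (r := -q ^ (2 * n)) (q := q) i)
        rw [map_mul, map_one] at r1 r2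
        refine left_inv_eq_right_inv (a := Ψ (BW.g _ q i)) ?_ ?_
        · have := congrArg Ψ r1
          rwa [map_mul, map_one] at this
        · rw [hgg]
          have := congrArg (Φ.codRestrict _ hΦ) r2
          rwa [map_mul, map_one] at this

/-! ### Reduced roots as differences of weights of `V` -/

/-- The reduced root attached to `x < y`: the difference `wt x - wt y` of the weights of `bv x` and
`bv y`, or one half of it if `y = -x`, when this difference is twice an odd root. -/
def rt {n : ℕ} (x y : ℤ) : Weight n := if y = -x then wt x else wt x - wt y

theorem rt_of_ne {x y : ℤ} (h : y ≠ -x) : (rt x y : Weight n) = wt x - wt y := if_neg h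

theorem rt_zero_right (x : ℤ) : (rt x 0 : Weight n) = wt x := by
  unfold rt; split_ifs <;> simp [wt_zero]

theorem rt_self_neg (x : ℤ) : (rt x (-x) : Weight n) = wt x := if_pos rfl

theorem rt_mirror (x y : ℤ) : (rt (-y) (-x) : Weight n) = rt x y := by
  unfold rt
  by_cases h : y = -x
  · subst h; simp
  · rw [if_neg h, if_neg (by omega), wt_neg, wt_neg]; abel

theorem exists_wt_eq_single {x : ℤ} (h1 : -(n : ℤ) ≤ x) (h2 : x < 0) :
    ∃ i : Fin n, (i : ℤ) = x + n ∧ (wt x : Weight n) = Pi.single i 1 := by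
  refine ⟨⟨(x + n).toNat, by omega⟩, by simp; omega, ?_⟩
  rw [← wt_single]
  congr 1
  simp
  omega

/-- Every pair `x < y` of distinct labels has a representative with `x + y < 0` that gives the same
root. -/
theorem exists_canonical {x y : ℤ} (h1 : -(n : ℤ) ≤ x) (h2 : x < y) (h3 : y ≤ n) :
    ∃ a b : ℤ, -(n : ℤ) ≤ a ∧ a < b ∧ a + b < 0 ∧ (rt x y : Weight n) = rt a b := by
  rcases lt_trichotomy (x + y) 0 with h | h | h
  · exact ⟨x, y, h1, h2, h, rfl⟩
  · refine ⟨x, 0, h1, by omega, by omega, ?_⟩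
    rw [show y = -x by omega, rt_self_neg, rt_zero_right]
  · exact ⟨-y, -x, by omega, by omega, by omega, (rt_mirror x y).symm⟩

theorem rt_mem_oddRoots {x : ℤ} (h1 : -(n : ℤ) ≤ x) (h2 : x < 0) :
    (wt x : Weight n) ∈ oddRoots n := by
  obtain ⟨i, -, hi⟩ := exists_wt_eq_single h1 h2
  exact ⟨i, hi⟩

theorem rt_mem {x y : ℤ} (h1 : -(n : ℤ) ≤ x) (h2 : x < y) (h3 : y ≤ n) :
    (rt x y : Weight n) ∈ reducedRoots n := by
  obtain ⟨a, b, ha, hab, hab', h⟩ := exists_canonical h1 h2 h3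
  rw [h, rt_of_ne (by omega)]
  obtain ⟨i, hi, hi'⟩ := exists_wt_eq_single ha (by omega : a < 0)
  rcases lt_trichotomy b 0 with hb | rfl | hb
  · obtain ⟨j, hj, hj'⟩ := exists_wt_eq_single (by omega : -(n : ℤ) ≤ b) hb
    exact Or.inr ⟨i, j, Fin.lt_def.2 (by omega), Or.inl (by rw [hi', hj'])⟩
  · exact Or.inl ⟨i, by rw [hi', wt_zero, sub_zero]⟩
  · obtain ⟨j, hj, hj'⟩ := exists_wt_eq_single (by omega : -(n : ℤ) ≤ -b) (by omega)
    refine Or.inr ⟨i, j, Fin.lt_def.2 (by omega), Or.inr ?_⟩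
    rw [hi', ← hj', wt_neg, sub_eq_add_neg]

theorem exists_rt_of_mem {γ : Weight n} (h : γ ∈ reducedRoots n) :
    ∃ x y : ℤ, -(n : ℤ) ≤ x ∧ x < y ∧ x + y < 0 ∧ γ = rt x y := by
  rcases h with ⟨i, rfl⟩ | ⟨i, j, hij, rfl | rfl⟩
  · exact ⟨i - n, 0, by omega, by omega, by omega, by rw [rt_zero_right, wt_single]⟩
  · refine ⟨i - n, j - n, by omega, by omega, by omega, ?_⟩
    rw [rt_of_ne (by omega), wt_single, wt_single]
  · refine ⟨i - n, -(j - n), by omega, by omega, by omega, ?_⟩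
    rw [rt_of_ne (by omega), wt_neg, wt_single, wt_single, sub_neg_eq_add]

theorem wt_injective {x y : ℤ} (hx : -(n : ℤ) ≤ x ∧ x ≤ n) (hy : -(n : ℤ) ≤ y ∧ y ≤ n)
    (h : (wt x : Weight n) = wt y) : x = y := by
  have e1 := congrArg (fun v => wt x ⬝ᵥ v) h
  have e2 := congrArg (fun v => wt y ⬝ᵥ v) h
  simp only [wt_dot hx, wt_dot hy] at e1 e2
  split_ifs at e1 e2 <;> omega

theorem wt_dot_rt_of_lt {x a b : ℤ} (h1 : -(n : ℤ) ≤ x) (h2 : x < a) (h3 : a < b) (h4 : a + b < 0) :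
    (wt x : Weight n) ⬝ᵥ rt a b = 0 := by
  have hx : -(n : ℤ) ≤ x ∧ x ≤ n := by omega
  rw [rt_of_ne (by omega), dotProduct_sub, wt_dot hx, wt_dot hx, if_neg (by omega),
    if_neg (by omega), if_neg (by omega), if_neg (by omega), if_neg (by omega), if_neg (by omega),
    sub_zero]

theorem wt_dot_rt_self {a b : ℤ} (h1 : -(n : ℤ) ≤ a) (h3 : a < b) (h4 : a + b < 0) :
    (wt a : Weight n) ⬝ᵥ rt a b = 1 := by
  have hx : -(n : ℤ) ≤ a ∧ a ≤ n := by omega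
  rw [rt_of_ne (by omega), dotProduct_sub, wt_dot hx, wt_dot hx, if_neg (by omega),
    if_pos rfl, if_neg (by omega), if_neg (by omega), if_neg (by omega), sub_zero]

theorem rt_injective {x y x' y' : ℤ} (h1 : -(n : ℤ) ≤ x) (h2 : x < y) (h3 : x + y < 0)
    (h1' : -(n : ℤ) ≤ x') (h2' : x' < y') (h3' : x' + y' < 0)
    (h : (rt x y : Weight n) = rt x' y') : x = x' ∧ y = y' := by
  have e1 := wt_dot_rt_self (n := n) h1 h2 h3
  have e2 := wt_dot_rt_self (n := n) h1' h2' h3'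
  have hx : x = x' := by
    rcases lt_trichotomy x x' with hx | hx | hx
    · rw [h, wt_dot_rt_of_lt h1 hx h2' h3'] at e1; omega
    · exact hx
    · rw [← h, wt_dot_rt_of_lt h1' hx h2 h3] at e2; omega
  subst hx
  rw [rt_of_ne (show y ≠ -x by omega), rt_of_ne (show y' ≠ -x by omega)] at h
  exact ⟨rfl, wt_injective (by omega) (by omega) (sub_right_injective h)⟩

theorem add_self_not_mem (α : Weight n) : α + α ∉ reducedRoots n := by
  intro h
  obtain ⟨x, y, h1, h2, h3, h⟩ := exists_rt_of_mem h
  have e := wt_dot_rt_self (n := n) h1 h2 h3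
  rw [← h, dotProduct_add] at e
  omega

/-- The decompositions of a reduced root into two reduced roots pass through an intermediate
label. -/
theorem exists_of_add_eq_rt {x y : ℤ} (h1 : -(n : ℤ) ≤ x) (h2 : x < y) (h3 : x + y < 0)
    {α β : Weight n} (hα : α ∈ reducedRoots n) (hβ : β ∈ reducedRoots n) (h : α + β = rt x y) :
    ∃ k, x < k ∧ k < y ∧ k ≠ -y ∧ (α = rt x k ∧ β = rt k y ∨ β = rt x k ∧ α = rt k y) := by
  obtain ⟨a, b, a1, a2, a3, rfl⟩ := exists_rt_of_mem hα
  obtain ⟨c, d, c1, c2, c3, rfl⟩ := exists_rt_of_mem hβ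
  have main : ∀ {b c d : ℤ}, x < b → x + b < 0 → -(n : ℤ) ≤ c → c < d → c + d < 0 → x < c →
      (rt x b : Weight n) + rt c d = rt x y →
      ∃ k, x < k ∧ k < y ∧ k ≠ -y ∧ (rt x b : Weight n) = rt x k ∧ (rt c d : Weight n) = rt k y := by
    intro b c d b1 b2 c1 c2 c3 hxc h
    have h' : (wt c : Weight n) + wt y = wt b + wt d := by
      rw [rt_of_ne (show b ≠ -x by omega), rt_of_ne (show d ≠ -c by omega),
        rt_of_ne (show y ≠ -x by omega), sub_add_sub_comm, sub_eq_iff_eq_add] at h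
      refine add_left_cancel (a := wt x) ?_
      rw [← add_assoc, h]
      abel
    have e1 := congrArg (fun v => (wt c : Weight n) ⬝ᵥ v) h'
    have hc : -(n : ℤ) ≤ c ∧ c ≤ n := by omega
    rw [dotProduct_add, dotProduct_add, wt_dot hc, wt_dot hc, wt_dot hc, wt_dot hc] at e1
    by_cases hyc : y = -c
    · subst hyc
      have hbd : (wt b : Weight n) = wt (-d) := by
        rw [wt_neg, add_neg_cancel] at h'
        rw [wt_neg]
        exact eq_neg_of_add_eq_zero_left h'.symm
      have := wt_injective (by omega) (by omega) hbd
      subst this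
      exact ⟨-d, by omega, by omega, by omega, rfl, by rw [rt_mirror]⟩
    · have hbc : b = c := by split_ifs at e1 <;> omega
      subst hbc
      have := wt_injective (by omega) (by omega) (add_left_cancel h')
      subst this
      exact ⟨b, by omega, by omega, by omega, rfl, rfl⟩
  have hd : ∀ z, (wt z : Weight n) ⬝ᵥ rt a b + wt z ⬝ᵥ rt c d = wt z ⬝ᵥ rt x y := fun z => by
    rw [← dotProduct_add, h]
  -- compare the first non-vanishing coordinates of the three roots
  have hac : a = x ∧ x < c ∨ c = x ∧ x < a := by
    have ex := wt_dot_rt_self (n := n) h1 h2 h3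
    have ea := wt_dot_rt_self (n := n) a1 a2 a3
    have ec := wt_dot_rt_self (n := n) c1 c2 c3
    have dx := hd x
    have da := hd a
    have dc := hd c
    have exa := fun h' => wt_dot_rt_of_lt (n := n) (x := x) h1 h' a2 a3
    have exc := fun h' => wt_dot_rt_of_lt (n := n) (x := x) h1 h' c2 c3
    have eax := fun h' => wt_dot_rt_of_lt (n := n) (x := a) a1 h' h2 h3
    have eac := fun h' => wt_dot_rt_of_lt (n := n) (x := a) a1 h' c2 c3
    have ecx := fun h' => wt_dot_rt_of_lt (n := n) (x := c) c1 h' h2 h3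
    have eca := fun h' => wt_dot_rt_of_lt (n := n) (x := c) c1 h' a2 a3
    rcases lt_trichotomy a c with hac | hac | hac
    · have := eac hac
      rcases lt_trichotomy a x with hax | hax | hax
      · have := eax hax; omega
      · omega
      · have := exa hax; have := exc (by omega); omega
    · subst hac
      rcases lt_trichotomy a x with hax | hax | hax
      · have := eax hax; omega
      · subst hax; omega
      · have := exa hax; have := exc hax; omega
    · have := eca hac
      rcases lt_trichotomy c x with hcx | hcx | hcx
      · have := ecx hcx; omega
      · omega
      · have := exc hcx; have := exa (by omega); omega
  rcases hac with ⟨rfl, hc⟩ | ⟨rfl, ha⟩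
  · obtain ⟨k, k1, k2, k3, k4, k5⟩ := main a2 a3 c1 c2 c3 hc h
    exact ⟨k, k1, k2, k3, Or.inl ⟨k4, k5⟩⟩
  · obtain ⟨k, k1, k2, k3, k4, k5⟩ := main c2 c3 a1 a2 a3 ha (by rw [add_comm]; exact h)
    exact ⟨k, k1, k2, k3, Or.inr ⟨k4, k5⟩⟩

/-! ### Normal orderings -/

/-- The position of the root attached to `x < y` in the list `l`. -/
def rho (l : List (Weight n)) (x y : ℤ) : ℕ := l.idxOf (rt x y)

variable {l : List (Weight n)}

theorem rho_mirror (x y : ℤ) : rho l (-y) (-x) = rho l x y := by rw [rho, rt_mirror, rho]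

theorem rho_self_neg (x : ℤ) : rho l x (-x) = rho l x 0 := by
  rw [rho, rho, rt_self_neg, rt_zero_right]

theorem rho_zero_left (x : ℤ) : rho l 0 x = rho l (-x) 0 := by
  rw [← rho_mirror, neg_zero]

/-- A sum of two roots lies between the two in a normal ordering. -/
theorem IsNormalOrdering.between (hl : IsNormalOrdering l) {α β γ : Weight n}
    (hα : α ∈ reducedRoots n) (hβ : β ∈ reducedRoots n) (hγ : γ ∈ reducedRoots n)
    (h : α + β = γ) :
    l.idxOf α < l.idxOf γ ∧ l.idxOf γ < l.idxOf β ∨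
      l.idxOf β < l.idxOf γ ∧ l.idxOf γ < l.idxOf α := by
  subst h
  rcases lt_trichotomy (l.idxOf α) (l.idxOf β) with h | h | h
  · exact Or.inl (hl.normal α hα β hβ h hγ)
  · have := (List.idxOf_inj ((hl.mem_iff α).2 hα)).1 h
    subst this
    exact absurd hγ (add_self_not_mem α)
  · have := hl.normal β hβ α hα h (by rwa [add_comm])
    rw [add_comm β α] at this
    exact Or.inr this

/-- The roots `c - μ`, `c`, `c + μ`, `μ` of a subsystem of type `B₂` appear in this order or in the
reverse one. -/
theorem IsNormalOrdering.between₂ (hl : IsNormalOrdering l) {a μ c d : Weight n}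
    (ha : a ∈ reducedRoots n) (hμ : μ ∈ reducedRoots n) (hc : c ∈ reducedRoots n)
    (hd : d ∈ reducedRoots n) (h1 : a + μ = c) (h2 : c + μ = d) :
    l.idxOf a < l.idxOf c ∧ l.idxOf c < l.idxOf d ∧ l.idxOf d < l.idxOf μ ∨
      l.idxOf μ < l.idxOf d ∧ l.idxOf d < l.idxOf c ∧ l.idxOf c < l.idxOf a := by
  have := hl.between ha hμ hc h1
  have := hl.between hc hμ hd h2
  omega

/-- Convexity of a normal ordering: `rt x y` lies between `rt x m` and `rt m y`, even in those cases
in which it is only proportional to their sum. -/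
theorem IsNormalOrdering.convex (hl : IsNormalOrdering l) {x m y : ℤ} (h1 : -(n : ℤ) ≤ x)
    (h2 : x < m) (h3 : m < y) (h4 : y ≤ n) (h5 : ¬ (m = 0 ∧ y = -x)) :
    rho l x m < rho l x y ∧ rho l x y < rho l m y ∨
      rho l m y < rho l x y ∧ rho l x y < rho l x m := by
  have a1 := rt_mem h1 h2 (by omega)
  have a2 := rt_mem (by omega) h3 h4
  have a3 := rt_mem h1 (h2.trans h3) h4
  unfold rho
  by_cases c1 : y = -x
  · subst c1
    rcases lt_or_gt_of_ne (show m ≠ 0 by omega) with hm | hm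
    · have := hl.between₂ a1 (rt_mem (n := n) (x := m) (y := 0) (by omega) hm (by omega)) a3 a2
        (by rw [rt_of_ne (show m ≠ -x by omega), rt_zero_right, rt_self_neg]; abel)
        (by rw [rt_of_ne (show -x ≠ -m by omega), rt_zero_right, rt_self_neg, wt_neg]; abel)
      omega
    · have := hl.between₂ a2 (rt_mem (n := n) (x := -m) (y := 0) (by omega) (by omega) (by omega))
        a3 a1
        (by rw [rt_of_ne (show -x ≠ -m by omega), rt_zero_right, rt_self_neg, wt_neg, wt_neg]; abel)
        (by rw [rt_of_ne (show m ≠ -x by omega), rt_zero_right, rt_self_neg, wt_neg]; abel)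
      omega
  by_cases c2 : m = -x
  · subst c2
    have := hl.between₂ (μ := rt x (-x)) (a := rt (-y) x) (c := rt (-y) 0) (d := rt x y)
      (rt_mem (by omega) (by omega) (by omega)) a1 (rt_mem (by omega) (by omega) (by omega)) a3
      (by rw [rt_of_ne (show x ≠ - -y by omega), rt_zero_right, rt_self_neg]; abel)
      (by rw [rt_of_ne (show y ≠ -x by omega), rt_zero_right, rt_self_neg, wt_neg]; abel)
    rw [← rt_mirror (-x) y, neg_neg]
    omega
  by_cases c3 : y = -m
  · subst c3
    have := hl.between₂ (μ := rt m (-m)) (a := rt x m) (c := rt x 0) (d := rt x (-m))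
      a1 a2 (rt_mem (by omega) (by omega) (by omega)) a3
      (by rw [rt_of_ne (show m ≠ -x by omega), rt_zero_right, rt_self_neg]; abel)
      (by rw [rt_of_ne (show -m ≠ -x by omega), rt_zero_right, rt_self_neg, wt_neg]; abel)
    omega
  · exact hl.between a1 a2 a3 (by
      rw [rt_of_ne (show m ≠ -x by omega), rt_of_ne (show y ≠ -m by omega),
        rt_of_ne (show y ≠ -x by omega)]; abel)

theorem IsNormalOrdering.rho_eq_iff (hl : IsNormalOrdering l) {x y i b : ℤ} (h1 : -(n : ℤ) ≤ x)
    (h2 : x < y) (h3 : x + y < 0) (h4 : -(n : ℤ) ≤ i) (h5 : i < b) (h6 : b ≤ n) :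
    rho l i b = rho l x y ↔ i = x ∧ b = y ∨ i = -y ∧ b = -x ∨ i = x ∧ b = -x ∧ y = 0 := by
  have key : ∀ {i b : ℤ}, -(n : ℤ) ≤ i → i < b → i + b < 0 → rho l i b = rho l x y →
      i = x ∧ b = y := fun {i b} h4 h5 h6 h => by
    exact rt_injective h4 h5 h6 h1 h2 h3
      ((List.idxOf_inj ((hl.mem_iff _).2 (rt_mem h4 h5 (by omega)))).1 h)
  constructor
  · intro h
    rcases lt_trichotomy (i + b) 0 with h7 | h7 | h7
    · exact Or.inl (key h4 h5 h7 h)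
    · obtain rfl : b = -i := by omega
      rw [rho_self_neg] at h
      have := key h4 (by omega) (by omega) h
      omega
    · rw [← rho_mirror] at h
      have := key (by omega) (by omega) (by omega) h
      omega
  · rintro (⟨rfl, rfl⟩ | ⟨rfl, rfl⟩ | ⟨rfl, rfl, rfl⟩)
    · rfl
    · exact rho_mirror _ _
    · exact rho_self_neg _

/-- The minimality of the pair of roots attached to `x < k < y`. -/
def MinSplit (l : List (Weight n)) (x k y : ℤ) : Prop :=
  ∀ m, x < m → m < y → m ≠ -y →
    ¬ ((rho l x k < rho l x m ∧ rho l x m < rho l k y ∧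
        rho l x k < rho l m y ∧ rho l m y < rho l k y) ∨
      (rho l k y < rho l x m ∧ rho l x m < rho l x k ∧
        rho l k y < rho l m y ∧ rho l m y < rho l x k))

/-- A minimal pair with sum `rt x y` comes from an intermediate label. The label `-y` does not occur:
the roots `rt x (-y)` and `rt (-y) y` do not add up to `rt x y`. -/
theorem exists_minSplit {x y : ℤ} (h1 : -(n : ℤ) ≤ x) (h2 : x < y)
    (h3 : x + y < 0) {α β : Weight n} (h : IsMinimalPair l (rt x y) α β) :
    ∃ k, x < k ∧ k < y ∧ k ≠ -y ∧ MinSplit l x k y ∧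
      ((α = rt x k ∧ β = rt k y ∧ rho l x k < rho l k y) ∨
        (β = rt x k ∧ α = rt k y ∧ rho l k y < rho l x k)) := by
  obtain ⟨k, k1, k2, k3, k4⟩ := exists_of_add_eq_rt h1 h2 h3 h.left_mem h.right_mem h.add_eq
  have hb := h.before
  have hm := h.minimal
  have hadd : ∀ m, x < m → m < y → m ≠ -y → (rt x m : Weight n) + rt m y = rt x y := by
    intro m m1 m2 m3
    rw [rt_of_ne (show m ≠ -x by omega), rt_of_ne (show y ≠ -m by omega),
      rt_of_ne (show y ≠ -x by omega)]; abel
  refine ⟨k, k1, k2, k3, fun m m1 m2 m3 hcon => ?_, ?_⟩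
  · have r1 : (rt x m : Weight n) ∈ reducedRoots n := rt_mem h1 m1 (by omega)
    have r2 : (rt m y : Weight n) ∈ reducedRoots n := rt_mem (by omega) m2 (by omega)
    rcases k4 with ⟨rfl, rfl⟩ | ⟨rfl, rfl⟩
    · refine hm ⟨_, r1, _, r2, hadd m m1 m2 m3, ?_⟩
      unfold Before at hb ⊢
      unfold rho at hcon
      omega
    · refine hm ⟨_, r1, _, r2, hadd m m1 m2 m3, ?_⟩
      unfold Before at hb ⊢
      unfold rho at hcon
      omega
  · rcases k4 with ⟨rfl, rfl⟩ | ⟨rfl, rfl⟩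
    · exact Or.inl ⟨rfl, rfl, hb⟩
    · exact Or.inr ⟨rfl, rfl, hb⟩

/-- For a minimal pair attached to `x < k < y`, the order of the two roots of the pair `x < m < y` is
that of the pair `x < m < k`. -/
theorem MinSplit.left_iff (hl : IsNormalOrdering l) {x m k y : ℤ} (h1 : -(n : ℤ) ≤ x)
    (h3 : x + y < 0) (hx : x < m) (hm : m < k) (hk : k < y) (hky : k ≠ -y)
    (h : MinSplit l x k y) : rho l x m < rho l m y ↔ rho l x m < rho l m k := by
  have e1 := hl.convex h1 hx hm (by omega) (by omega)
  have e2 := hl.convex h1 (hx.trans hm) hk (by omega) (by omega)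
  have e3 := hl.convex h1 hx (hm.trans hk) (by omega) (by omega)
  by_cases hmy : m = -y
  · -- the decomposition through `m` is replaced by the one through `0`
    have z1 : rho l m y = rho l 0 y := by
      rw [rho_zero_left, ← rho_self_neg, hmy, neg_neg]
    have z2 : rho l m 0 = rho l 0 y := by rw [hmy, rho_zero_left]
    have e4 := hl.convex h1 hx (show m < 0 by omega) (by omega) (by omega)
    have e5 := hl.convex h1 (show x < 0 by omega) (show 0 < y by omega) (by omega) (by omega)
    have e6 := h 0 (by omega) (by omega) (by omega)
    by_cases hk0 : k = 0
    · subst hk0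
      omega
    · have e7 := hl.convex (by omega) hm hk (by omega) (by omega)
      omega
  · have e4 := hl.convex (by omega) hm hk (by omega) (by omega)
    have e5 := h m hx (hm.trans hk) hmy
    omega

/-- For a minimal pair attached to `x < k < y`, the order of the two roots of the pair `x < m < y` is
that of the pair `k < m < y`. -/
theorem MinSplit.right_iff (hl : IsNormalOrdering l) {x m k y : ℤ} (h1 : -(n : ℤ) ≤ x)
    (h3 : x + y < 0) (hx : x < k) (hk : k < m) (hm : m < y) (h0 : m ≠ 0)
    (h : MinSplit l x k y) : rho l x m < rho l m y ↔ rho l k m < rho l m y := by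
  have e1 := hl.convex h1 hx hk (by omega) (by omega)
  have e2 := hl.convex h1 hx (hk.trans hm) (by omega) (by omega)
  have e3 := hl.convex h1 (hx.trans hk) hm (by omega) (by omega)
  have e4 := hl.convex (by omega) hk hm (by omega) (by omega)
  by_cases hmy : m = -y
  · have z1 : rho l m y = rho l 0 y := by
      rw [rho_zero_left, ← rho_self_neg, hmy, neg_neg]
    have z2 : rho l m 0 = rho l 0 y := by rw [hmy, rho_zero_left]
    have e5 := hl.convex h1 (hx.trans hk) (show m < 0 by omega) (by omega) (by omega)
    have e6 := hl.convex h1 (show x < 0 by omega) (show 0 < y by omega) (by omega) (by omega)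
    have e7 := h 0 (by omega) (by omega) (by omega)
    omega
  · have e5 := h m (hx.trans hk) hm hmy
    omega

/-- The exponent `∑ ± 1` over the labels `m ≠ 0` between `x` and `y`, with sign `+` if `rt x m`
precedes `rt m y`. -/
def ordExp (l : List (Weight n)) (x y : ℤ) : ℤ :=
  ∑ m ∈ Finset.Ioo x y, if m = 0 then 0 else if rho l x m < rho l m y then 1 else -1

/-- The mirror image of a label interval gives the opposite exponent: the roots `rt x m` and `rt m y`
are interchanged. -/
theorem ordExp_mirror (hl : IsNormalOrdering l) {x y : ℤ} (h1 : -(n : ℤ) ≤ x) (h2 : y ≤ n) :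
    ordExp l (-y) (-x) = -ordExp l x y := by
  rw [ordExp, ordExp, ← Finset.sum_neg_distrib]
  refine Finset.sum_nbij' (fun m => -m) (fun m => -m) ?_ ?_ ?_ ?_ fun m hm => ?_
  · intro m hm; simp only [Finset.mem_Ioo] at hm ⊢; omega
  · intro m hm; simp only [Finset.mem_Ioo] at hm ⊢; omega
  · simp
  · simp
  · simp only [Finset.mem_Ioo] at hm
    have e := hl.convex (m := -m) h1 (by omega) (by omega) h2
    have e1 : rho l (-y) m = rho l (-m) y := by rw [← rho_mirror (-m) y, neg_neg]
    have e2 : rho l m (-x) = rho l x (-m) := by rw [← rho_mirror x (-m), neg_neg]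
    rw [e1, e2]
    split_ifs <;> omega

theorem ordExp_succ (l : List (Weight n)) (x : ℤ) : ordExp l x (x + 1) = 0 := by
  rw [ordExp, Finset.sum_eq_zero]
  intro m hm
  simp only [Finset.mem_Ioo] at hm
  omega

/-- The exponent `ordExp` is additive along a minimal pair, up to the contribution of the middle
label. -/
theorem MinSplit.ordExp_eq (hl : IsNormalOrdering l) {x k y : ℤ} (h1 : -(n : ℤ) ≤ x)
    (h3 : x + y < 0) (hx : x < k) (hk : k < y) (hky : k ≠ -y) (h : MinSplit l x k y) :
    ordExp l x y = ordExp l x k + ordExp l k y +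
      if k = 0 then 0 else if rho l x k < rho l k y then 1 else -1 := by
  have e : Finset.Ioo x y = insert k (Finset.Ioo x k ∪ Finset.Ioo k y) := by
    ext m; simp only [Finset.mem_Ioo, Finset.mem_insert, Finset.mem_union]; omega
  have hd : Disjoint (Finset.Ioo x k) (Finset.Ioo k y) := by
    rw [Finset.disjoint_left]
    intro m hm hm'
    simp only [Finset.mem_Ioo] at hm hm'
    omega
  rw [ordExp, e, Finset.sum_insert (by simp), Finset.sum_union hd, add_comm]
  congr 2
  · refine Finset.sum_congr rfl fun m hm => ?_
    simp only [Finset.mem_Ioo] at hm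
    by_cases h0 : m = 0
    · rw [if_pos h0, if_pos h0]
    · simp only [h0, if_false, h.left_iff hl h1 h3 hm.1 hm.2 hk hky]
  · refine Finset.sum_congr rfl fun m hm => ?_
    simp only [Finset.mem_Ioo] at hm
    by_cases h0 : m = 0
    · rw [if_pos h0, if_pos h0]
    · simp only [h0, if_false, h.right_iff hl h1 h3 hx hm.1 hm.2 h0]

/-! ### Root vectors in the fundamental representation -/

/-- The sign by which the vector `bv x ⊗ bv (-x)` is normalised: `1` if `x = 0`, and `-(-1)^x`
otherwise. -/
def hs (x : ℤ) : ℂ := if x = 0 then 1 else (-1) ^ (x.natAbs + 1)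

/-- `-1` if `0` lies strictly between `x` and `y`, and `1` otherwise. -/
def cs (x y : ℤ) : ℂ := if x < 0 ∧ 0 < y then -1 else 1

/-- `-1` for the pairs that give an odd root, and `1` for the others. -/
def oddSign (x y : ℤ) : ℂ := if x = 0 ∨ y = 0 then -1 else 1

/-- The ratio of the two matrix coefficients, at `un x y` and at `un (-y) (-x)`, of the root vector
`E_γ` for `γ = rt x y`. -/
def rootRatio (q : ℂ) (l : List (Weight n)) (x y : ℤ) : ℂ :=
  -(cs x y * (hs x * hs y) * q ^ ordExp l x y)

theorem hs_neg (x : ℤ) : hs (-x) = hs x := by simp [hs]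

theorem hs_mul_self (x : ℤ) : hs x * hs x = 1 := by
  unfold hs
  split_ifs
  · simp
  · rw [← mul_pow]; simp

theorem cs_mirror (x y : ℤ) : cs (-y) (-x) = cs x y := by
  unfold cs
  split_ifs <;> first | rfl | omega

theorem cs_mul_self (x y : ℤ) : cs x y * cs x y = 1 := by
  unfold cs
  split_ifs <;> simp

theorem rootRatio_mirror {l : List (Weight n)} (h0 : q ≠ 0) (hl : IsNormalOrdering l) {x y : ℤ}
    (h1 : -(n : ℤ) ≤ x) (h2 : y ≤ n) : rootRatio q l x y * rootRatio q l (-y) (-x) = 1 := by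
  have : q ^ ordExp l x y * q ^ (-ordExp l x y) = 1 := by rw [← zpow_add₀ h0]; simp
  rw [rootRatio, rootRatio, ordExp_mirror hl h1 h2, hs_neg, hs_neg, cs_mirror]
  linear_combination (cs x y * cs x y * (hs x * hs x) * (hs y * hs y)) * this +
    (cs x y * cs x y * (hs x * hs x)) * hs_mul_self y + (cs x y * cs x y) * hs_mul_self x +
    cs_mul_self x y

/-- The images in `End V` of the root vectors `E_γ`, `F_γ` for `γ = rt x y`: they are combinations
of two matrix units, with non-zero coefficients of the prescribed ratio. -/
def RootForm (hq : Generic q) (l : List (Weight n)) (E F : Weight n → Uq n q) (x y : ℤ) : Prop :=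
  ∃ X Y X' Y' : ℂ, piV n hq (E (rt x y)) = X • un x y + Y • un (-y) (-x) ∧
    piV n hq (F (rt x y)) = X' • un y x + Y' • un (-x) (-y) ∧
    X * X' = oddSign x y * (Y * Y') ∧ X * X' ≠ 0 ∧ X = rootRatio q l x y * Y

/-- As `rt (-y) (-x) = rt x y`, the two matrix units may be interchanged. -/
theorem RootForm.mirror {hq : Generic q} {l : List (Weight n)} {E F : Weight n → Uq n q} {x y : ℤ}
    (hl : IsNormalOrdering l) (h1 : -(n : ℤ) ≤ x) (h2 : y ≤ n) (h : RootForm hq l E F x y) :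
    RootForm hq l E F (-y) (-x) := by
  obtain ⟨X, Y, X', Y', e1, e2, e3, e4, e5⟩ := h
  have hs : oddSign (-y) (-x) = oddSign x y := by
    unfold oddSign; simp only [neg_eq_zero, or_comm]
  have hss : oddSign x y * oddSign x y = 1 := by unfold oddSign; split_ifs <;> simp
  refine ⟨Y, X, Y', X', ?_, ?_, ?_, ?_, ?_⟩
  · rw [rt_mirror, e1, neg_neg, neg_neg, add_comm]
  · rw [rt_mirror, e2, neg_neg, neg_neg, add_comm]
  · rw [hs]; linear_combination (-(Y * Y')) * hss - oddSign x y * e3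
  · intro h
    rw [h, mul_zero] at e3
    exact e4 e3
  · have := rootRatio_mirror hq.1 hl h1 h2
    rw [e5]
    linear_combination (-Y) * this

theorem rootParity_rt {x y : ℤ} (h1 : -(n : ℤ) ≤ x) (h2 : x < y) (h3 : x + y < 0) :
    rootParity (rt x y : Weight n) = if y = 0 then 1 else 0 := by
  unfold rootParity
  by_cases hy : y = 0
  · subst hy
    rw [rt_zero_right, if_pos (rt_mem_oddRoots h1 h2), if_pos rfl]
  · rw [if_neg hy, if_neg]
    rintro ⟨k, hk⟩
    rw [← wt_single, ← rt_zero_right] at hk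
    exact hy (rt_injective h1 h2 h3 (by omega) (by omega) (by omega) hk).2

theorem rootParity_rt' {x y : ℤ} (h1 : -(n : ℤ) ≤ x) (h2 : x < y) (h3 : y ≤ n) (h4 : y ≠ -x) :
    rootParity (rt x y : Weight n) = if x = 0 ∨ y = 0 then 1 else 0 := by
  rcases lt_or_gt_of_ne (show x + y ≠ 0 by omega) with h | h
  · rw [rootParity_rt h1 h2 h]
    split_ifs <;> first | rfl | omega
  · rw [← rt_mirror, rootParity_rt (by omega) (by omega) (by omega)]
    split_ifs <;> first | rfl | omega

theorem rt_dot_rt {x k y : ℤ} (hx : -(n : ℤ) ≤ x ∧ x ≤ n) (hk : -(n : ℤ) ≤ k ∧ k ≤ n)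
    (h1 : x ≠ k) (h2 : x ≠ y) (h3 : k ≠ y) (h4 : k ≠ -x) (h5 : y ≠ -x) (h6 : y ≠ -k) :
    (rt x k : Weight n) ⬝ᵥ rt k y = if k = 0 then 0 else -1 := by
  rw [rt_of_ne h4, rt_of_ne h6, sub_dotProduct, dotProduct_sub, dotProduct_sub, wt_dot hx,
    wt_dot hx, wt_dot hk, wt_dot hk]
  split_ifs <;> omega

theorem un_pair_mul {x k y : ℤ} (hx : -(n : ℤ) ≤ x ∧ x ≤ n) (hk : -(n : ℤ) ≤ k ∧ k ≤ n)
    (hy : -(n : ℤ) ≤ y ∧ y ≤ n) (h1 : k ≠ -x) (h2 : k ≠ -y) (h3 : x ≠ y) (a b c d : ℂ) :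
    ((a • un x k + b • un (-k) (-x)) * (c • un k y + d • un (-y) (-k)) : Module.End ℂ (V n)) =
      (a * c) • un x y := by
  simp only [add_mul, mul_add, smul_mul_assoc, mul_smul_comm]
  rw [un_mul_un hk.1 hk.2 hy.1 hy.2, un_mul_un (by omega) (by omega) hy.1 hy.2,
    un_mul_un hk.1 hk.2 (by omega) (by omega), un_mul_un (by omega) (by omega) (by omega) (by omega),
    if_pos rfl, if_neg (by omega), if_neg (by omega), if_neg (by omega)]
  simp only [smul_zero, add_zero]
  rw [smul_smul, mul_comm]

theorem map_qBracket {A B : Type*} [Ring A] [Algebra ℂ A] [Ring B] [Algebra ℂ B] (φ : A →ₐ[ℂ] B)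
    (c : ℂ) (α β : Weight n) (X Y : A) :
    φ (qBracket c α β X Y) = qBracket c α β (φ X) (φ Y) := by
  simp only [qBracket, map_sub, map_mul, map_smul]

/-- The form of the root vectors is inherited by a root from its minimal pair. -/
theorem RootForm.step {hq : Generic q} {l : List (Weight n)} {E F : Weight n → Uq n q} {x k y : ℤ}
    (hl : IsNormalOrdering l) (h1 : -(n : ℤ) ≤ x) (h2 : x < k) (h3 : k < y) (h4 : x + y < 0)
    (h5 : k ≠ -y) (hm : MinSplit l x k y) (hxk : RootForm hq l E F x k)
    (hky : RootForm hq l E F k y)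
    (hEF : rho l x k < rho l k y ∧
        E (rt x y) = qBracket q (rt x k : Weight n) (rt k y) (E (rt x k)) (E (rt k y)) ∧
        F (rt x y) = qBracket q⁻¹ (rt k y : Weight n) (rt x k) (F (rt k y)) (F (rt x k)) ∨
      rho l k y < rho l x k ∧
        E (rt x y) = qBracket q (rt k y : Weight n) (rt x k) (E (rt k y)) (E (rt x k)) ∧
        F (rt x y) = qBracket q⁻¹ (rt x k : Weight n) (rt k y) (F (rt x k)) (F (rt k y))) :
    RootForm hq l E F x y := by
  obtain ⟨X1, Y1, X1', Y1', a1, a2, a3, a4, a5⟩ := hxk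
  obtain ⟨X2, Y2, X2', Y2', b1, b2, b3, b4, b5⟩ := hky
  have h0 := hq.1
  have hx : -(n : ℤ) ≤ x ∧ x ≤ n := by omega
  have hk : -(n : ℤ) ≤ k ∧ k ≤ n := by omega
  have hy : -(n : ℤ) ≤ y ∧ y ≤ n := by omega
  have hd : (rt x k : Weight n) ⬝ᵥ rt k y = if k = 0 then 0 else -1 :=
    rt_dot_rt hx hk (by omega) (by omega) (by omega) (by omega) (by omega) (by omega)
  have hp : rootParity (rt x k : Weight n) * rootParity (rt k y : Weight n) =
      if k = 0 then 1 else 0 := by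
    rw [rootParity_rt h1 h2 (by omega), rootParity_rt' hk.1 h3 hy.2 (by omega)]
    split_ifs <;> first | rfl | omega
  set κ : ℂ := if k = 0 then -1 else q⁻¹ with hκ
  set κ' : ℂ := if k = 0 then -1 else q with hκ'
  have hκκ : κ * κ' = 1 := by
    rw [hκ, hκ']; split_ifs
    · norm_num
    · exact inv_mul_cancel₀ h0
  have c1 : (-1 : ℂ) ^ (rootParity (rt x k : Weight n) * rootParity (rt k y : Weight n)) *
      q ^ ((rt x k : Weight n) ⬝ᵥ rt k y) = κ := by
    rw [hd, hp, hκ]; split_ifs <;> simp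
  have c2 : (-1 : ℂ) ^ (rootParity (rt x k : Weight n) * rootParity (rt k y : Weight n)) *
      q⁻¹ ^ ((rt x k : Weight n) ⬝ᵥ rt k y) = κ' := by
    rw [hd, hp, hκ']; split_ifs <;> simp
  have e1 := un_pair_mul hx hk hy (by omega) (by omega) (by omega) X1 Y1 X2 Y2
  have e2 : ((X2 • un k y + Y2 • un (-y) (-k)) * (X1 • un x k + Y1 • un (-k) (-x)) :
      Module.End ℂ (V n)) = (Y2 * Y1) • un (-y) (-x) := by
    have := un_pair_mul (n := n) (x := -y) (k := -k) (y := -x) (by omega) (by omega) (by omega)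
      (by omega) (by omega) (by omega) Y2 X2 Y1 X1
    simp only [neg_neg] at this
    rw [← this, add_comm, add_comm (Y1 • _)]
  have e3 := un_pair_mul (n := n) (x := y) (k := k) (y := x) hy hk hx (by omega) (by omega)
    (by omega) X2' Y2' X1' Y1'
  have e4 : ((X1' • un k x + Y1' • un (-x) (-k)) * (X2' • un y k + Y2' • un (-k) (-y)) :
      Module.End ℂ (V n)) = (Y1' * Y2') • un (-x) (-y) := by
    have := un_pair_mul (n := n) (x := -x) (k := -k) (y := -y) (by omega) (by omega) (by omega)
      (by omega) (by omega) (by omega) Y1' X1' Y2' X2'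
    simp only [neg_neg] at this
    rw [← this, add_comm, add_comm (Y2' • _)]
  have hsign : oddSign x k * oddSign k y = oddSign x y := by
    unfold oddSign
    split_ifs <;> first | omega | norm_num
  have hXX : X1 * X1' * (X2 * X2') = oddSign x y * (Y1 * Y1' * (Y2 * Y2')) := by
    rw [a3, b3, ← hsign]; ring
  have hne : X1 * X1' * (X2 * X2') ≠ 0 := mul_ne_zero a4 b4
  have hN := hm.ordExp_eq hl h1 h4 h2 h3 h5
  -- the closed form of the ratio is multiplicative up to the factor `-κ^{±1}`
  have hcs : cs x k * cs k y = (if k = 0 then -1 else 1) * cs x y := by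
    unfold cs
    split_ifs <;> first | omega | norm_num
  have hu : rootRatio q l x k * rootRatio q l k y =
      (if k = 0 then -1 else 1) * (cs x y * (hs x * hs y) *
        (q ^ ordExp l x k * q ^ ordExp l k y)) := by
    rw [rootRatio, rootRatio]
    linear_combination (hs x * hs y * hs k * hs k * (q ^ ordExp l x k * q ^ ordExp l k y)) * hcs +
      (hs x * hs y * (q ^ ordExp l x k * q ^ ordExp l k y)) *
        ((if k = 0 then -1 else 1) * cs x y) * hs_mul_self k
  rcases hEF with ⟨hlt, hE, hF⟩ | ⟨hlt, hE, hF⟩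
  · refine ⟨X1 * X2, -(κ * (Y2 * Y1)), X2' * X1', -(κ' * (Y1' * Y2')), ?_, ?_, ?_, ?_, ?_⟩
    · rw [hE, map_qBracket, a1, b1, qBracket, e1, e2, c1, smul_smul, neg_smul, sub_eq_add_neg]
    · rw [hF, map_qBracket, a2, b2, qBracket, e3, e4, dotProduct_comm, mul_comm (rootParity _), c2,
        smul_smul, neg_smul, sub_eq_add_neg]
    · linear_combination hXX - oddSign x y * (Y1 * Y1' * (Y2 * Y2')) * hκκ
    · intro h; exact hne (by linear_combination h)
    · have : rootRatio q l x y * -κ = rootRatio q l x k * rootRatio q l k y := by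
        rw [hu, rootRatio, hN, hκ, zpow_add₀ h0, zpow_add₀ h0]
        split_ifs
        · simp
        · rw [zpow_one]; field_simp
      rw [a5, b5]
      linear_combination (-(Y1 * Y2)) * this
  · refine ⟨-(κ * (X1 * X2)), Y2 * Y1, -(κ' * (X2' * X1')), Y1' * Y2', ?_, ?_, ?_, ?_, ?_⟩
    · rw [hE, map_qBracket, a1, b1, qBracket, e1, e2, dotProduct_comm, mul_comm (rootParity _), c1,
        smul_smul, neg_smul, sub_eq_neg_add]
    · rw [hF, map_qBracket, a2, b2, qBracket, e3, e4, c2, smul_smul, neg_smul, sub_eq_neg_add]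
    · linear_combination hXX + (X1 * X1' * (X2 * X2')) * hκκ
    · intro h; exact hne (by linear_combination h - (X1 * X1' * (X2 * X2')) * hκκ)
    · have : rootRatio q l x y = -κ * (rootRatio q l x k * rootRatio q l k y) := by
        rw [hu, rootRatio, hN, hκ, zpow_add₀ h0, zpow_add₀ h0, if_neg (not_lt.2 hlt.le)]
        split_ifs
        · simp
        · rw [zpow_neg_one]; ring
      rw [a5, b5]
      linear_combination (-(Y1 * Y2)) * this

theorem piV_e (hq : Generic q) (i : Fin n) : piV n hq (Uq.e q i) = eV i := by
  rw [piV, Uq.lift, Uq.e, Uq.mk, RingQuot.liftAlgHom_mkAlgHom_apply, FreeU.e,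
    FreeAlgebra.lift_ι_apply, genMap]

theorem piV_f (hq : Generic q) (i : Fin n) : piV n hq (Uq.f q i) = fV i := by
  rw [piV, Uq.lift, Uq.f, Uq.mk, RingQuot.liftAlgHom_mkAlgHom_apply, FreeU.f,
    FreeAlgebra.lift_ι_apply, genMap]

theorem RootForm.simple {hq : Generic q} {l : List (Weight n)} {E F : Weight n → Uq n q}
    (hEF : IsRootVectors l E F) {x : ℤ} (h1 : -(n : ℤ) ≤ x) (h2 : x < 0) :
    RootForm hq l E F x (x + 1) := by
  obtain ⟨i, rfl⟩ : ∃ i : Fin n, x = (i : ℤ) - n := ⟨⟨(x + n).toNat, by omega⟩, by simp; omega⟩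
  have hi := i.2
  have hr : (rt ((i : ℤ) - n) ((i : ℤ) - n + 1) : Weight n) = simpleRoot i := by
    rw [simpleRoot_eq, rt_of_ne (by omega)]
  refine ⟨1, if (i : ℤ) = n - 1 then -1 else 1, 1, 1, ?_, ?_, ?_, ?_, ?_⟩
  · rw [hr, (hEF.simple i).1, piV_e, eV_eq_un, one_smul]
  · rw [hr, (hEF.simple i).2, piV_f, fV_eq_un, one_smul, one_smul]
  · unfold oddSign
    split_ifs <;> first | omega | norm_num
  · norm_num
  · rw [rootRatio, ordExp_succ, zpow_zero, mul_one]
    by_cases hj : (i : ℤ) = n - 1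
    · rw [if_pos hj, hj]
      simp [cs, hs]
    · rw [if_neg hj, cs, if_neg (by omega), hs, hs, if_neg (by omega), if_neg (by omega),
        show ((i : ℤ) - n).natAbs = ((i : ℤ) - n + 1).natAbs + 1 by omega, pow_succ (-1 : ℂ)]
      have : ((-1 : ℂ) ^ (((i : ℤ) - n + 1).natAbs + 1)) *
          (-1) ^ (((i : ℤ) - n + 1).natAbs + 1) = 1 := by
        rw [← mul_pow]; simp
      linear_combination -this

/-- The matrices of all root vectors in the fundamental representation, by induction on `y - x`. -/
theorem rootForm {hq : Generic q} {l : List (Weight n)} {E F : Weight n → Uq n q}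
    (hl : IsNormalOrdering l) (hEF : IsRootVectors l E F) {x y : ℤ} (h1 : -(n : ℤ) ≤ x)
    (h2 : x < y) (h3 : y ≤ n) (h4 : y ≠ -x) : RootForm hq l E F x y := by
  suffices ∀ d : ℕ, ∀ x y : ℤ, -(n : ℤ) ≤ x → x < y → x + y < 0 → y - x ≤ d →
      RootForm hq l E F x y by
    rcases lt_or_gt_of_ne (show x + y ≠ 0 by omega) with h | h
    · exact this (y - x).toNat x y h1 h2 h (by omega)
    · have := (this (y - x).toNat (-y) (-x) (by omega) (by omega) (by omega) (by omega)).mirror hl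
        (by omega) (by omega)
      rwa [neg_neg, neg_neg] at this
  intro d
  induction d with
  | zero => intro x y _ _ _ _; omega
  | succ d ih =>
    intro x y h1 h2 h3 h4
    have ih' : ∀ a b : ℤ, -(n : ℤ) ≤ a → a < b → b ≤ n → a + b ≠ 0 → b - a ≤ d →
        RootForm hq l E F a b := by
      intro a b ha hab hb hne hd
      rcases lt_or_gt_of_ne hne with h | h
      · exact ih a b ha hab h hd
      · have := (ih (-b) (-a) (by omega) (by omega) (by omega) (by omega)).mirror hl
          (by omega) (by omega)
        rwa [neg_neg, neg_neg] at this
    by_cases hs : y = x + 1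
    · subst hs; exact RootForm.simple hEF h1 (by omega)
    · obtain ⟨α, β, hmin, hE, hF⟩ := hEF.nonsimple (rt x y) (rt_mem h1 h2 (by omega)) (by
        intro i hi
        rw [simpleRoot_eq, ← rt_of_ne (by omega)] at hi
        have := rt_injective h1 h2 h3 (by omega) (by omega) (by omega) hi
        omega)
      obtain ⟨k, k1, k2, k3, k4, k5⟩ := exists_minSplit h1 h2 h3 hmin
      refine RootForm.step hl h1 k1 k2 h3 k3 k4
        (ih' x k h1 k1 (by omega) (by omega) (by omega))
        (ih' k y (by omega) k2 (by omega) (by omega) (by omega)) ?_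
      rcases k5 with ⟨rfl, rfl, hlt⟩ | ⟨rfl, rfl, hlt⟩
      · exact Or.inl ⟨hlt, hE, hF⟩
      · exact Or.inr ⟨hlt, hE, hF⟩

/-! ### The action of `K_γ` and the scalars `a_γ` -/

theorem bv_ne_zero {x : ℤ} (h : -(n : ℤ) ≤ x ∧ x ≤ n) : (bv x : V n) ≠ 0 := by
  rw [bv_eq_vec h]
  have := (vBasis n).ne_zero ⟨lev n x, lev_mem h⟩
  rwa [vBasis_eq_vec] at this

/-- The operators `KV q β` as a homomorphism from the weight lattice to the units of `End V`. -/
def KVHom (n : ℕ) (h0 : q ≠ 0) : Multiplicative (Weight n) →* (Module.End ℂ (V n))ˣ where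
  toFun β := ⟨KV q β.toAdd, KV q (-β.toAdd), KV_mul_KV_neg h0 _, KV_neg_mul_KV h0 _⟩
  map_one' := Units.ext (KV_zero q)
  map_mul' _ _ := Units.ext (KV_mul_KV h0 _ _).symm

/-- The coefficients of a weight with respect to the simple roots are the partial sums of its
coordinates. -/
theorem sum_smul_simpleRoot (β : Weight n) :
    ∑ i : Fin n, (∑ a ∈ Finset.Iic i, β a) • (simpleRoot i : Weight n) = β := by
  funext a
  rw [Finset.sum_apply]
  simp only [Pi.smul_apply, simpleRoot_apply, smul_eq_mul, mul_sub, mul_ite, mul_one, mul_zero,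
    Finset.sum_sub_distrib, Finset.sum_ite_eq, Finset.mem_univ, if_true]
  by_cases ha : (a : ℕ) = 0
  · rw [Finset.sum_eq_zero fun i _ => if_neg (by omega), sub_zero]
    have : Finset.Iic a = {a} := by
      ext b; simp only [Finset.mem_Iic, Finset.mem_singleton, Fin.le_def, Fin.ext_iff]; omega
    rw [this, Finset.sum_singleton]
  · have hb := a.2
    let b : Fin n := ⟨a - 1, by omega⟩
    have h1 : (∑ i : Fin n, if (a : ℕ) = i + 1 then ∑ c ∈ Finset.Iic i, β c else 0) =
        ∑ c ∈ Finset.Iic b, β c := by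
      rw [Finset.sum_eq_single b]
      · rw [if_pos (by simp only [b]; omega)]
      · intro c _ hc
        rw [if_neg]
        simp only [ne_eq, Fin.ext_iff, b] at hc
        omega
      · intro h
        exact absurd (Finset.mem_univ b) h
    have h2 : Finset.Iic a = insert a (Finset.Iic b) := by
      ext c
      simp only [Finset.mem_Iic, Finset.mem_insert, Fin.le_def, Fin.ext_iff, b]
      omega
    rw [h1, h2, Finset.sum_insert, add_sub_cancel_right]
    simp only [Finset.mem_Iic, Fin.le_def, b]
    omega

theorem map_Kweight (hq : Generic q) (β : Weight n) :
    Units.map (piV n hq : Uq n q →* Module.End ℂ (V n)) (Uq.Kweight q β) =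
      KVHom n hq.1 (Multiplicative.ofAdd β) := by
  have hK : ∀ i, Units.map (piV n hq : Uq n q →* Module.End ℂ (V n)) (Uq.K q i) =
      KVHom n hq.1 (Multiplicative.ofAdd (simpleRoot i)) := fun i => by
    refine Units.ext ?_
    rw [Units.coe_map]
    change piV n hq (Uq.mk q (FreeU.K i)) = KV q (simpleRoot i)
    rw [piV, Uq.lift, Uq.mk, RingQuot.liftAlgHom_mkAlgHom_apply, FreeU.K,
      FreeAlgebra.lift_ι_apply, genMap]
  have hm : (Units.map (piV n hq : Uq n q →* Module.End ℂ (V n)) ∘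
      fun i : Fin n => Uq.K q i ^ (∑ a ∈ Finset.Iic i, β a)) = (KVHom n hq.1) ∘
      fun i => Multiplicative.ofAdd ((∑ a ∈ Finset.Iic i, β a) • simpleRoot i) := by
    funext i
    simp only [Function.comp_apply, map_zpow, hK, ofAdd_zsmul]
  rw [Uq.Kweight, map_list_prod, List.map_ofFn, hm, ← List.map_ofFn, ← map_list_prod,
    List.prod_ofFn, ← ofAdd_sum, sum_smul_simpleRoot]

theorem piV_Kweight (hq : Generic q) (β : Weight n) :
    piV n hq (↑(Uq.Kweight q β) - ↑(Uq.Kweight q β)⁻¹) = KV q β - KV q (-β) := by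
  have h := map_Kweight hq β
  have h1 : piV n hq ↑(Uq.Kweight q β) = KV q β := congrArg Units.val h
  have h2 : piV n hq ↑(Uq.Kweight q β)⁻¹ = KV q (-β) := by
    have := congrArg (fun u => Units.val u⁻¹) h
    rw [← map_inv] at this
    exact this
  rw [map_sub, h1, h2]

theorem un_pair_mul' {x y : ℤ} (hx : -(n : ℤ) ≤ x ∧ x ≤ n) (hy : -(n : ℤ) ≤ y ∧ y ≤ n)
    (h1 : y ≠ -x) (a b c d : ℂ) :
    ((a • un x y + b • un (-y) (-x)) * (c • un y x + d • un (-x) (-y)) : Module.End ℂ (V n)) =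
      (a * c) • un x x + (b * d) • un (-y) (-y) := by
  simp only [add_mul, mul_add, smul_mul_assoc, mul_smul_comm]
  rw [un_mul_un hy.1 hy.2 hx.1 hx.2, un_mul_un (by omega) (by omega) hx.1 hx.2,
    un_mul_un hy.1 hy.2 (by omega) (by omega), un_mul_un (by omega) (by omega) (by omega) (by omega),
    if_pos rfl, if_neg (by omega), if_neg (by omega), if_pos rfl]
  simp only [smul_zero, add_zero, zero_add]
  rw [smul_smul, smul_smul, mul_comm, mul_comm d]

theorem KV_sub_KV_neg {x y : ℤ} (h1 : -(n : ℤ) ≤ x) (h2 : x < y) (h3 : x + y < 0) :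
    KV q (rt x y : Weight n) - KV q (-rt x y) = (q - q⁻¹) • ((un x x - un (-x) (-x)) +
      if y = 0 then 0 else un (-y) (-y) - un y y) := by
  refine hom_ext_bv fun w _ _ => ?_
  have hx : -(n : ℤ) ≤ x ∧ x ≤ n := by omega
  have hy : -(n : ℤ) ≤ y ∧ y ≤ n := by omega
  rw [LinearMap.sub_apply, KV_bv, KV_bv, neg_dotProduct, rt_of_ne (show y ≠ -x by omega),
    sub_dotProduct, wt_dot hx, wt_dot hy, LinearMap.smul_apply, LinearMap.add_apply,
    LinearMap.sub_apply, un_bv hx.1 hx.2, un_bv (by omega) (by omega), if_neg (by omega : x ≠ 0)]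
  by_cases hy0 : y = 0
  · rw [if_pos hy0, if_pos hy0, LinearMap.zero_apply]
    split_ifs with h4 h5 h5
    · omega
    · subst h4; simp [sub_smul]
    · subst h5; simp [sub_smul]
    · simp
  · rw [if_neg hy0, if_neg hy0, LinearMap.sub_apply, un_bv (by omega) (by omega),
      un_bv (by omega) (by omega)]
    split_ifs <;> first | (exfalso; omega) | (subst_vars; simp [sub_smul])

/-- The scalar `a_γ` in terms of the matrices of `E_γ` and `F_γ`. It is determined by its defining
equation, since `K_γ - K_γ⁻¹` does not act as zero. -/
theorem rootScalar_eq {hq : Generic q} {E F : Weight n → Uq n q} {x y : ℤ} (h1 : -(n : ℤ) ≤ x)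
    (h2 : x < y) (h3 : x + y < 0) {X Y X' Y' : ℂ}
    (hE : piV n hq (E (rt x y)) = X • un x y + Y • un (-y) (-x))
    (hF : piV n hq (F (rt x y)) = X' • un y x + Y' • un (-x) (-y))
    (hA : X * X' = oddSign x y * (Y * Y')) : rootScalar hq E F (rt x y) = X * X' := by
  have h0 := hq.1
  have hz := sub_inv_ne_zero h0 (hq.2 2 two_pos)
  have hx : -(n : ℤ) ≤ x ∧ x ≤ n := by omega
  have hy : -(n : ℤ) ≤ y ∧ y ≤ n := by omega
  have key : piV n hq (E (rt x y) * F (rt x y) - (-1) ^ rootParity (rt x y : Weight n) *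
      (F (rt x y) * E (rt x y))) = ((X * X') / (q - q⁻¹)) •
        piV n hq (↑(Uq.Kweight q (rt x y : Weight n)) - ↑(Uq.Kweight q (rt x y : Weight n))⁻¹) := by
    have e2 := un_pair_mul' (n := n) hy hx (by omega) X' Y' X Y
    rw [piV_Kweight, KV_sub_KV_neg h1 h2 h3, smul_smul, div_mul_cancel₀ _ hz, map_sub, map_mul,
      neg_one_pow_mul, map_smul, map_mul, hE, hF, un_pair_mul' hx hy (by omega), e2,
      rootParity_rt h1 h2 h3]
    unfold oddSign at hA
    by_cases hy0 : y = 0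
    · subst hy0
      rw [if_pos (Or.inr rfl)] at hA
      simp only [if_true, neg_zero, add_zero]
      match_scalars
      · ring
      · linear_combination hA
      · linear_combination hA
    · rw [if_neg (by omega)] at hA
      simp only [hy0, if_false, pow_zero]
      match_scalars
      · ring
      · linear_combination -hA
      · ring
      · linear_combination hA
  have hspec := Classical.epsilon_spec (p := fun a : ℂ =>
    piV n hq (E (rt x y) * F (rt x y) - (-1) ^ rootParity (rt x y : Weight n) *
      (F (rt x y) * E (rt x y))) = (a / (q - q⁻¹)) •
        piV n hq (↑(Uq.Kweight q (rt x y : Weight n)) - ↑(Uq.Kweight q (rt x y : Weight n))⁻¹))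
    ⟨_, key⟩
  change _ = (rootScalar hq E F (rt x y) / (q - q⁻¹)) • _ at hspec
  rw [key, piV_Kweight, KV_sub_KV_neg h1 h2 h3, smul_smul, smul_smul, div_mul_cancel₀ _ hz,
    div_mul_cancel₀ _ hz] at hspec
  -- evaluate on the highest weight vector of the root string
  have hb := LinearMap.congr_fun hspec (bv x)
  have hb1 : ((un x x - un (-x) (-x)) + if y = 0 then 0 else un (-y) (-y) - un y y :
      Module.End ℂ (V n)) (bv x) = bv x := by
    rw [LinearMap.add_apply, LinearMap.sub_apply, un_bv hx.1 hx.2, un_bv (by omega) (by omega),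
      if_pos rfl, if_neg (by omega)]
    split_ifs
    · simp
    · rw [LinearMap.sub_apply, un_bv (by omega) (by omega), un_bv (by omega) (by omega),
        if_neg (by omega), if_neg (by omega)]
      simp
  rw [LinearMap.smul_apply, LinearMap.smul_apply, hb1] at hb
  exact (smul_left_injective ℂ (bv_ne_zero hx) hb).symm

/-! ### Partial products in the zero weight space -/

variable {l : List (Weight n)}

/-- The exponent `∑ ± 1` over the labels `m ≠ 0` between `i` and `b`, with sign `-` if `rt m b` is
one of the first `p` roots. -/
def partExp (l : List (Weight n)) (p : ℕ) (i b : ℤ) : ℤ :=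
  ∑ m ∈ Finset.Ioo i b, if m = 0 then 0 else if rho l m b < p then -1 else 1

/-- The entry in row `i` and column `b`, for `i < b` and `i + b ≤ 0`, of the product of the first
`p` factors of the `R`-matrix on the zero weight space. -/
def partEntry (q : ℂ) (l : List (Weight n)) (p : ℕ) (i b : ℤ) : ℂ :=
  if rho l i b < p then hs i * hs b * ((q - q⁻¹) *
    ((if b = -i then q else 0) - cs i b * q ^ partExp l p i b)) else 0

theorem partExp_congr {p p' : ℕ} {i b : ℤ}
    (h : ∀ m, i < m → m < b → m ≠ 0 → (rho l m b < p' ↔ rho l m b < p)) :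
    partExp l p' i b = partExp l p i b := by
  refine Finset.sum_congr rfl fun m hm => ?_
  rw [Finset.mem_Ioo] at hm
  by_cases h0 : m = 0
  · rw [if_pos h0, if_pos h0]
  · simp only [h0, if_false, h m hm.1 hm.2 h0]

theorem partEntry_succ_of_ne {p : ℕ} {i b : ℤ} (h : rho l i b ≠ p)
    (h' : ∀ m, i < m → m < b → m ≠ 0 → rho l m b ≠ p) :
    partEntry q l (p + 1) i b = partEntry q l p i b := by
  have h1 : rho l i b < p + 1 ↔ rho l i b < p := by omega
  have h2 : partExp l (p + 1) i b = partExp l p i b := partExp_congr fun m m1 m2 m3 => by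
    have := h' m m1 m2 m3
    omega
  simp only [partEntry, h1, h2]

theorem sum_Ioo_split {a i b : ℤ} (h1 : i < a) (h2 : a < b) (f : ℤ → ℤ) :
    ∑ m ∈ Finset.Ioo i b, f m = ∑ m ∈ Finset.Ioo i a, f m + f a + ∑ m ∈ Finset.Ioo a b, f m := by
  have e : Finset.Ioo i b = insert a (Finset.Ioo i a ∪ Finset.Ioo a b) := by
    ext m; simp only [Finset.mem_Ioo, Finset.mem_insert, Finset.mem_union]; omega
  have hd : Disjoint (Finset.Ioo i a) (Finset.Ioo a b) := by
    rw [Finset.disjoint_left]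
    intro m hm hm'
    simp only [Finset.mem_Ioo] at hm hm'
    omega
  rw [e, Finset.sum_insert (by simp), Finset.sum_union hd]
  ring

theorem ordExp_eq_partExp (hl : IsNormalOrdering l) {a b : ℤ} (h1 : -(n : ℤ) ≤ a) (h3 : b ≤ n)
    (h4 : b ≠ -a) : ordExp l a b = partExp l (rho l a b) a b := by
  refine Finset.sum_congr rfl fun m hm => ?_
  rw [Finset.mem_Ioo] at hm
  have := hl.convex h1 hm.1 hm.2 h3 (by omega)
  split_ifs <;> omega

/-- The exponent of `i < b` just before the root `rt a b` is reached. -/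
theorem partExp_split (hl : IsNormalOrdering l) {i a b : ℤ} (h1 : -(n : ℤ) ≤ i) (h2 : i < a)
    (h3 : a < b) (h4 : b ≤ n) (h5 : a ≠ 0) (h6 : b ≠ -a) :
    partExp l (rho l a b) i b = partExp l (rho l a b) i a + 1 + ordExp l a b := by
  rw [ordExp_eq_partExp hl (by omega) h4 h6, partExp, sum_Ioo_split h2 h3]
  congr 1
  congr 1
  · refine Finset.sum_congr rfl fun m hm => ?_
    rw [Finset.mem_Ioo] at hm
    have := hl.convex (by omega) hm.2 h3 h4 (by omega)
    split_ifs <;> omega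
  · rw [if_neg h5, if_neg (lt_irrefl _)]

theorem partExp_succ (hl : IsNormalOrdering l) {i a b : ℤ} (h1 : -(n : ℤ) ≤ i) (h2 : i < a)
    (h3 : a < b) (h4 : b ≤ n) (h5 : a ≠ 0)
    (h6 : ∀ m, a < m → m < b → m ≠ 0 → rho l m b ≠ rho l a b) :
    partExp l (rho l a b + 1) i b = partExp l (rho l a b) i b - 2 := by
  rw [partExp, partExp, sum_Ioo_split h2 h3, sum_Ioo_split h2 h3, if_neg h5, if_neg h5,
    if_pos (Nat.lt_succ_self _), if_neg (lt_irrefl _)]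
  have e1 : ∀ m ∈ Finset.Ioo i a, (if m = 0 then (0 : ℤ) else if rho l m b < rho l a b + 1 then -1
      else 1) = if m = 0 then 0 else if rho l m b < rho l a b then -1 else 1 := fun m hm => by
    rw [Finset.mem_Ioo] at hm
    have := hl.convex (by omega) hm.2 h3 h4 (by omega)
    split_ifs <;> omega
  have e2 : ∀ m ∈ Finset.Ioo a b, (if m = 0 then (0 : ℤ) else if rho l m b < rho l a b + 1 then -1
      else 1) = if m = 0 then 0 else if rho l m b < rho l a b then -1 else 1 := fun m hm => by
    rw [Finset.mem_Ioo] at hm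
    have := h6 m hm.1 hm.2
    split_ifs <;> omega
  rw [Finset.sum_congr rfl e1, Finset.sum_congr rfl e2]
  ring

/-- The recursion for the entries in which the two sides of the column operation are non-trivial. -/
theorem partEntry_succ (h0 : q ≠ 0) (hl : IsNormalOrdering l) {i a b : ℤ} (h1 : -(n : ℤ) ≤ i)
    (h2 : i < a) (h3 : a < b) (h4 : b ≤ n) (h5 : a ≠ 0) (h6 : b ≠ -a) (h7 : a ≠ -i) :
    partEntry q l (rho l a b + 1) i b = partEntry q l (rho l a b) i b +
      (q - q⁻¹) * rootRatio q l a b * partEntry q l (rho l a b) i a := by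
  have c1 := hl.convex h1 h2 h3 h4 (by omega)
  have hs := partExp_split hl h1 h2 h3 h4 h5 h6
  have hsucc := partExp_succ hl h1 h2 h3 h4 h5 (fun m m1 m2 m3 => by
    have := hl.convex (by omega) m1 m2 h4 (by omega)
    omega)
  have hcs : cs i b = cs a b * cs i a := by
    unfold cs
    split_ifs <;> first | omega | norm_num
  unfold partEntry
  rcases c1 with ⟨c1, c2⟩ | ⟨c1, c2⟩
  · rw [if_pos (show rho l i b < rho l a b + 1 by omega), if_pos (show rho l i b < rho l a b by omega),
      if_pos (show rho l i a < rho l a b by omega), hsucc, hs, rootRatio, hcs, if_neg h7,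
      zpow_sub₀ h0, zpow_add₀ h0, zpow_add₀ h0]
    have := hs_mul_self a
    set A := q ^ partExp l (rho l a b) i a
    set B := q ^ ordExp l a b
    -- the exponent `partExp` drops by two, which is compensated by the added multiple of a column
    have hz : (q - q⁻¹) * A * B = A * q * B - A * q * B / q ^ 2 := by
      field_simp
    rw [zpow_one, show (q : ℂ) ^ (2 : ℤ) = q ^ 2 from by norm_cast]
    linear_combination (OspBMW.hs i * OspBMW.hs b * (q - q⁻¹) * cs a b * cs i a) * (-hz) -
      (q - q⁻¹) ^ 2 * cs a b * cs i a * OspBMW.hs i * OspBMW.hs b * A * B * this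
  · rw [if_neg (show ¬ rho l i b < rho l a b + 1 by omega),
      if_neg (show ¬ rho l i b < rho l a b by omega), if_neg (show ¬ rho l i a < rho l a b by omega)]
    ring

theorem partEntry_self_succ (hl : IsNormalOrdering l) {a b : ℤ} (h1 : -(n : ℤ) ≤ a)
    (h4 : b ≤ n) (h6 : b ≠ -a) :
    partEntry q l (rho l a b + 1) a b = (q - q⁻¹) * rootRatio q l a b := by
  rw [partEntry, if_pos (Nat.lt_succ_self _), if_neg h6, rootRatio, ordExp_eq_partExp hl h1 h4 h6,
    partExp_congr (p := rho l a b) fun m m1 m2 m3 => ?_]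
  · ring
  · have := hl.convex h1 m1 m2 h4 (by omega)
    omega

/-- The contributions of `m` and `-m` cancel. -/
theorem partExp_self_neg (hl : IsNormalOrdering l) {x : ℤ} (h1 : -(n : ℤ) ≤ x) :
    partExp l (rho l x (-x)) x (-x) = 0 := by
  have : partExp l (rho l x (-x)) x (-x) = -partExp l (rho l x (-x)) x (-x) := by
    rw [partExp, ← Finset.sum_neg_distrib]
    refine Finset.sum_nbij' (fun m => -m) (fun m => -m) ?_ ?_ ?_ ?_ fun m hm => ?_
    · intro m hm; simp only [Finset.mem_Ioo] at hm ⊢; omega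
    · intro m hm; simp only [Finset.mem_Ioo] at hm ⊢; omega
    · simp
    · simp
    · simp only [Finset.mem_Ioo] at hm
      by_cases hm0 : m = 0
      · simp [hm0]
      · have c1 := hl.convex h1 hm.1 hm.2 (by omega) (by omega)
        have e : rho l (-m) (-x) = rho l x m := rho_mirror _ _
        rw [e, if_neg hm0, if_neg (show ¬ -m = 0 by omega)]
        split_ifs <;> omega
  omega

theorem rho_ne_self_neg (hl : IsNormalOrdering l) {x m : ℤ} (h1 : -(n : ℤ) ≤ x) (h2 : x < m)
    (h3 : m < -x) (h4 : m ≠ 0) : rho l m (-x) ≠ rho l x (-x) := by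
  have := hl.convex h1 h2 h3 (by omega) (by omega)
  omega

/-- The recursion for the last column of the string of an odd root. -/
theorem partEntry_succ_odd (h0 : q ≠ 0) (hl : IsNormalOrdering l) {i x : ℤ} (h1 : -(n : ℤ) ≤ i)
    (h2 : i < x) (h3 : x < 0) :
    partEntry q l (rho l x 0 + 1) i (-x) = partEntry q l (rho l x 0) i (-x) +
      (q - q⁻¹) * rootRatio q l 0 (-x) * partEntry q l (rho l x 0) i 0 +
      (q - q⁻¹) * (q + 1) * partEntry q l (rho l x 0) i x := by
  have hp : rho l x 0 = rho l x (-x) := (rho_self_neg x).symm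
  have hp' : rho l 0 (-x) = rho l x (-x) := by rw [rho_zero_left, neg_neg, hp]
  have c1 := hl.convex (y := -x) h1 (show i < 0 by omega) (by omega) (by omega) (by omega)
  have c2 := hl.convex (y := -x) h1 h2 (by omega) (by omega) (by omega)
  have hN : ordExp l 0 (-x) = -ordExp l x 0 := by
    have := ordExp_mirror hl (x := x) (y := 0) (by omega) (by omega)
    rwa [neg_zero] at this
  have e1 : partExp l (rho l x 0) i 0 = partExp l (rho l x 0) i x + 1 + ordExp l x 0 :=
    partExp_split hl h1 h2 h3 (by omega) (by omega) (by omega)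
  have e2 : partExp l (rho l x 0) i (-x) = partExp l (rho l x 0) i x + 1 := by
    rw [partExp, sum_Ioo_split h2 (show x < -x by omega), if_neg (by omega), hp,
      if_neg (lt_irrefl _)]
    have := partExp_self_neg hl (show -(n : ℤ) ≤ x by omega)
    unfold partExp at this ⊢
    rw [this, add_zero]
    congr 1
    refine Finset.sum_congr rfl fun m hm => ?_
    rw [Finset.mem_Ioo] at hm
    have := hl.convex (y := -x) (by omega) hm.2 (by omega) (by omega) (by omega)
    split_ifs <;> omega
  have e3 : partExp l (rho l x 0 + 1) i (-x) = partExp l (rho l x 0) i (-x) - 2 := by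
    rw [hp]
    exact partExp_succ hl h1 h2 (by omega) (by omega) (by omega) fun m m1 m2 m3 =>
      rho_ne_self_neg hl (by omega) m1 m2 m3
  unfold partEntry
  rw [hp', ← hp] at c1
  rw [← hp] at c2
  by_cases hlt : rho l i (-x) < rho l x 0
  · rw [if_pos (show rho l i (-x) < rho l x 0 + 1 by omega), if_pos hlt,
      if_pos (show rho l i 0 < rho l x 0 by omega), if_pos (show rho l i x < rho l x 0 by omega),
      e3, e2, e1, rootRatio, hN, hs_neg, if_neg (show ¬ -x = -i by omega),
      if_neg (show ¬ 0 = -i by omega), if_neg (show ¬ x = -i by omega)]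
    have g1 : cs i (-x) = -1 := if_pos (by omega)
    have g2 : cs i 0 = 1 := if_neg (by omega)
    have g3 : cs i x = 1 := if_neg (by omega)
    have g4 : cs 0 (-x) = 1 := if_neg (by omega)
    have g5 : hs 0 = 1 := if_pos rfl
    rw [g1, g2, g3, g4, g5, zpow_sub₀ h0, zpow_add₀ h0, zpow_add₀ h0, zpow_add₀ h0, zpow_neg,
      zpow_one, show (q : ℂ) ^ (2 : ℤ) = q ^ 2 from by norm_cast]
    have hB : q ^ ordExp l x 0 ≠ 0 := zpow_ne_zero _ h0
    set A := q ^ partExp l (rho l x 0) i x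
    set B := q ^ ordExp l x 0
    field_simp
    ring
  · rw [if_neg (show ¬ rho l i (-x) < rho l x 0 + 1 by omega), if_neg hlt,
      if_neg (show ¬ rho l i 0 < rho l x 0 by omega), if_neg (show ¬ rho l i x < rho l x 0 by omega)]
    ring

theorem partEntry_self_neg_succ (hl : IsNormalOrdering l) {x : ℤ} (h1 : -(n : ℤ) ≤ x)
    (h2 : x < 0) : partEntry q l (rho l x 0 + 1) x (-x) = (q - q⁻¹) * (q + 1) := by
  have hp : rho l x 0 = rho l x (-x) := (rho_self_neg x).symm
  have e : partExp l (rho l x (-x) + 1) x (-x) = 0 := by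
    rw [partExp_congr (p := rho l x (-x)) fun m m1 m2 m3 => ?_, partExp_self_neg hl h1]
    have := rho_ne_self_neg hl h1 m1 m2 m3
    omega
  have hcs : cs x (-x) = -1 := if_pos (by omega)
  rw [hp, partEntry, if_pos (Nat.lt_succ_self _), if_pos rfl, e, hs_neg, hs_mul_self, hcs]
  simp

/-- The column operations satisfied by the products of the first `p` factors of the `R`-matrix on
the zero weight space. -/
def ColumnRec (q : ℂ) (l : List (Weight n)) (M : ℕ → ℤ → ℤ → ℂ) : Prop :=
  ∀ x y : ℤ, -(n : ℤ) ≤ x → x < y → x + y < 0 → ∀ i b : ℤ, -(n : ℤ) ≤ i → i ≤ n → -(n : ℤ) ≤ b →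
    b ≤ n → M (rho l x y + 1) i b = M (rho l x y) i b +
      (if b = y then (q - q⁻¹) * rootRatio q l x y * M (rho l x y) i x else 0) +
      (if b = -x then (q - q⁻¹) * rootRatio q l (-y) (-x) * M (rho l x y) i (-y) else 0) +
      (if b = -x ∧ y = 0 then (q - q⁻¹) * (q + 1) * M (rho l x y) i x else 0)

/-- The root in position `p` comes from labels `x < y` with `x + y < 0`. -/
theorem exists_rho_eq (hl : IsNormalOrdering l) {p : ℕ} (hp : p < l.length) :
    ∃ x y : ℤ, -(n : ℤ) ≤ x ∧ x < y ∧ x + y < 0 ∧ l[p] = rt x y ∧ rho l x y = p := by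
  obtain ⟨x, y, h1, h2, h3, h4⟩ := exists_rt_of_mem ((hl.mem_iff _).1 (List.getElem_mem hp))
  refine ⟨x, y, h1, h2, h3, h4, ?_⟩
  rw [rho, ← h4, hl.nodup.idxOf_getElem]

/-- The column operations determine the entries on and above the diagonal up to the antidiagonal; in
that region each operation only involves entries of the same region. -/
theorem ColumnRec.eq_partEntry (h0 : q ≠ 0) (hl : IsNormalOrdering l) {M : ℕ → ℤ → ℤ → ℂ}
    (hM0 : ∀ i b : ℤ, -(n : ℤ) ≤ b → b ≤ n → M 0 i b = if i = b then 1 else 0)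
    (hM : ColumnRec q l M) {p : ℕ}
    (hp : p ≤ l.length) {i b : ℤ} (hi : -(n : ℤ) ≤ i) (hi' : i ≤ n) (hb : -(n : ℤ) ≤ b)
    (hb' : b ≤ n) : (b < i → M p i b = 0) ∧ (i = b → M p i b = 1) ∧
      (i < b → i + b ≤ 0 → M p i b = partEntry q l p i b) := by
  induction p generalizing i b with
  | zero =>
    refine ⟨fun h => ?_, fun h => ?_, fun h _ => ?_⟩
    · rw [hM0 i b hb hb', if_neg (by omega)]
    · rw [hM0 i b hb hb', if_pos h]
    · rw [hM0 i b hb hb', if_neg (by omega), partEntry, if_neg (by omega)]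
  | succ p ih =>
    obtain ⟨x, y, h1, h2, h3, -, rfl⟩ := exists_rho_eq hl (show p < l.length by omega)
    replace ih := fun {i b : ℤ} => @ih (by omega) i b
    have hx : -(n : ℤ) ≤ x ∧ x ≤ n := by omega
    have hy : -(n : ℤ) ≤ -y ∧ -y ≤ n := by omega
    rw [hM x y h1 h2 h3 i b hi hi' hb hb']
    have ih0 := ih hi hi' hb hb'
    have ihx := ih hi hi' hx.1 hx.2
    have ihy := ih hi hi' hy.1 hy.2
    refine ⟨fun h => ?_, fun h => ?_, fun h h' => ?_⟩
    · rw [ih0.1 h]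
      split_ifs with c1 c2 c3 c2 c3 c3
      all_goals first | omega | skip
      all_goals (try rw [ihx.1 (by omega)])
      all_goals (try rw [ihy.1 (by omega)])
      all_goals ring
    · rw [ih0.2.1 h]
      split_ifs with c1 c2 c3 c2 c3 c3
      all_goals first | omega | skip
      all_goals (try rw [ihx.1 (by omega)])
      all_goals (try rw [ihy.1 (by omega)])
      all_goals ring
    · rw [ih0.2.2 h h']
      by_cases c1 : b = y
      · subst c1
        rw [if_pos rfl, if_neg (by omega), if_neg (by omega), add_zero, add_zero]
        rcases lt_trichotomy i x with hix | hix | hix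
        · rw [ihx.2.2 hix (by omega), partEntry_succ h0 hl hi hix h2 hb' (by omega) (by omega)
            (by omega)]
        · subst hix
          rw [ihx.2.1 rfl, partEntry_self_succ hl hi hb' (by omega), mul_one, partEntry,
            if_neg (lt_irrefl _), zero_add]
        · rw [ihx.1 hix, mul_zero, add_zero, partEntry_succ_of_ne]
          · have := hl.convex h1 hix h hb' (by omega)
            omega
          · intro m m1 m2 m3
            have := hl.convex h1 (hix.trans m1) m2 hb' (by omega)
            omega
      by_cases c2 : b = -x
      · subst c2
        rw [if_neg c1, if_pos rfl, add_zero]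
        by_cases c3 : y = 0
        · subst c3
          rw [if_pos ⟨rfl, rfl⟩]
          rw [neg_zero] at ihy ⊢
          rw [ihy.2.2 (by omega) (by omega)]
          rcases lt_or_eq_of_le (show i ≤ x by omega) with hix | hix
          · rw [ihx.2.2 hix (by omega), partEntry_succ_odd h0 hl hi hix h2]
          · subst hix
            rw [ihx.2.1 rfl, partEntry_self_neg_succ hl hi h2, partEntry, partEntry,
              if_neg (lt_irrefl _), if_neg]
            · ring
            · rw [rho_self_neg]; exact lt_irrefl _
        · rw [if_neg (by omega), ihy.2.2 (by omega) (by omega), add_zero]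
          have := partEntry_succ (a := -y) (b := -x) h0 hl hi (by omega) (by omega) hb' (by omega)
            (by omega) (by omega)
          rw [rho_mirror] at this
          rw [this]
      · rw [if_neg c1, if_neg c2, if_neg (by omega), add_zero, add_zero, add_zero,
          partEntry_succ_of_ne]
        · rw [ne_eq, hl.rho_eq_iff h1 h2 h3 hi h hb']
          omega
        · intro m m1 m2 m3
          rw [ne_eq, hl.rho_eq_iff h1 h2 h3 (by omega) m2 hb']
          omega

/-! ### The factors of the `R`-matrix -/

variable {l : List (Weight n)}

theorem finsum_eq_of_pow_three {A : Type*} [Ring A] [Algebra ℂ A] {S : A} (h : S ^ 3 = 0)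
    (c : ℕ → ℂ) : ∑ᶠ k : ℕ, c k • S ^ k = c 0 • 1 + c 1 • S + c 2 • S ^ 2 := by
  rw [finsum_eq_sum_of_support_subset (s := Finset.range 3)]
  · simp [Finset.sum_range_succ]
  · intro k hk
    rw [Finset.coe_range, Set.mem_Iio]
    by_contra hk'
    obtain ⟨m, rfl⟩ := Nat.exists_eq_add_of_le (not_lt.1 hk')
    rw [Function.mem_support, pow_add, h, zero_mul, smul_zero] at hk
    exact hk rfl

/-- The action of `e_γ ⊗ f_γ` on `V ⊗ V` for `γ = rt x y`, in terms of matrix units. -/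
def rootTensor (q : ℂ) (l : List (Weight n)) (x y : ℤ) : Module.End ℂ (V n ⊗[ℂ] V n) :=
  TensorProduct.map (un x y) (un y x) + TensorProduct.map (un (-y) (-x)) (un (-x) (-y)) +
    (oddSign x y * rootRatio q l x y) • TensorProduct.map (un x y) (un (-x) (-y)) +
    (oddSign x y * rootRatio q l (-y) (-x)) • TensorProduct.map (un (-y) (-x)) (un y x)

/-- The square of `e_γ ⊗ f_γ` vanishes unless `γ` is odd. -/
theorem rootTensor_sq (h0 : q ≠ 0) (hl : IsNormalOrdering l) {x y : ℤ} (h1 : -(n : ℤ) ≤ x)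
    (h2 : x < y) (h3 : x + y < 0) : rootTensor q l x y ^ 2 =
      if y = 0 then TensorProduct.map (un x (-x)) (un (-x) x) else 0 := by
  have hu := rootRatio_mirror h0 hl h1 (show y ≤ n by omega)
  have hm : ∀ {a b c d : ℤ}, -(n : ℤ) ≤ b → b ≤ n → -(n : ℤ) ≤ d → d ≤ n → c ≠ b →
      (un a b * un c d : Module.End ℂ (V n)) = 0 := fun h1 h2 h3 h4 h => by
    rw [un_mul_un h1 h2 h3 h4, if_neg h]
  have hm' : ∀ {a b d : ℤ}, -(n : ℤ) ≤ b → b ≤ n → -(n : ℤ) ≤ d → d ≤ n →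
      (un a b * un b d : Module.End ℂ (V n)) = un a d := fun h1 h2 h3 h4 => by
    rw [un_mul_un h1 h2 h3 h4, if_pos rfl]
  have hσ : oddSign x y * oddSign x y = 1 := by unfold oddSign; split_ifs <;> simp
  rw [rootTensor, sq]
  simp only [add_mul, mul_add, smul_mul_assoc, mul_smul_comm, ← TensorProduct.map_mul]
  by_cases hy : y = 0
  · subst hy
    simp only [neg_zero] at hu ⊢
    simp (disch := omega) only [hm, hm', TensorProduct.map_zero_left, TensorProduct.map_zero_right,
      smul_zero, add_zero, zero_add, if_true]
    match_scalars
    linear_combination (rootRatio q l x 0 * rootRatio q l 0 (-x)) * hσ + hu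
  · simp (disch := omega) only [hm, TensorProduct.map_zero_right,
      smul_zero, add_zero, if_neg hy]

theorem rootTensor_cube (h0 : q ≠ 0) (hl : IsNormalOrdering l) {x y : ℤ} (h1 : -(n : ℤ) ≤ x)
    (h2 : x < y) (h3 : x + y < 0) : rootTensor q l x y ^ 3 = 0 := by
  rw [pow_succ, rootTensor_sq h0 hl h1 h2 h3]
  have hm : ∀ {a b c d : ℤ}, -(n : ℤ) ≤ b → b ≤ n → -(n : ℤ) ≤ d → d ≤ n → c ≠ b →
      (un a b * un c d : Module.End ℂ (V n)) = 0 := fun h1 h2 h3 h4 h => by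
    rw [un_mul_un h1 h2 h3 h4, if_neg h]
  split_ifs with hy
  · rw [rootTensor]
    simp (disch := omega) only [mul_add, mul_smul_comm, ← TensorProduct.map_mul, hm,
      TensorProduct.map_zero_left, smul_zero, add_zero]
  · rw [zero_mul]

theorem un_mul_parity {x y : ℤ} (h1 : -(n : ℤ) ≤ y) (h2 : y ≤ n) :
    (un x y * parityV n : Module.End ℂ (V n)) = sg y • un x y := by
  refine hom_ext_bv fun w _ _ => ?_
  rw [Module.End.mul_apply, parityV_bv, map_smul, LinearMap.smul_apply, un_bv h1 h2]
  split_ifs with h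
  · rw [h]
  · rw [smul_zero, smul_zero]

/-- The factor `R̃_γ` of the `R`-matrix on `V ⊗ V`, for `γ = rt x y`. -/
theorem RtildeFactor_eq {hq : Generic q} {E F : Weight n → Uq n q} (hl : IsNormalOrdering l)
    (hEF : IsRootVectors l E F) {x y : ℤ} (h1 : -(n : ℤ) ≤ x) (h2 : x < y) (h3 : x + y < 0) :
    RtildeFactor hq E F (rt x y) = 1 + (oddSign x y * (q - q⁻¹)) • rootTensor q l x y +
      if y = 0 then ((q - q⁻¹) * (q + 1)) • TensorProduct.map (un x (-x)) (un (-x) x) else 0 := by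
  have h0 := hq.1
  have hq2 : q ^ 2 ≠ 1 := hq.2 2 two_pos
  obtain ⟨X, Y, X', Y', e1, e2, e3, e4, e5⟩ := rootForm hl hEF h1 h2 (by omega) (by omega)
  have hu := rootRatio_mirror h0 hl h1 (show y ≤ n by omega)
  have hσ : oddSign x y * oddSign x y = 1 := by unfold oddSign; split_ifs <;> simp
  have hX : X ≠ 0 := left_ne_zero_of_mul e4
  have hX' : X' ≠ 0 := right_ne_zero_of_mul e4
  have hp : (-1 : ℂ) ^ rootParity (rt x y : Weight n) = oddSign x y := by
    rw [rootParity_rt h1 h2 h3]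
    unfold oddSign
    split_ifs <;> first | omega | norm_num
  have hA : (X • un x y + Y • un (-y) (-x) : Module.End ℂ (V n)) *
      parityV n ^ rootParity (rt x y : Weight n) =
      X • un x y + (oddSign x y * Y) • un (-y) (-x) := by
    rw [rootParity_rt h1 h2 h3]
    unfold oddSign
    split_ifs with c1 c2 c2
    · rw [pow_one, add_mul, smul_mul_assoc, smul_mul_assoc, un_mul_parity (by omega) (by omega),
        un_mul_parity (by omega) (by omega), sg, sg, if_pos c1, if_neg (by omega), one_smul,
        smul_smul, mul_comm]
    · omega
    · omega
    · rw [pow_zero, mul_one, one_mul]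
  -- the coefficients of `e_γ ⊗ f_γ` only depend on the ratio `X / Y`
  have hY : Y = rootRatio q l (-y) (-x) * X := by rw [e5]; linear_combination (-Y) * hu
  have hY' : Y' = oddSign x y * rootRatio q l x y * X' := by
    have : X * Y' = X * (oddSign x y * rootRatio q l x y * X') := by
      linear_combination Y' * e5 - oddSign x y * rootRatio q l x y * e3 -
        rootRatio q l x y * Y * Y' * hσ
    exact mul_left_cancel₀ hX this
  have hS : superTensor (rootParity (rt x y : Weight n)) (piV n hq (E (rt x y)))
      (piV n hq ((rootScalar hq E F (rt x y))⁻¹ • F (rt x y))) = rootTensor q l x y := by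
    rw [rootScalar_eq h1 h2 h3 e1 e2 e3, superTensor, map_smul, e1, e2, hA, hY, hY', rootTensor]
    simp only [smul_add, smul_smul, TensorProduct.map_add_left, TensorProduct.map_add_right,
      TensorProduct.map_smul_left, TensorProduct.map_smul_right]
    match_scalars
    · field_simp
    · field_simp
    · field_simp
    · field_simp
      linear_combination (rootRatio q l x y * rootRatio q l (-y) (-x)) * hσ + hu
  have hγ : (rt x y : Weight n) ⬝ᵥ rt x y = if y = 0 then 1 else 2 := by
    have hx : -(n : ℤ) ≤ x ∧ x ≤ n := by omega
    have hy : -(n : ℤ) ≤ y ∧ y ≤ n := by omega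
    rw [rt_of_ne (by omega), sub_dotProduct, dotProduct_sub, dotProduct_sub, wt_dot hx, wt_dot hx,
      wt_dot hy, wt_dot hy]
    split_ifs <;> omega
  have hone : (1 : ℂ) - oddSign x y * q ^ (-((rt x y : Weight n) ⬝ᵥ rt x y)) ≠ 0 := by
    rw [hγ]
    unfold oddSign
    split_ifs with c1 c2 c2
    · intro h
      rw [zpow_neg_one] at h
      field_simp at h
      exact hq2 (by linear_combination (q - 1) * h)
    · omega
    · omega
    · intro h
      rw [zpow_neg, show (q : ℂ) ^ (2 : ℤ) = q ^ 2 from by norm_cast] at h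
      field_simp at h
      exact hq2 (by linear_combination h)
  have hn1 : qNumber (oddSign x y * q ^ (-((rt x y : Weight n) ⬝ᵥ rt x y))) 1 = 1 := by
    rw [qNumber, pow_one, div_self hone]
  rw [RtildeFactor, hS, finsum_eq_of_pow_three (rootTensor_cube h0 hl h1 h2 h3),
    rootTensor_sq h0 hl h1 h2 h3, hp]
  simp only [qFactorial, Finset.prod_range_succ, Finset.prod_range_zero, zero_add, one_mul, hn1,
    pow_zero, pow_one, div_one, one_smul, one_add_one_eq_two]
  congr 1
  by_cases hy : y = 0
  · rw [if_pos hy, if_pos hy]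
    congr 1
    rw [hγ, if_pos hy, zpow_neg_one] at hone ⊢
    have hodd : oddSign x y = -1 := if_pos (Or.inr hy)
    rw [hodd] at hone ⊢
    rw [qNumber, div_div_eq_mul_div, div_eq_iff]
    · field_simp
      ring
    · intro h
      have : (1 - (-1 * q⁻¹)) * (1 - q⁻¹) = 0 := by rw [← h]; ring
      have h5 := (mul_eq_zero.1 this).resolve_left hone
      field_simp at h5
      exact hq2 (by linear_combination (q + 1) * h5)
  · rw [if_neg hy, if_neg hy, smul_zero]

/-! ### The action of the factors on the zero weight space -/

/-- The vectors `bv x ⊗ bv (-x)` of weight zero. -/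
def zw (n : ℕ) (x : ℤ) : V n ⊗[ℂ] V n := bv x ⊗ₜ bv (-x)

/-- The coordinate of a vector of `V` at `bv x`. -/
def coordV (n : ℕ) (x : ℤ) : V n →ₗ[ℂ] ℂ := bvLift fun w => if w = x then 1 else 0

/-- The coordinate of a vector of `V ⊗ V` at `bv x ⊗ bv (-x)`. -/
def zeroCoord (n : ℕ) (x : ℤ) : V n ⊗[ℂ] V n →ₗ[ℂ] ℂ :=
  TensorProduct.lift ((LinearMap.mul ℂ ℂ).compl₁₂ (coordV n x) (coordV n (-x)))

theorem zeroCoord_tmul (x : ℤ) (a b : V n) :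
    zeroCoord n x (a ⊗ₜ b) = coordV n x a * coordV n (-x) b := rfl

theorem coordV_bv (x : ℤ) {w : ℤ} (h1 : -(n : ℤ) ≤ w) (h2 : w ≤ n) :
    coordV n x (bv w) = if w = x then 1 else 0 := bvLift_bv _ h1 h2

theorem zeroCoord_zw (x : ℤ) {w : ℤ} (h1 : -(n : ℤ) ≤ w) (h2 : w ≤ n) :
    zeroCoord n x (zw n w) = if x = w then 1 else 0 := by
  rw [zw, zeroCoord_tmul, coordV_bv _ h1 h2, coordV_bv _ (by omega) (by omega)]
  split_ifs <;> first | omega | simp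

theorem coordV_un (x : ℤ) {p r : ℤ} (hp : -(n : ℤ) ≤ p ∧ p ≤ n) (hr : -(n : ℤ) ≤ r ∧ r ≤ n)
    (v : V n) : coordV n x (un p r v) = if p = x then coordV n r v else 0 := by
  refine LinearMap.congr_fun (f := coordV n x ∘ₗ un p r)
    (g := if p = x then coordV n r else 0) (hom_ext_bv fun w h1 h2 => ?_) v |>.trans ?_
  · rw [LinearMap.comp_apply, un_bv hr.1 hr.2]
    split_ifs with c1 c2 c2
    · rw [coordV_bv _ hp.1 hp.2, if_pos c2, coordV_bv _ h1 h2, if_pos c1]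
    · rw [coordV_bv _ hp.1 hp.2, if_neg c2]; rfl
    · rw [map_zero, coordV_bv _ h1 h2, if_neg c1]
    · rw [map_zero]; rfl
  · split_ifs <;> rfl

theorem zeroCoord_map_un {i p r s t : ℤ} (hp : -(n : ℤ) ≤ p ∧ p ≤ n) (hr : -(n : ℤ) ≤ r ∧ r ≤ n)
    (hs : -(n : ℤ) ≤ s ∧ s ≤ n) (ht : -(n : ℤ) ≤ t ∧ t ≤ n) (u : V n ⊗[ℂ] V n) :
    zeroCoord n i (TensorProduct.map (un p r) (un s t) u) =
      if p = i ∧ s = -i then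
        TensorProduct.lift ((LinearMap.mul ℂ ℂ).compl₁₂ (coordV n r) (coordV n t)) u else 0 := by
  induction u with
  | zero => simp
  | add u v hu hv => rw [map_add, map_add, hu, hv, map_add]; split_ifs <;> simp
  | tmul a b =>
    rw [TensorProduct.map_tmul, zeroCoord_tmul, coordV_un _ hp hr, coordV_un _ hs ht]
    split_ifs <;> first | rfl | omega | simp

section Factor

variable {hq : Generic q} {E F : Weight n → Uq n q} {x y : ℤ}

/-- A factor of the `R`-matrix acts on the vectors `zw n b` by column operations. -/
theorem RtildeFactor_zw (hl : IsNormalOrdering l)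
    (hEF : IsRootVectors l E F) (h1 : -(n : ℤ) ≤ x) (h2 : x < y) (h3 : x + y < 0) (b : ℤ) :
    RtildeFactor hq E F (rt x y) (zw n b) = zw n b +
      (if b = y then ((q - q⁻¹) * rootRatio q l x y) • zw n x else 0) +
      (if b = -x then ((q - q⁻¹) * rootRatio q l (-y) (-x)) • zw n (-y) else 0) +
      (if b = -x ∧ y = 0 then ((q - q⁻¹) * (q + 1)) • zw n x else 0) := by
  have hσ : oddSign x y * oddSign x y = 1 := by unfold oddSign; split_ifs <;> simp
  have hT : ∀ {p r s t : ℤ}, -(n : ℤ) ≤ r → r ≤ n → -(n : ℤ) ≤ t → t ≤ n →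
      TensorProduct.map (un p r) (un s t) (zw n b) =
        if b = r ∧ -b = t then (bv p : V n) ⊗ₜ[ℂ] (bv s : V n) else 0 := by
    intro p r s t a1 a2 a3 a4
    rw [zw, TensorProduct.map_tmul, un_bv a1 a2, un_bv a3 a4]
    split_ifs <;> first | rfl | omega | simp
  rw [RtildeFactor_eq hl hEF h1 h2 h3, LinearMap.add_apply, LinearMap.add_apply,
    Module.End.one_apply, LinearMap.smul_apply, rootTensor]
  simp only [LinearMap.add_apply, LinearMap.smul_apply]
  rw [hT (by omega) (by omega) (by omega) (by omega), hT (by omega) (by omega) (by omega) (by omega),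
    hT (by omega) (by omega) (by omega) (by omega), hT (by omega) (by omega) (by omega) (by omega),
    if_neg (by omega), if_neg (by omega), zero_add, zero_add, smul_add, smul_smul, smul_smul,
    ← add_assoc]
  congr 1
  · congr 1
    · congr 1
      by_cases c : b = y
      · rw [if_pos (by omega), if_pos c, zw]
        congr 1
        linear_combination ((q - q⁻¹) * rootRatio q l x y) * hσ
      · rw [if_neg (by omega), if_neg c, smul_zero]
    · by_cases c : b = -x
      · rw [if_pos (by omega), if_pos c, zw, neg_neg]
        congr 1
        linear_combination ((q - q⁻¹) * rootRatio q l (-y) (-x)) * hσ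
      · rw [if_neg (by omega), if_neg c, smul_zero]
  · by_cases c : y = 0
    · rw [if_pos c, LinearMap.smul_apply, hT (by omega) (by omega) (by omega) (by omega)]
      by_cases c' : b = -x
      · rw [if_pos (by omega), if_pos ⟨c', c⟩, zw]
      · rw [if_neg (by omega), if_neg (by omega), smul_zero]
    · rw [if_neg c, if_neg (by omega), LinearMap.zero_apply]

/-- A factor of the `R`-matrix acts on the coordinates at the `zw n i` by row operations. -/
theorem zeroCoord_RtildeFactor (hl : IsNormalOrdering l)
    (hEF : IsRootVectors l E F) (h1 : -(n : ℤ) ≤ x) (h2 : x < y) (h3 : x + y < 0) (i : ℤ)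
    (u : V n ⊗[ℂ] V n) :
    zeroCoord n i (RtildeFactor hq E F (rt x y) u) = zeroCoord n i u +
      (if i = x then (q - q⁻¹) * rootRatio q l x y * zeroCoord n y u else 0) +
      (if i = -y then (q - q⁻¹) * rootRatio q l (-y) (-x) * zeroCoord n (-x) u else 0) +
      (if i = x ∧ y = 0 then (q - q⁻¹) * (q + 1) * zeroCoord n (-x) u else 0) := by
  have hσ : oddSign x y * oddSign x y = 1 := by unfold oddSign; split_ifs <;> simp
  have hx : -(n : ℤ) ≤ x ∧ x ≤ n := by omega
  have hy : -(n : ℤ) ≤ y ∧ y ≤ n := by omega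
  have hx' : -(n : ℤ) ≤ -x ∧ -x ≤ n := by omega
  have hy' : -(n : ℤ) ≤ -y ∧ -y ≤ n := by omega
  have z1 : TensorProduct.lift ((LinearMap.mul ℂ ℂ).compl₁₂ (coordV n y) (coordV n (-y))) u =
    zeroCoord n y u := rfl
  have z2 : TensorProduct.lift ((LinearMap.mul ℂ ℂ).compl₁₂ (coordV n (-x)) (coordV n x)) u =
    zeroCoord n (-x) u := by rw [zeroCoord, neg_neg]
  rw [RtildeFactor_eq hl hEF h1 h2 h3, LinearMap.add_apply, LinearMap.add_apply,
    Module.End.one_apply, LinearMap.smul_apply, rootTensor]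
  simp only [LinearMap.add_apply, LinearMap.smul_apply, map_add, map_smul, smul_eq_mul]
  rw [zeroCoord_map_un hx hy hy hx, zeroCoord_map_un hy' hx' hx' hy', zeroCoord_map_un hx hy hx' hy',
    zeroCoord_map_un hy' hx' hy hx, if_neg (by omega), if_neg (by omega), z1, z2, zero_add, zero_add,
    mul_add, ← add_assoc]
  congr 1
  · congr 1
    · congr 1
      by_cases c : i = x
      · rw [if_pos (by omega), if_pos c]
        linear_combination ((q - q⁻¹) * rootRatio q l x y * zeroCoord n y u) * hσ
      · rw [if_neg (by omega), if_neg c, mul_zero, mul_zero]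
    · by_cases c : i = -y
      · rw [if_pos (by omega), if_pos c]
        linear_combination ((q - q⁻¹) * rootRatio q l (-y) (-x) * zeroCoord n (-x) u) * hσ
      · rw [if_neg (by omega), if_neg c, mul_zero, mul_zero]
  · by_cases c : y = 0
    · rw [if_pos c, LinearMap.smul_apply, map_smul, zeroCoord_map_un hx hx' hx' hx, smul_eq_mul, z2]
      by_cases c' : i = x
      · rw [if_pos (by omega), if_pos ⟨c', c⟩]
      · rw [if_neg (by omega), if_neg (by omega), mul_zero]
    · rw [if_neg c, if_neg (by omega), LinearMap.zero_apply, map_zero]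

/-- The action of a factor of the `R`-matrix on a vector of non-zero weight. -/
theorem RtildeFactor_bv (hl : IsNormalOrdering l)
    (hEF : IsRootVectors l E F) (h1 : -(n : ℤ) ≤ x) (h2 : x < y) (h3 : x + y < 0) {a b : ℤ}
    (ha : -(n : ℤ) ≤ a ∧ a ≤ n) (hb : -(n : ℤ) ≤ b ∧ b ≤ n) (hab : a ≠ -b) :
    RtildeFactor hq E F (rt x y) (bv a ⊗ₜ bv b) = bv a ⊗ₜ bv b +
      (if b < a ∧ (rt b a : Weight n) = rt x y then
        (oddSign b a * (q - q⁻¹)) • (bv b ⊗ₜ bv a) else 0) := by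
  have hT : ∀ {p r s t : ℤ}, -(n : ℤ) ≤ r → r ≤ n → -(n : ℤ) ≤ t → t ≤ n →
      TensorProduct.map (un p r) (un s t) ((bv a : V n) ⊗ₜ[ℂ] (bv b : V n)) =
        if a = r ∧ b = t then (bv p : V n) ⊗ₜ[ℂ] (bv s : V n) else 0 := by
    intro p r s t a1 a2 a3 a4
    rw [TensorProduct.map_tmul, un_bv a1 a2, un_bv a3 a4]
    split_ifs <;> first | rfl | omega | simp
  have hiff : b < a ∧ (rt b a : Weight n) = rt x y ↔ a = y ∧ b = x ∨ a = -x ∧ b = -y := by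
    constructor
    · rintro ⟨c1, c2⟩
      rcases lt_or_gt_of_ne (show b + a ≠ 0 by omega) with c | c
      · have := rt_injective hb.1 c1 c h1 h2 h3 c2
        omega
      · rw [← rt_mirror] at c2
        have := rt_injective (by omega) (by omega) (by omega) h1 h2 h3 c2
        omega
    · rintro (⟨rfl, rfl⟩ | ⟨rfl, rfl⟩)
      · exact ⟨h2, rfl⟩
      · exact ⟨by omega, rt_mirror _ _⟩
  rw [RtildeFactor_eq hl hEF h1 h2 h3, LinearMap.add_apply, LinearMap.add_apply,
    Module.End.one_apply, LinearMap.smul_apply, rootTensor]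
  simp only [LinearMap.add_apply, LinearMap.smul_apply, hiff]
  rw [hT (by omega) (by omega) (by omega) (by omega), hT (by omega) (by omega) (by omega) (by omega),
    hT (by omega) (by omega) (by omega) (by omega), hT (by omega) (by omega) (by omega) (by omega),
    if_neg (show ¬ (a = y ∧ b = -y) by omega), if_neg (show ¬ (a = -x ∧ b = x) by omega)]
  have hlast : (if y = 0 then ((q - q⁻¹) * (q + 1)) • TensorProduct.map (un x (-x)) (un (-x) x)
      else 0 : Module.End ℂ (V n ⊗[ℂ] V n)) (bv a ⊗ₜ bv b) = 0 := by
    split_ifs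
    · rw [LinearMap.smul_apply, hT (by omega) (by omega) (by omega) (by omega), if_neg (by omega),
        smul_zero]
    · rfl
  rw [hlast, smul_zero, smul_zero, add_zero, add_zero, add_zero]
  congr 1
  by_cases c1 : a = y ∧ b = x
  · obtain ⟨rfl, rfl⟩ := c1
    rw [if_pos ⟨rfl, rfl⟩, if_neg (by omega), if_pos (Or.inl ⟨rfl, rfl⟩), add_zero]
  by_cases c2 : a = -x ∧ b = -y
  · obtain ⟨rfl, rfl⟩ := c2
    rw [if_neg c1, if_pos ⟨rfl, rfl⟩, if_pos (Or.inr ⟨rfl, rfl⟩), zero_add]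
    congr 2
    unfold oddSign
    simp only [neg_eq_zero, or_comm]
  · rw [if_neg c1, if_neg c2, if_neg (by omega), add_zero, smul_zero]

end Factor

/-! ### The `R`-matrix on the zero weight space -/

section Reverse

variable {l : List (Weight n)}

theorem rho_lt_length (hl : IsNormalOrdering l) {x y : ℤ} (h1 : -(n : ℤ) ≤ x) (h2 : x < y)
    (h3 : y ≤ n) : rho l x y < l.length :=
  List.idxOf_lt_length_of_mem ((hl.mem_iff _).2 (rt_mem h1 h2 h3))

theorem idxOf_reverse_add {α : Type*} [DecidableEq α] {l : List α} (hl : l.Nodup) {a : α}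
    (ha : a ∈ l) : l.reverse.idxOf a + l.idxOf a + 1 = l.length := by
  have h1 := List.idxOf_lt_length_of_mem ha
  have h2 : l.reverse[l.length - 1 - l.idxOf a]'(by rw [List.length_reverse]; omega) = a := by
    rw [List.getElem_reverse]
    have : l.length - 1 - (l.length - 1 - l.idxOf a) = l.idxOf a := by omega
    simp only [this]
    exact List.getElem_idxOf h1
  have h3 := (List.nodup_reverse.2 hl).idxOf_getElem (l.length - 1 - l.idxOf a)
    (by rw [List.length_reverse]; omega)
  rw [h2] at h3
  omega

theorem rho_reverse_add (hl : IsNormalOrdering l) {x y : ℤ} (h1 : -(n : ℤ) ≤ x) (h2 : x < y)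
    (h3 : y ≤ n) : rho l.reverse x y + rho l x y + 1 = l.length :=
  idxOf_reverse_add hl.nodup ((hl.mem_iff _).2 (rt_mem h1 h2 h3))

/-- The reverse of a normal ordering is a normal ordering. -/
theorem IsNormalOrdering.reverse (hl : IsNormalOrdering l) : IsNormalOrdering l.reverse where
  nodup := List.nodup_reverse.2 hl.nodup
  mem_iff γ := by rw [List.mem_reverse, hl.mem_iff]
  normal α hα β hβ h hαβ := by
    unfold Before at h ⊢
    have e1 := idxOf_reverse_add hl.nodup ((hl.mem_iff _).2 hα)
    have e2 := idxOf_reverse_add hl.nodup ((hl.mem_iff _).2 hβ)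
    have e3 := idxOf_reverse_add hl.nodup ((hl.mem_iff _).2 hαβ)
    have := hl.normal β hβ α hα (show l.idxOf β < l.idxOf α by omega) (by rwa [add_comm])
    unfold Before at this
    rw [add_comm β α] at this
    omega

theorem ordExp_reverse (hl : IsNormalOrdering l) {x y : ℤ} (h1 : -(n : ℤ) ≤ x) (h2 : y ≤ n) :
    ordExp l.reverse x y = -ordExp l x y := by
  rw [ordExp, ordExp, ← Finset.sum_neg_distrib]
  refine Finset.sum_congr rfl fun m hm => ?_
  rw [Finset.mem_Ioo] at hm
  by_cases hm0 : m = 0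
  · rw [if_pos hm0, if_pos hm0, neg_zero]
  · have e1 := rho_reverse_add hl h1 hm.1 (by omega)
    have e2 := rho_reverse_add hl (by omega) hm.2 h2
    have := hl.convex h1 hm.1 hm.2 h2 (by omega)
    rw [if_neg hm0, if_neg hm0]
    split_ifs <;> omega

theorem rootRatio_reverse (hl : IsNormalOrdering l) {x y : ℤ} (h1 : -(n : ℤ) ≤ x) (h2 : y ≤ n) :
    rootRatio q l.reverse x y = rootRatio q l (-y) (-x) := by
  rw [rootRatio, rootRatio, ordExp_reverse hl h1 h2, ordExp_mirror hl h1 h2, cs_mirror, hs_neg,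
    hs_neg, mul_comm (hs y)]

end Reverse

/-- The entry in row `i` and column `b` of the matrix of `R̃` on the zero weight space, for
`i < b`. -/
def zeroEntry (q : ℂ) (i b : ℤ) : ℂ :=
  hs i * hs b * ((q - q⁻¹) * ((if b = -i then q else 0) -
    cs i b * q ^ (-(b - i - 1 - if i < 0 ∧ 0 < b then 1 else 0))))

/-- The entries are symmetric about the antidiagonal. -/
theorem zeroEntry_mirror (i b : ℤ) : zeroEntry q (-b) (-i) = zeroEntry q i b := by
  have e1 : -i = - -b ↔ b = -i := by omega
  have e2 : -b < 0 ∧ 0 < -i ↔ i < 0 ∧ 0 < b := by omega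
  rw [zeroEntry, zeroEntry, cs_mirror, hs_neg, hs_neg, mul_comm (hs b)]
  simp only [e1, e2]
  congr 6
  ring

theorem partEntry_length {l : List (Weight n)} (hl : IsNormalOrdering l) {i b : ℤ}
    (h1 : -(n : ℤ) ≤ i) (h2 : i < b) (h3 : b ≤ n) :
    partEntry q l l.length i b = zeroEntry q i b := by
  have e : partExp l l.length i b = -(b - i - 1 - if i < 0 ∧ 0 < b then 1 else 0) := by
    have e1 : ∀ m ∈ Finset.Ioo i b, (if m = 0 then (0 : ℤ) else if rho l m b < l.length then -1
        else 1) = (if m = 0 then 1 else 0) + (-1) := fun m hm => by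
      rw [Finset.mem_Ioo] at hm
      rw [if_pos (rho_lt_length hl (by omega) hm.2 h3)]
      split_ifs <;> rfl
    rw [partExp, Finset.sum_congr rfl e1, Finset.sum_add_distrib, Finset.sum_ite_eq',
      Finset.sum_const, Int.card_Ioo]
    simp only [Finset.mem_Ioo, smul_neg, nsmul_eq_mul, mul_one]
    have : ((b - i - 1).toNat : ℤ) = b - i - 1 := Int.toNat_of_nonneg (by omega)
    rw [this]
    ring
  rw [partEntry, if_pos (rho_lt_length hl h1 h2 h3), e, zeroEntry]

section Product

variable {l : List (Weight n)} {hq : Generic q} {E F : Weight n → Uq n q}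

/-- The products of the first factors of `R̃` satisfy the column operations. -/
theorem columnRec_take (hl : IsNormalOrdering l) (hEF : IsRootVectors l E F) :
    ColumnRec q l fun p i b =>
      zeroCoord n i (((l.take p).map (RtildeFactor hq E F)).prod (zw n b)) := by
  intro x y h1 h2 h3 i b _ _ _ _
  have hlt := rho_lt_length hl h1 h2 (by omega)
  have hget : l[rho l x y] = rt x y := List.getElem_idxOf hlt
  have hstep : ((l.take (rho l x y + 1)).map (RtildeFactor hq E F)).prod =
      ((l.take (rho l x y)).map (RtildeFactor hq E F)).prod * RtildeFactor hq E F (rt x y) := by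
    rw [← List.take_append_getElem hlt, List.map_append, List.prod_append, List.map_singleton,
      List.prod_singleton, hget]
  simp only [hstep, Module.End.mul_apply, RtildeFactor_zw hl hEF h1 h2 h3, map_add]
  congr 1
  · congr 1
    · congr 1
      split_ifs <;> simp
    · split_ifs <;> simp
  · split_ifs <;> simp

/-- The products of the last factors of `R̃` satisfy, in the mirror image, the column operations for
the reversed ordering. -/
theorem columnRec_drop (hl : IsNormalOrdering l) (hEF : IsRootVectors l E F) :
    ColumnRec q l.reverse fun p i b =>
      zeroCoord n (-b) (((l.drop (l.length - p)).map (RtildeFactor hq E F)).prod (zw n (-i))) := by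
  intro x y h1 h2 h3 i b _ _ _ _
  have hlt := rho_lt_length hl h1 h2 (by omega)
  have hrev := rho_reverse_add hl h1 h2 (by omega)
  have hget : l[rho l x y] = rt x y := List.getElem_idxOf hlt
  have e1 : l.length - (rho l.reverse x y + 1) = rho l x y := by omega
  have e2 : l.length - rho l.reverse x y = rho l x y + 1 := by omega
  simp only [e1, e2]
  rw [List.drop_eq_getElem_cons hlt, List.map_cons, List.prod_cons, Module.End.mul_apply, hget,
    zeroCoord_RtildeFactor hl hEF h1 h2 h3, rootRatio_reverse hl h1 (by omega),
    rootRatio_reverse hl (show -(n : ℤ) ≤ -y by omega) (by omega), neg_neg, neg_neg]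
  have c1 : -b = x ↔ b = -x := by omega
  have c2 : -b = -y ↔ b = y := by omega
  simp only [c1, c2]
  ring

/-- The matrix of `R̃` on the zero weight space. The entries with `i + b ≤ 0` are computed from the
products of the first factors, those with `i + b ≥ 0` from the products of the last factors. -/
theorem zeroCoord_Rtilde (hl : IsNormalOrdering l) (hEF : IsRootVectors l E F) {i b : ℤ}
    (hi : -(n : ℤ) ≤ i) (hi' : i ≤ n) (hb : -(n : ℤ) ≤ b) (hb' : b ≤ n) :
    zeroCoord n i (Rtilde hq l E F (zw n b)) =
      if i = b then 1 else if i < b then zeroEntry q i b else 0 := by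
  have A := (columnRec_take (hq := hq) hl hEF).eq_partEntry hq.1 hl
    (fun i b h1 h2 => by simp [zeroCoord_zw i h1 h2]) le_rfl hi hi' hb hb'
  have B := (columnRec_drop (hq := hq) hl hEF).eq_partEntry hq.1 hl.reverse
    (fun i b h1 h2 => ?_) (p := l.length) (List.length_reverse).ge (i := -b) (b := -i) (by omega)
    (by omega) (by omega) (by omega)
  · simp only [List.take_length, Nat.sub_self, List.drop_zero, neg_neg] at A B
    change (b < i → zeroCoord n i (Rtilde hq l E F (zw n b)) = _) ∧ _ at A
    change (_ → zeroCoord n i (Rtilde hq l E F (zw n b)) = _) ∧ _ at B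
    rcases lt_trichotomy i b with h | h | h
    · rw [if_neg h.ne, if_pos h]
      rcases le_total (i + b) 0 with h' | h'
      · rw [← partEntry_length hl hi h hb']
        exact A.2.2 h h'
      · rw [← zeroEntry_mirror, ← partEntry_length hl.reverse (by omega) (by omega) (by omega),
          List.length_reverse]
        exact B.2.2 (by omega) (by omega)
    · rw [if_pos h]
      exact A.2.1 h
    · rw [if_neg h.ne', if_neg h.not_gt]
      exact A.1 h
  · simp only [Nat.sub_zero, List.drop_length, List.map_nil, List.prod_nil, Module.End.one_apply]
    by_cases h : -(n : ℤ) ≤ i ∧ i ≤ n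
    · rw [zeroCoord_zw _ (by omega) (by omega)]
      split_ifs <;> first | rfl | omega
    · rw [zw, bv_of_not (by omega), TensorProduct.zero_tmul, map_zero, if_neg (by omega)]

/-- The zero weight space of `V ⊗ V`. -/
def zeroSpace (n : ℕ) : Submodule ℂ (V n ⊗[ℂ] V n) := Submodule.span ℂ (Set.range (zw n))

theorem eq_sum_zeroCoord {u : V n ⊗[ℂ] V n} (hu : u ∈ zeroSpace n) :
    u = ∑ i ∈ Finset.Icc (-(n : ℤ)) n, zeroCoord n i u • zw n i := by
  induction hu using Submodule.span_induction with
  | mem u hu =>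
    obtain ⟨w, rfl⟩ := hu
    by_cases h : -(n : ℤ) ≤ w ∧ w ≤ n
    · simp_rw [zeroCoord_zw _ h.1 h.2, ite_smul, one_smul, zero_smul, Finset.sum_ite_eq']
      rw [if_pos (Finset.mem_Icc.2 h)]
    · have : zw n w = 0 := by rw [zw, bv_of_not h, TensorProduct.zero_tmul]
      simp [this]
  | zero => simp
  | add u v _ _ hu hv =>
    simp only [map_add, add_smul, Finset.sum_add_distrib]
    rw [← hu, ← hv]
  | smul c u _ hu =>
    simp only [map_smul, smul_assoc, ← Finset.smul_sum]
    rw [← hu]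

theorem Rtilde_mem_zeroSpace (hl : IsNormalOrdering l) (hEF : IsRootVectors l E F)
    {u : V n ⊗[ℂ] V n} (hu : u ∈ zeroSpace n) : Rtilde hq l E F u ∈ zeroSpace n := by
  have hz : ∀ w, zw n w ∈ zeroSpace n := fun w => Submodule.subset_span ⟨w, rfl⟩
  have hf : ∀ γ ∈ l, ∀ u ∈ zeroSpace n, RtildeFactor hq E F γ u ∈ zeroSpace n := by
    intro γ hγ u hu
    obtain ⟨x, y, h1, h2, h3, rfl⟩ := exists_rt_of_mem ((hl.mem_iff _).1 hγ)
    induction hu using Submodule.span_induction with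
    | mem u hu =>
      obtain ⟨w, rfl⟩ := hu
      rw [RtildeFactor_zw hl hEF h1 h2 h3]
      have hite : ∀ (P : Prop) [Decidable P] (c : ℂ) (w : ℤ),
          (if P then c • zw n w else 0) ∈ zeroSpace n := fun P _ c w => by
        split_ifs
        · exact Submodule.smul_mem _ _ (hz w)
        · exact Submodule.zero_mem _
      exact add_mem (add_mem (add_mem (hz w) (hite _ _ _)) (hite _ _ _)) (hite _ _ _)
    | zero => rw [map_zero]; exact Submodule.zero_mem _
    | add u v _ _ hu hv => rw [map_add]; exact add_mem hu hv
    | smul c u _ hu => rw [map_smul]; exact Submodule.smul_mem _ _ hu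
  rw [Rtilde]
  clear hEF hl
  induction l with
  | nil => exact hu
  | cons γ l ih =>
    rw [List.map_cons, List.prod_cons, Module.End.mul_apply]
    exact hf γ List.mem_cons_self _ (ih fun δ hδ => hf δ (List.mem_cons_of_mem _ hδ))

theorem Rtilde_zw (hl : IsNormalOrdering l) (hEF : IsRootVectors l E F) {b : ℤ}
    (hb : -(n : ℤ) ≤ b) (hb' : b ≤ n) : Rtilde hq l E F (zw n b) = zw n b +
      ∑ i ∈ Finset.Ico (-(n : ℤ)) b, zeroEntry q i b • zw n i := by
  rw [eq_sum_zeroCoord (Rtilde_mem_zeroSpace hl hEF (Submodule.subset_span ⟨b, rfl⟩))]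
  have e : ∀ i ∈ Finset.Icc (-(n : ℤ)) n, zeroCoord n i (Rtilde hq l E F (zw n b)) • zw n i =
      (if i = b then zw n i else 0) + if i < b then zeroEntry q i b • zw n i else 0 := fun i hi => by
    rw [Finset.mem_Icc] at hi
    rw [zeroCoord_Rtilde hl hEF hi.1 hi.2 hb hb']
    split_ifs <;> first | omega | simp
  rw [Finset.sum_congr rfl e, Finset.sum_add_distrib, Finset.sum_ite_eq',
    if_pos (Finset.mem_Icc.2 ⟨hb, hb'⟩), ← Finset.sum_filter]
  congr 2
  ext i
  simp only [Finset.mem_filter, Finset.mem_Icc, Finset.mem_Ico]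
  omega

/-! ### The `R`-matrix on the other weight spaces -/

/-- `R̃` on a vector of non-zero weight: only the factor of the root `rt b a` acts non-trivially. -/
theorem Rtilde_bv (hl : IsNormalOrdering l) (hEF : IsRootVectors l E F) {a b : ℤ}
    (ha : -(n : ℤ) ≤ a ∧ a ≤ n) (hb : -(n : ℤ) ≤ b ∧ b ≤ n) (hab : a ≠ -b) :
    Rtilde hq l E F (bv a ⊗ₜ bv b) = bv a ⊗ₜ bv b +
      (if b < a then (oddSign b a * (q - q⁻¹)) • (bv b ⊗ₜ bv a) else 0) := by
  have hf : ∀ γ ∈ l, ∀ {a b : ℤ}, -(n : ℤ) ≤ a ∧ a ≤ n → -(n : ℤ) ≤ b ∧ b ≤ n → a ≠ -b →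
      RtildeFactor hq E F γ (bv a ⊗ₜ bv b) = bv a ⊗ₜ bv b +
      (if b < a ∧ (rt b a : Weight n) = γ then
        (oddSign b a * (q - q⁻¹)) • (bv b ⊗ₜ bv a) else 0) := by
    intro γ hγ a b ha hb hab
    obtain ⟨x, y, h1, h2, h3, rfl⟩ := exists_rt_of_mem ((hl.mem_iff _).1 hγ)
    exact RtildeFactor_bv hl hEF h1 h2 h3 ha hb hab
  have key : ∀ l' : List (Weight n), l'.Nodup → (∀ γ ∈ l', γ ∈ l) →
      (l'.map (RtildeFactor hq E F)).prod (bv a ⊗ₜ bv b) = bv a ⊗ₜ bv b +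
      (if b < a ∧ (rt b a : Weight n) ∈ l' then
        (oddSign b a * (q - q⁻¹)) • (bv b ⊗ₜ bv a) else 0) := by
    intro l' hnd hsub
    induction l' with
    | nil => simp
    | cons γ l' ih =>
      have hγ := hsub γ List.mem_cons_self
      rw [List.map_cons, List.prod_cons, Module.End.mul_apply,
        ih (List.nodup_cons.1 hnd).2 fun δ hδ => hsub δ (List.mem_cons_of_mem _ hδ), map_add,
        hf γ hγ ha hb hab, add_assoc]
      congr 1
      simp only [List.mem_cons]
      by_cases h1 : b < a ∧ (rt b a : Weight n) ∈ l'
      · have hne : (rt b a : Weight n) ≠ γ := fun h => (List.nodup_cons.1 hnd).1 (h ▸ h1.2)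
        rw [if_pos h1, if_neg (fun h => hne h.2), if_pos ⟨h1.1, Or.inr h1.2⟩, map_smul,
          hf γ hγ hb ha (by omega), if_neg (fun h => absurd h.1 h1.1.not_gt), add_zero, zero_add]
      · rw [if_neg h1, map_zero, add_zero]
        refine if_congr ?_ rfl rfl
        tauto
  rw [Rtilde, key l hl.nodup fun _ h => h]
  congr 1
  refine if_congr ⟨fun h => h.1, fun h => ⟨h, ?_⟩⟩ rfl rfl
  exact (hl.mem_iff _).2 (rt_mem hb.1 h ha.2)

/-! ### The permuted `R`-matrix -/

theorem vvBasis_apply_lev {x y : ℤ} (hx : -(n : ℤ) ≤ x ∧ x ≤ n) (hy : -(n : ℤ) ≤ y ∧ y ≤ n) :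
    vvBasis n (⟨lev n x, lev_mem hx⟩, ⟨lev n y, lev_mem hy⟩) = bv x ⊗ₜ bv y := by
  rw [vvBasis, Module.Basis.tensorProduct_apply, vBasis_eq_vec, vBasis_eq_vec, bv_eq_vec hx,
    bv_eq_vec hy]

theorem gradedPerm_weightOp_bv {x y : ℤ} (hx : -(n : ℤ) ≤ x ∧ x ≤ n) (hy : -(n : ℤ) ≤ y ∧ y ≤ n) :
    gradedPerm n (weightOp n q (bv x ⊗ₜ bv y)) = swapC q x y • (bv y ⊗ₜ bv x) := by
  rw [← vvBasis_apply_lev hx hy, weightOp, Module.Basis.constr_basis, map_smul, gradedPerm,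
    Module.Basis.constr_basis, smul_smul, Prod.swap, vvBasis_apply_lev hy hx, eps_lev hx,
    eps_lev hy, wt_dot hx]
  have hp : ∀ z : ℤ, -(n : ℤ) ≤ z ∧ z ≤ n → vParity (lev n z) = if z = 0 then 0 else 1 :=
    fun z hz => if_congr (by unfold lev; split_ifs <;> omega) rfl rfl
  simp only [hp x hx, hp y hy]
  congr 1
  unfold swapC
  split_ifs <;> first | (exfalso; omega) | simp

theorem hs_zero : hs 0 = 1 := if_pos rfl

theorem hs_of_ne_zero {x : ℤ} (hx : x ≠ 0) : hs x = -(-1) ^ x := by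
  rw [hs, if_neg hx, pow_succ, ← zpow_natCast, Int.natCast_natAbs]
  rcases abs_choice x with h | h <;> rw [h]
  · ring
  · rw [zpow_neg, ← inv_zpow, inv_neg, inv_one]; ring

/-- The entries of `R̃` on the zero weight space, in terms of the invariant vector and the
invariant functional. -/
theorem swapC_mul_zeroEntry (h0 : q ≠ 0) {i b : ℤ} (h : i < b) :
    swapC q i (-i) * zeroEntry q i b =
      (q - q⁻¹) * capC q b * cupC q (-i) - if i = -b then q - q⁻¹ else 0 := by
  have hneg : ∀ k : ℤ, (-q) ^ k = (-1) ^ k * q ^ k := fun k => by rw [← mul_zpow, neg_one_mul]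
  have hsq : ∀ k : ℤ, (-1 : ℂ) ^ k * (-1) ^ k = 1 := fun k => by
    rw [← mul_zpow]; norm_num
  have hinv : ∀ k : ℤ, ((-1 : ℂ) ^ k)⁻¹ = (-1) ^ k := fun k => inv_eq_of_mul_eq_one_left (hsq k)
  have h1 : (-1 : ℂ) ≠ 0 := by norm_num
  have hqi : q ^ i ≠ 0 := zpow_ne_zero _ h0
  have hqb : q ^ b ≠ 0 := zpow_ne_zero _ h0
  have hpm : (-1 : ℂ) ^ b = 1 ∨ (-1 : ℂ) ^ b = -1 := mul_self_eq_one_iff.1 (hsq b)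
  unfold zeroEntry swapC cs capC cupC
  rcases lt_trichotomy i 0 with hi | rfl | hi
  · rcases lt_trichotomy b 0 with hb | rfl | hb
    · simp (disch := omega) only [if_neg, if_pos, if_true, hs_of_ne_zero]
      simp only [hneg, zpow_sub₀ h0, zpow_neg, hinv, zpow_one, neg_neg]
      field_simp
      ring
    · simp (disch := omega) only [if_neg, if_true, hs_of_ne_zero, hs_zero]
      simp only [hneg, zpow_sub₀ h0, zpow_neg, zpow_one, neg_neg, zpow_zero]
      field_simp
      ring
    · simp (disch := omega) only [if_neg, if_pos, if_true, hs_of_ne_zero]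
      by_cases hib : i = -b
      · subst hib
        simp (disch := omega) only [if_pos, if_true]
        simp only [hneg, zpow_sub₀ h0, zpow_sub₀ h1, zpow_neg, hinv, zpow_one, neg_neg]
        rcases hpm with e | e <;> simp only [e] <;> field_simp <;> ring
      · simp (disch := omega) only [if_neg]
        simp only [hneg, zpow_sub₀ h0, zpow_sub₀ h1, zpow_neg, zpow_one, neg_neg]
        rcases hpm with e | e <;> simp only [e] <;> field_simp <;> ring
  · simp (disch := omega) only [if_neg, if_pos, hs_of_ne_zero, hs_zero]
    simp only [hneg, zpow_sub₀ h0, zpow_sub₀ h1, zpow_neg, zpow_one, zpow_zero]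
    rcases hpm with e | e <;> simp only [e] <;> field_simp <;> ring
  · simp (disch := omega) only [if_neg, if_pos, if_true, hs_of_ne_zero]
    simp only [hneg, zpow_sub₀ h0, zpow_sub₀ h1, zpow_neg, zpow_one, neg_neg]
    rcases hpm with e | e <;> simp only [e] <;> field_simp <;> ring

/-- The permuted `R`-matrix is the explicit braid operator, whatever the normal ordering and the
root vectors. -/
theorem Rcheck_eq_braidOp (hl : IsNormalOrdering l) (hEF : IsRootVectors l E F) :
    Rcheck hq l E F = braidOp n q := by
  refine hom_ext_bv₂ fun x y h1 h2 h3 h4 => ?_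
  rw [Rcheck, Module.End.mul_apply, Module.End.mul_apply, braidOp_bv h1 h2 h3 h4]
  by_cases hxy : y = -x
  · subst hxy
    change gradedPerm n (weightOp n q (Rtilde hq l E F (zw n x))) = _
    rw [Rtilde_zw hl hEF h1 h2, map_add, map_add, zw, gradedPerm_weightOp_bv ⟨h1, h2⟩ ⟨h3, h4⟩,
      if_pos rfl, sub_add_eq_add_sub, add_sub_assoc]
    congr 1
    rw [cupPart, Finset.smul_sum, map_sum, map_sum]
    have e : (if -x < x then (q - q⁻¹) • ((bv x : V n) ⊗ₜ[ℂ] (bv (-x) : V n)) else 0) =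
        ∑ i ∈ Finset.Ico (-(n : ℤ)) x, if i = -x then (q - q⁻¹) • ((bv (-i) : V n) ⊗ₜ[ℂ] (bv i : V n))
          else 0 := by
      rw [Finset.sum_ite_eq']
      simp only [Finset.mem_Ico, neg_neg]
      exact if_congr (by omega) rfl rfl
    rw [e, ← Finset.sum_sub_distrib]
    refine Finset.sum_congr rfl fun i hi => ?_
    rw [Finset.mem_Ico] at hi
    rw [map_smul, map_smul, zw, gradedPerm_weightOp_bv (by omega) (by omega), smul_smul, mul_comm,
      swapC_mul_zeroEntry hq.1 hi.2, sub_smul, smul_smul]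
    congr 1
    split_ifs <;> simp
  · rw [Rtilde_bv hl hEF ⟨h1, h2⟩ ⟨h3, h4⟩ (by omega), map_add, map_add,
      gradedPerm_weightOp_bv ⟨h1, h2⟩ ⟨h3, h4⟩, if_neg hxy, add_zero,
      sub_eq_add_neg (swapC q x y • _)]
    congr 1
    split_ifs with h
    · rw [map_smul, map_smul, gradedPerm_weightOp_bv ⟨h3, h4⟩ ⟨h1, h2⟩, smul_smul, ← neg_smul]
      congr 1
      unfold oddSign swapC
      split_ifs <;> first | (exfalso; omega) | ring
    · simp

end Product

end

end OspBMW

theorem mainTheorem2 (n : ℕ) (hn : 1 ≤ n) (t : ℕ) (ht : 2 ≤ t) (q : ℂ) (hq : OspBMW.Generic q)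
    (l : List (OspBMW.Weight n)) (hl : OspBMW.IsNormalOrdering l)
    (E F : OspBMW.Weight n → OspBMW.Uq n q) (hEF : OspBMW.IsRootVectors l E F) :
    (∀ i : Fin (t - 1), IsUnit (OspBMW.Ri hq l E F i) ∧
      OspBMW.Ri hq l E F i ∈ OspBMW.EndU n t hq) ∧
    OspBMW.Ct hq l E F t ≤ OspBMW.EndU n t hq ∧
    ∃! Υ : OspBMW.BW t (-q ^ (2 * n)) q →ₐ[ℂ] OspBMW.Ct hq l E F t,
      ∀ i : Fin (t - 1), (Υ (OspBMW.BW.g (-q ^ (2 * n)) q i) : Module.End ℂ (OspBMW.TV n t)) =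
        -OspBMW.Ri hq l E F i := by exact OspBMW.exists_unique_of_Rcheck_eq hn hq (OspBMW.Rcheck_eq_braidOp hl hEF) t
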